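/- Work in intensional Martin-Löf type theory with $\Pi$-types (with judgmental $\eta$), $\Sigma$-types, coproducts, $\mathbf 0$, $\mathbf 1$, $\mathbb N$, identity types and a cumulative hierarchy of universes $\mathcal U_0 : \mathcal U_1 : \mathcal U_2 : \cdots$ (the theory of Appendix A.2 of *Homotopy Type Theory: Univalent Foundations of Mathematics*), in which the univalence axiom is assumed for every universe $\mathcal U_i$. No function extensionality axiom, truncations or higher inductive types are assumed. Let $\mathbf 2 := \mathbf 1 + \mathbf 1$. For a pointed type $(A,a)$ put $\Omega(A,a) := (a =_A a, \mathsf{refl}_a)$, $\Omega^0(A,a) := (A,a)$ and $\Omega^{k+1}(A,a) := \Omega^k(\Omega(A,a))$. Put $\mathsf{is}\text{-}(-2)\text{-}\mathsf{type}(A) := \sum_{a:A}\prod_{x:A} a = x$ and $\mathsf{is}\text{-}(k+1)\text{-}\mathsf{type}(A) := \prod_{x,y:A} \mathsf{is}\text{-}k\text{-}\mathsf{type}(x = y)$. Let $\mathcal U_n^{\le n} := \sum_{A : \mathcal U_n} \mathsf{is}\text{-}n\text{-}\mathsf{type}(A)$ be the type of $n$-types in $\mathcal U_n$. Define $\mathsf{Loop}_{-1}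 := \mathbf 2 : \mathcal U_0$ and, for $n \ge 0$, $\mathsf{Loop}_n := \sum_{X : \mathcal U_n^{\le n}} \Omega^{n+1}(\mathcal U_n^{\le n}, X) : \mathcal U_{n+1}$ (where $\Omega^{n+1}(\ldots)$ stands for its underlying type). A *non-trivial inhabitant* of a pointed type $(A,a)$ is a term $b : A$ together with a term of type $\neg (a =_A b)$. **Lemma.** For every (external) natural number $n \ge 0$, one can derive in this theory, in the empty context: 1. a non-trivial inhabitant of $\Omega^{n+1}(\mathcal U_n, \mathsf{Loop}_{n-1})$; 2. the fact that $\mathsf{Loop}_{n-1}$ is an $n$-type, i.e. there is a closed term $h_n : \mathsf{is}\text{-}n\text{-}\mathsf{type}(\mathsf{Loop}_{n-1})$; and, for every such closed term $h_n$, a non-trivial inhabitant of $\Omega^{n+1}\big(\mathcal U_n^{\le n}, (\mathsf{Loop}_{n-1}, h_n)\big)$. -/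

import Mathlib

/-! Intensional Martin-Löf type theory with a cumulative hierarchy of univalent universes, given by
raw terms (with de Bruijn indices) and an inductive derivability predicate, and the loop spaces of
that theory. -/

namespace HoTT

/-- Raw terms. Variables are de Bruijn indices: `var 0` is bound by the innermost binder.
The comments say in how many additional variables the arguments live. -/
inductive Tm : Type
  | var (k : ℕ)
  /-- the universe `U_i` -/
  | U (i : ℕ)
  /-- `Π (x : A), B`; `B` binds `x` -/
  | pi (A B : Tm)
  /-- `λ (x : A), b`; `b` binds `x` -/
  | lam (A b : Tm)
  | app (f a : Tm)
  /-- `Σ (x : A), B`; `B` binds `x` -/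
  | sigma (A B : Tm)
  | pair (a b : Tm)
  /-- `ind_{Σ (x : A), B} (z.C, x.y.g, p)`; `B` binds one variable, `C` one, `g` two -/
  | sigmaInd (A B C g p : Tm)
  /-- the coproduct `A + B` -/
  | sum (A B : Tm)
  | inl (a : Tm)
  | inr (b : Tm)
  /-- `ind_{A + B} (z.C, x.c, y.d, e)`; each of `C`, `c`, `d` binds one variable -/
  | sumInd (A B C c d e : Tm)
  /-- the empty type `0` -/
  | empty
  /-- `ind_0 (z.C, e)`; `C` binds one variable -/
  | emptyInd (C e : Tm)
  /-- the unit type `1` -/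
  | unit
  | star
  /-- `ind_1 (z.C, c, e)`; `C` binds one variable -/
  | unitInd (C c e : Tm)
  | nat
  | zero
  | succ (m : Tm)
  /-- `ind_ℕ (z.C, c₀, x.y.cₛ, m)`; `C` binds one variable, `cₛ` two -/
  | natInd (C c₀ cₛ m : Tm)
  /-- the identity type `a =_A b` -/
  | id (A a b : Tm)
  | refl (a : Tm)
  /-- `ind_{=_A} (x.y.p.C, z.c, a, b, q)`; `C` binds three variables, `c` one -/
  | idInd (A C c a b q : Tm)
  /-- the constant that inhabits the univalence axiom for `U_i` -/
  | univalence (i : ℕ)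

namespace Tm

/-- The renaming `ρ`, extended under a binder. -/
def upRen (ρ : ℕ → ℕ) : ℕ → ℕ
  | 0 => 0
  | k + 1 => ρ k + 1

/-- Renaming of variables. -/
def rename : (ℕ → ℕ) → Tm → Tm
  | ρ, var k => var (ρ k)
  | _, U i => U i
  | ρ, pi A B => pi (rename ρ A) (rename (upRen ρ) B)
  | ρ, lam A b => lam (rename ρ A) (rename (upRen ρ) b)
  | ρ, app f a => app (rename ρ f) (rename ρ a)
  | ρ, sigma A B => sigma (rename ρ A) (rename (upRen ρ) B)
  | ρ, pair a b => pair (rename ρ a) (rename ρ b)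
  | ρ, sigmaInd A B C g p =>
      sigmaInd (rename ρ A) (rename (upRen ρ) B) (rename (upRen ρ) C)
        (rename (upRen (upRen ρ)) g) (rename ρ p)
  | ρ, sum A B => sum (rename ρ A) (rename ρ B)
  | ρ, inl a => inl (rename ρ a)
  | ρ, inr b => inr (rename ρ b)
  | ρ, sumInd A B C c d e =>
      sumInd (rename ρ A) (rename ρ B) (rename (upRen ρ) C) (rename (upRen ρ) c)
        (rename (upRen ρ) d) (rename ρ e)
  | _, empty => empty
  | ρ, emptyInd C e => emptyInd (rename (upRen ρ) C) (rename ρ e)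
  | _, unit => unit
  | _, star => star
  | ρ, unitInd C c e => unitInd (rename (upRen ρ) C) (rename ρ c) (rename ρ e)
  | _, nat => nat
  | _, zero => zero
  | ρ, succ m => succ (rename ρ m)
  | ρ, natInd C c₀ cₛ m =>
      natInd (rename (upRen ρ) C) (rename ρ c₀) (rename (upRen (upRen ρ)) cₛ) (rename ρ m)
  | ρ, id A a b => id (rename ρ A) (rename ρ a) (rename ρ b)
  | ρ, refl a => refl (rename ρ a)
  | ρ, idInd A C c a b q =>
      idInd (rename ρ A) (rename (upRen (upRen (upRen ρ))) C) (rename (upRen ρ) c)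
        (rename ρ a) (rename ρ b) (rename ρ q)
  | _, univalence i => univalence i

/-- Weakening by `k` variables. -/
def lift (k : ℕ) (t : Tm) : Tm := rename (fun j => j + k) t

/-- The substitution that maps variable `0` to `a` and variable `k + 1` to `σ k`. -/
def cons (a : Tm) (σ : ℕ → Tm) : ℕ → Tm
  | 0 => a
  | k + 1 => σ k

/-- The substitution `σ`, extended under a binder. -/
def up (σ : ℕ → Tm) : ℕ → Tm := cons (var 0) (fun k => lift 1 (σ k))

/-- Simultaneous capture-avoiding substitution. -/
def subst : (ℕ → Tm) → Tm → Tm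
  | σ, var k => σ k
  | _, U i => U i
  | σ, pi A B => pi (subst σ A) (subst (up σ) B)
  | σ, lam A b => lam (subst σ A) (subst (up σ) b)
  | σ, app f a => app (subst σ f) (subst σ a)
  | σ, sigma A B => sigma (subst σ A) (subst (up σ) B)
  | σ, pair a b => pair (subst σ a) (subst σ b)
  | σ, sigmaInd A B C g p =>
      sigmaInd (subst σ A) (subst (up σ) B) (subst (up σ) C) (subst (up (up σ)) g) (subst σ p)
  | σ, sum A B => sum (subst σ A) (subst σ B)
  | σ, inl a => inl (subst σ a)
  | σ, inr b => inr (subst σ b)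
  | σ, sumInd A B C c d e =>
      sumInd (subst σ A) (subst σ B) (subst (up σ) C) (subst (up σ) c) (subst (up σ) d)
        (subst σ e)
  | _, empty => empty
  | σ, emptyInd C e => emptyInd (subst (up σ) C) (subst σ e)
  | _, unit => unit
  | _, star => star
  | σ, unitInd C c e => unitInd (subst (up σ) C) (subst σ c) (subst σ e)
  | _, nat => nat
  | _, zero => zero
  | σ, succ m => succ (subst σ m)
  | σ, natInd C c₀ cₛ m =>
      natInd (subst (up σ) C) (subst σ c₀) (subst (up (up σ)) cₛ) (subst σ m)
  | σ, id A a b => id (subst σ A) (subst σ a) (subst σ b)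
  | σ, refl a => refl (subst σ a)
  | σ, idInd A C c a b q =>
      idInd (subst σ A) (subst (up (up (up σ))) C) (subst (up σ) c) (subst σ a) (subst σ b)
        (subst σ q)
  | _, univalence i => univalence i

/-- `B[a/x]`, where `x` is the last variable of `B`. -/
def inst (B a : Tm) : Tm := subst (cons a var) B

/-- `g[a/x, b/y]`, where `x, y` are the last two variables of `g` (`y` being the last one). -/
def inst₂ (g a b : Tm) : Tm := subst (cons b (cons a var)) g

/-- `C[a/x, b/y, q/p]`, where `x, y, p` are the last three variables of `C`. -/
def inst₃ (C a b q : Tm) : Tm := subst (cons q (cons b (cons a var))) C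

/-- `C[t/z]`, where `z` is the last variable of `C` and `t` lives over `j` variables in place
of `z`. -/
def instAt (j : ℕ) (C t : Tm) : Tm := subst (cons t (fun k => var (k + j))) C

/-- For `x, y, p` the last three variables of `C`, the term `C[z/x, z/y, refl_z/p]`, where `z` is
one variable in place of these three. -/
def instRefl (C : Tm) : Tm :=
  subst (cons (refl (var 0)) (cons (var 0) (cons (var 0) (fun k => var (k + 1))))) C

/-! ### Defined types and terms -/

/-- The non-dependent function type `A → B`. -/
def arrow (A B : Tm) : Tm := pi A (lift 1 B)

/-- `¬ A`, that is `A → 0`. -/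
def neg (A : Tm) : Tm := arrow A empty

/-- The type `2` with exactly two elements. -/
def two : Tm := sum unit unit

/-- `Σ (a : A), Π (x : A), a = x`. -/
def isContr (A : Tm) : Tm := sigma A (pi (lift 1 A) (id (lift 2 A) (var 1) (var 0)))

/-- `isTrunc k A` is the type that says that `A` is a `(k - 2)`-type. -/
def isTrunc : ℕ → Tm → Tm
  | 0, A => isContr A
  | k + 1, A => pi A (pi (lift 1 A) (isTrunc k (id (lift 2 A) (var 1) (var 0))))

/-- `isType n A` says that `A` is an `n`-type, for a natural number `n`. -/
def isType (n : ℕ) (A : Tm) : Tm := isTrunc (n + 2) A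

/-- `isequiv f`, for `f : A → B`: for every `b : B`, the fibre `Σ (a : A), f a = b` is
contractible. -/
def isEquiv (A B f : Tm) : Tm :=
  pi B (isContr (sigma (lift 1 A) (id (lift 2 B) (app (lift 2 f) (var 0)) (var 1))))

/-- `A ≃ B`. -/
def equiv (A B : Tm) : Tm := sigma (arrow A B) (isEquiv (lift 1 A) (lift 1 B) (var 0))

/-- `Σ (a : A), a = b`, for `b : A`. -/
def basedPaths (A b : Tm) : Tm := sigma A (id (lift 1 A) (var 0) (lift 1 b))

/-- The canonical proof that the identity function of `A` is an equivalence: for `b : A`, the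
centre of the fibre is `(b, refl_b)`, and `(b, refl_b) = (x, y)` holds for `y : x = b` by path
induction. -/
def idIsEquiv (A : Tm) : Tm :=
  lam A (pair (pair (var 0) (refl (var 0)))
    (lam (basedPaths (lift 1 A) (var 0))
      (sigmaInd (lift 2 A) (id (lift 3 A) (var 0) (var 2))
        (id (basedPaths (lift 3 A) (var 2)) (pair (var 2) (refl (var 2))) (var 0))
        (idInd (lift 4 A)
          (id (basedPaths (lift 7 A) (var 1)) (pair (var 1) (refl (var 1)))
            (pair (var 2) (var 0)))
          (refl (pair (var 0) (refl (var 0))))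
          (var 1) (var 3) (var 0))
        (var 0))))

/-- The identity equivalence of `A`. -/
def idEquiv (A : Tm) : Tm := pair (lam A (var 0)) (idIsEquiv A)

/-- `idtoeqv : (A =_{U_i} B) → (A ≃ B)`, defined by path induction, which maps `refl` to the
identity equivalence. -/
def idtoeqv (i : ℕ) (A B : Tm) : Tm :=
  lam (id (U i) A B)
    (idInd (U i) (equiv (var 2) (var 1)) (idEquiv (var 0)) (lift 1 A) (lift 1 B) (var 0))

/-- The univalence axiom for `U_i`: the type
`Π (A : U_i), Π (B : U_i), isequiv (idtoeqv : (A =_{U_i} B) → (A ≃ B))`. -/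
def univalenceType (i : ℕ) : Tm :=
  pi (U i) (pi (U i)
    (isEquiv (id (U i) (var 1) (var 0)) (equiv (var 1) (var 0)) (idtoeqv i (var 1) (var 0))))

end Tm

open Tm

/-- A context lists the types of its variables, the type of `var 0` first. -/
abbrev Ctx := List Tm

/-- The three forms of judgment: `Γ ctx`, `Γ ⊢ a : A` and `Γ ⊢ a ≡ b : A`. -/
inductive Judgment : Type
  | ctx (Γ : Ctx)
  | tm (Γ : Ctx) (a A : Tm)
  | eq (Γ : Ctx) (a b A : Tm)

open Judgment

/-- Derivable judgments. -/
inductive Der : Judgment → Prop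
  /- contexts -/
  | ctx_nil : Der (ctx [])
  | ctx_cons {Γ A i} : Der (tm Γ A (U i)) → Der (ctx (A :: Γ))
  /- structural rules -/
  | var {Γ A k} : Der (ctx Γ) → Γ[k]? = some A → Der (tm Γ (var k) (lift (k + 1) A))
  | eq_refl {Γ a A} : Der (tm Γ a A) → Der (eq Γ a a A)
  | eq_symm {Γ a b A} : Der (eq Γ a b A) → Der (eq Γ b a A)
  | eq_trans {Γ a b c A} : Der (eq Γ a b A) → Der (eq Γ b c A) → Der (eq Γ a c A)
  | conv {Γ a A B i} : Der (tm Γ a A) → Der (eq Γ A B (U i)) → Der (tm Γ a B)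
  | eq_conv {Γ a b A B i} : Der (eq Γ a b A) → Der (eq Γ A B (U i)) → Der (eq Γ a b B)
  /- universes -/
  | U_intro {Γ i} : Der (ctx Γ) → Der (tm Γ (U i) (U (i + 1)))
  | U_cumul {Γ A i} : Der (tm Γ A (U i)) → Der (tm Γ A (U (i + 1)))
  | U_cumul_eq {Γ A B i} : Der (eq Γ A B (U i)) → Der (eq Γ A B (U (i + 1)))
  /- dependent function types -/
  | pi_form {Γ A B i} : Der (tm Γ A (U i)) → Der (tm (A :: Γ) B (U i)) →
      Der (tm Γ (pi A B) (U i))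
  | pi_form_eq {Γ A A' B B' i} : Der (eq Γ A A' (U i)) → Der (eq (A :: Γ) B B' (U i)) →
      Der (eq Γ (pi A B) (pi A' B') (U i))
  | pi_intro {Γ A B b} : Der (tm (A :: Γ) b B) → Der (tm Γ (lam A b) (pi A B))
  | pi_intro_eq {Γ A A' B b b' i} : Der (eq Γ A A' (U i)) → Der (eq (A :: Γ) b b' B) →
      Der (eq Γ (lam A b) (lam A' b') (pi A B))
  | pi_elim {Γ A B f a} : Der (tm Γ f (pi A B)) → Der (tm Γ a A) →
      Der (tm Γ (app f a) (inst B a))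
  | pi_elim_eq {Γ A B f f' a a'} : Der (eq Γ f f' (pi A B)) → Der (eq Γ a a' A) →
      Der (eq Γ (app f a) (app f' a') (inst B a))
  | pi_comp {Γ A B b a} : Der (tm (A :: Γ) b B) → Der (tm Γ a A) →
      Der (eq Γ (app (lam A b) a) (inst b a) (inst B a))
  | pi_uniq {Γ A B f} : Der (tm Γ f (pi A B)) →
      Der (eq Γ f (lam A (app (lift 1 f) (Tm.var 0))) (pi A B))
  /- dependent pair types -/
  | sigma_form {Γ A B i} : Der (tm Γ A (U i)) → Der (tm (A :: Γ) B (U i)) →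
      Der (tm Γ (sigma A B) (U i))
  | sigma_form_eq {Γ A A' B B' i} : Der (eq Γ A A' (U i)) → Der (eq (A :: Γ) B B' (U i)) →
      Der (eq Γ (sigma A B) (sigma A' B') (U i))
  | sigma_intro {Γ A B a b i} : Der (tm (A :: Γ) B (U i)) → Der (tm Γ a A) →
      Der (tm Γ b (inst B a)) → Der (tm Γ (pair a b) (sigma A B))
  | sigma_intro_eq {Γ A B a a' b b' i} : Der (tm (A :: Γ) B (U i)) → Der (eq Γ a a' A) →
      Der (eq Γ b b' (inst B a)) → Der (eq Γ (pair a b) (pair a' b') (sigma A B))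
  | sigma_elim {Γ A B C g p i} : Der (tm (sigma A B :: Γ) C (U i)) →
      Der (tm (B :: A :: Γ) g (instAt 2 C (pair (Tm.var 1) (Tm.var 0)))) →
      Der (tm Γ p (sigma A B)) → Der (tm Γ (sigmaInd A B C g p) (inst C p))
  | sigma_elim_eq {Γ A A' B B' C C' g g' p p' i j} : Der (eq Γ A A' (U j)) →
      Der (eq (A :: Γ) B B' (U j)) → Der (eq (sigma A B :: Γ) C C' (U i)) →
      Der (eq (B :: A :: Γ) g g' (instAt 2 C (pair (Tm.var 1) (Tm.var 0)))) →
      Der (eq Γ p p' (sigma A B)) →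
      Der (eq Γ (sigmaInd A B C g p) (sigmaInd A' B' C' g' p') (inst C p))
  | sigma_comp {Γ A B C g a b i} : Der (tm (sigma A B :: Γ) C (U i)) →
      Der (tm (B :: A :: Γ) g (instAt 2 C (pair (Tm.var 1) (Tm.var 0)))) →
      Der (tm Γ a A) → Der (tm Γ b (inst B a)) →
      Der (eq Γ (sigmaInd A B C g (pair a b)) (inst₂ g a b) (inst C (pair a b)))
  /- coproduct types -/
  | sum_form {Γ A B i} : Der (tm Γ A (U i)) → Der (tm Γ B (U i)) → Der (tm Γ (sum A B) (U i))
  | sum_form_eq {Γ A A' B B' i} : Der (eq Γ A A' (U i)) → Der (eq Γ B B' (U i)) →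
      Der (eq Γ (sum A B) (sum A' B') (U i))
  | sum_intro_inl {Γ A B a i} : Der (tm Γ A (U i)) → Der (tm Γ B (U i)) → Der (tm Γ a A) →
      Der (tm Γ (inl a) (sum A B))
  | sum_intro_inr {Γ A B b i} : Der (tm Γ A (U i)) → Der (tm Γ B (U i)) → Der (tm Γ b B) →
      Der (tm Γ (inr b) (sum A B))
  | sum_intro_inl_eq {Γ A B a a' i} : Der (tm Γ A (U i)) → Der (tm Γ B (U i)) →
      Der (eq Γ a a' A) → Der (eq Γ (inl a) (inl a') (sum A B))
  | sum_intro_inr_eq {Γ A B b b' i} : Der (tm Γ A (U i)) → Der (tm Γ B (U i)) →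
      Der (eq Γ b b' B) → Der (eq Γ (inr b) (inr b') (sum A B))
  | sum_elim {Γ A B C c d e i} : Der (tm (sum A B :: Γ) C (U i)) →
      Der (tm (A :: Γ) c (instAt 1 C (inl (Tm.var 0)))) →
      Der (tm (B :: Γ) d (instAt 1 C (inr (Tm.var 0)))) →
      Der (tm Γ e (sum A B)) → Der (tm Γ (sumInd A B C c d e) (inst C e))
  | sum_elim_eq {Γ A A' B B' C C' c c' d d' e e' i j} : Der (eq Γ A A' (U j)) →
      Der (eq Γ B B' (U j)) → Der (eq (sum A B :: Γ) C C' (U i)) →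
      Der (eq (A :: Γ) c c' (instAt 1 C (inl (Tm.var 0)))) →
      Der (eq (B :: Γ) d d' (instAt 1 C (inr (Tm.var 0)))) →
      Der (eq Γ e e' (sum A B)) →
      Der (eq Γ (sumInd A B C c d e) (sumInd A' B' C' c' d' e') (inst C e))
  | sum_comp_inl {Γ A B C c d a i} : Der (tm (sum A B :: Γ) C (U i)) →
      Der (tm (A :: Γ) c (instAt 1 C (inl (Tm.var 0)))) →
      Der (tm (B :: Γ) d (instAt 1 C (inr (Tm.var 0)))) →
      Der (tm Γ a A) →
      Der (eq Γ (sumInd A B C c d (inl a)) (inst c a) (inst C (inl a)))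
  | sum_comp_inr {Γ A B C c d b i} : Der (tm (sum A B :: Γ) C (U i)) →
      Der (tm (A :: Γ) c (instAt 1 C (inl (Tm.var 0)))) →
      Der (tm (B :: Γ) d (instAt 1 C (inr (Tm.var 0)))) →
      Der (tm Γ b B) →
      Der (eq Γ (sumInd A B C c d (inr b)) (inst d b) (inst C (inr b)))
  /- the empty type -/
  | empty_form {Γ i} : Der (ctx Γ) → Der (tm Γ empty (U i))
  | empty_elim {Γ C e i} : Der (tm (empty :: Γ) C (U i)) → Der (tm Γ e empty) →
      Der (tm Γ (emptyInd C e) (inst C e))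
  | empty_elim_eq {Γ C C' e e' i} : Der (eq (empty :: Γ) C C' (U i)) →
      Der (eq Γ e e' empty) → Der (eq Γ (emptyInd C e) (emptyInd C' e') (inst C e))
  /- the unit type -/
  | unit_form {Γ i} : Der (ctx Γ) → Der (tm Γ unit (U i))
  | unit_intro {Γ} : Der (ctx Γ) → Der (tm Γ star unit)
  | unit_elim {Γ C c e i} : Der (tm (unit :: Γ) C (U i)) → Der (tm Γ c (inst C star)) →
      Der (tm Γ e unit) → Der (tm Γ (unitInd C c e) (inst C e))
  | unit_elim_eq {Γ C C' c c' e e' i} : Der (eq (unit :: Γ) C C' (U i)) →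
      Der (eq Γ c c' (inst C star)) → Der (eq Γ e e' unit) →
      Der (eq Γ (unitInd C c e) (unitInd C' c' e') (inst C e))
  | unit_comp {Γ C c i} : Der (tm (unit :: Γ) C (U i)) → Der (tm Γ c (inst C star)) →
      Der (eq Γ (unitInd C c star) c (inst C star))
  /- natural numbers -/
  | nat_form {Γ i} : Der (ctx Γ) → Der (tm Γ nat (U i))
  | nat_intro_zero {Γ} : Der (ctx Γ) → Der (tm Γ zero nat)
  | nat_intro_succ {Γ m} : Der (tm Γ m nat) → Der (tm Γ (succ m) nat)
  | nat_intro_succ_eq {Γ m m'} : Der (eq Γ m m' nat) → Der (eq Γ (succ m) (succ m') nat)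
  | nat_elim {Γ C c₀ cₛ m i} : Der (tm (nat :: Γ) C (U i)) → Der (tm Γ c₀ (inst C zero)) →
      Der (tm (C :: nat :: Γ) cₛ (instAt 2 C (succ (Tm.var 1)))) → Der (tm Γ m nat) →
      Der (tm Γ (natInd C c₀ cₛ m) (inst C m))
  | nat_elim_eq {Γ C C' c₀ c₀' cₛ cₛ' m m' i} : Der (eq (nat :: Γ) C C' (U i)) →
      Der (eq Γ c₀ c₀' (inst C zero)) →
      Der (eq (C :: nat :: Γ) cₛ cₛ' (instAt 2 C (succ (Tm.var 1)))) → Der (eq Γ m m' nat) →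
      Der (eq Γ (natInd C c₀ cₛ m) (natInd C' c₀' cₛ' m') (inst C m))
  | nat_comp_zero {Γ C c₀ cₛ i} : Der (tm (nat :: Γ) C (U i)) → Der (tm Γ c₀ (inst C zero)) →
      Der (tm (C :: nat :: Γ) cₛ (instAt 2 C (succ (Tm.var 1)))) →
      Der (eq Γ (natInd C c₀ cₛ zero) c₀ (inst C zero))
  | nat_comp_succ {Γ C c₀ cₛ m i} : Der (tm (nat :: Γ) C (U i)) → Der (tm Γ c₀ (inst C zero)) →
      Der (tm (C :: nat :: Γ) cₛ (instAt 2 C (succ (Tm.var 1)))) → Der (tm Γ m nat) →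
      Der (eq Γ (natInd C c₀ cₛ (succ m)) (inst₂ cₛ m (natInd C c₀ cₛ m)) (inst C (succ m)))
  /- identity types -/
  | id_form {Γ A a b i} : Der (tm Γ A (U i)) → Der (tm Γ a A) → Der (tm Γ b A) →
      Der (tm Γ (id A a b) (U i))
  | id_form_eq {Γ A A' a a' b b' i} : Der (eq Γ A A' (U i)) → Der (eq Γ a a' A) →
      Der (eq Γ b b' A) → Der (eq Γ (id A a b) (id A' a' b') (U i))
  | id_intro {Γ A a i} : Der (tm Γ A (U i)) → Der (tm Γ a A) → Der (tm Γ (refl a) (id A a a))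
  | id_intro_eq {Γ A a a' i} : Der (tm Γ A (U i)) → Der (eq Γ a a' A) →
      Der (eq Γ (refl a) (refl a') (id A a a))
  | id_elim {Γ A C c a b q i} :
      Der (tm (id (lift 2 A) (Tm.var 1) (Tm.var 0) :: lift 1 A :: A :: Γ) C (U i)) →
      Der (tm (A :: Γ) c (instRefl C)) → Der (tm Γ a A) → Der (tm Γ b A) →
      Der (tm Γ q (id A a b)) → Der (tm Γ (idInd A C c a b q) (inst₃ C a b q))
  | id_elim_eq {Γ A A' C C' c c' a a' b b' q q' i j} : Der (eq Γ A A' (U j)) →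
      Der (eq (id (lift 2 A) (Tm.var 1) (Tm.var 0) :: lift 1 A :: A :: Γ) C C' (U i)) →
      Der (eq (A :: Γ) c c' (instRefl C)) → Der (eq Γ a a' A) → Der (eq Γ b b' A) →
      Der (eq Γ q q' (id A a b)) →
      Der (eq Γ (idInd A C c a b q) (idInd A' C' c' a' b' q') (inst₃ C a b q))
  | id_comp {Γ A C c a i} :
      Der (tm (id (lift 2 A) (Tm.var 1) (Tm.var 0) :: lift 1 A :: A :: Γ) C (U i)) →
      Der (tm (A :: Γ) c (instRefl C)) → Der (tm Γ a A) →
      Der (eq Γ (idInd A C c a a (refl a)) (inst c a) (inst₃ C a a (refl a)))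
  /- the univalence axiom for every universe -/
  | univalence_intro {Γ i} : Der (ctx Γ) → Der (tm Γ (univalence i) (univalenceType i))

/-- `⊢ a : A` in the empty context: the closed term `a` inhabits the closed type `A`. -/
def Inhabits (a A : Tm) : Prop := Der (tm [] a A)

/-! ### Pointed types, loop spaces, and the types of loops in the universes -/

/-- A pointed type `(A, a)` of the type theory, given by its underlying type and its basepoint. -/
structure Pointed : Type where
  carrier : Tm
  point : Tm

/-- `Ω (A, a) = (a =_A a, refl_a)`. -/
def Pointed.loop (X : Pointed) : Pointed := ⟨id X.carrier X.point X.point, refl X.point⟩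

/-- `Ω⁰ X = X` and `Ω^(n+1) X = Ω^n (Ω X)`. -/
def Pointed.iterLoop : ℕ → Pointed → Pointed
  | 0, X => X
  | n + 1, X => iterLoop n X.loop

/-- `U_i^{≤ n} = Σ (A : U_i), is-n-type A`, the type of `n`-types in `U_i` (a closed term). -/
def truncU (i n : ℕ) : Tm := sigma (U i) (isType n (Tm.var 0))

/-- `Loop_n = Σ (X : U_n^{≤ n}), Ω^(n+1) (U_n^{≤ n}, X)`, a closed term. -/
def loopType (n : ℕ) : Tm :=
  sigma (truncU n n) (Pointed.iterLoop (n + 1) ⟨lift 1 (truncU n n), Tm.var 0⟩).carrier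

/-- `loopTypePred n` is `Loop_{n-1}`, where `Loop_{-1} = 2`. -/
def loopTypePred : ℕ → Tm
  | 0 => two
  | n + 1 => loopType n

/-- The closed pointed type `X = (A, a)` has a non-trivial inhabitant: there are closed terms
`b : A` and `r : ¬ (a =_A b)`. -/
def HasNontrivialInhabitant (X : Pointed) : Prop :=
  ∃ b r : Tm, Inhabits b X.carrier ∧ Inhabits r (neg (id X.carrier X.point b))

end HoTT

/-! A global loop at a type is a family of local loops. By univalence and function extensionality,
an (n+2)-fold loop at `L` in a universe amounts to a choice, for every `w : L`, of an (n+1)-fold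
loop at `w` (`inh_loopU`). The type `L = Loop_n` is made so that such a choice is tautological. Its
points are pairs `(X, q)` with `q` an (n+1)-fold loop at `X`, and `q` itself lifts to an (n+1)-fold
loop at `(X, q)` (`inh_fixedLift`, `inh_loopsAt`). For `n = 0` the lift exists because transporting
`q` along itself conjugates `q` by `q` and gives back `q`. For `n > 0` it exists because the fibres
`Ω^(n+1)(U_n^{≤ n}, X)` are sets, so being fixed by transport is a proposition and loops lift to
subtypes.

If the loop at `L` so obtained were trivial, evaluation at one point `(X, q)` would make `q` trivial
(`inh_loopSumU`). The induction hypothesis supplies a non-trivial `q` at `X = Loop_{n-1}`.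
Truncatedness comes from `U_n^{≤ n}` being an (n+1)-type, with `Loop_n` a sum over it with sets as
fibres. Since being an (n+1)-type is a proposition, the loop in `U_{n+1}` lifts to one in the type
of (n+1)-types. The induction starts with the swap of `2`.

No equivalence of loop spaces is needed. It suffices that along a pointed retraction every loop
lifts to one whose triviality implies that of the original (`inh_loopPt`).

The universe grows with `n`, so the induction over `n` is external. Its step is uniform, however: it
is derived once for a variable `m : ℕ` in `U_0`, `U_1`, `U_2`, with truncatedness and loop spaces
defined by internal recursion. Derivations are stable under raising all universe levels
(`Der.shift`), and at a numeral the internal recursions unfold judgmentally to `isTrunc` and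
`iterLoop`.

The internal proofs are surface terms, elaborated with the help of a normalizer that is proved sound
for `Der` and evaluated by the kernel. Each lemma is elaborated with the earlier ones as variables
of the context. Univalence enters as such a variable, to be replaced by the constant. -/

namespace HoTT

/-! ### Admissible rules: renaming, substitution, raising of universe levels. -/

namespace Tm

/-! ### Substitution calculus -/

theorem up_comp_upRen (σ : ℕ → Tm) (ρ : ℕ → ℕ) : up σ ∘ upRen ρ = up (σ ∘ ρ) := by
  funext k; cases k <;> rfl

theorem up_var_comp (ρ : ℕ → ℕ) : up (var ∘ ρ) = var ∘ upRen ρ := by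
  funext k; cases k <;> rfl

theorem up_var : up var = var := by
  funext k; cases k <;> rfl

theorem rename_eq_subst (ρ : ℕ → ℕ) (t : Tm) : rename ρ t = subst (var ∘ ρ) t := by
  induction t generalizing ρ <;> simp_all [rename, subst, up_var_comp]

theorem subst_var (t : Tm) : subst var t = t := by
  induction t <;> simp_all [subst, up_var]

theorem subst_rename (σ : ℕ → Tm) (ρ : ℕ → ℕ) (t : Tm) :
    subst σ (rename ρ t) = subst (σ ∘ ρ) t := by
  induction t generalizing σ ρ <;> simp_all [rename, subst, up_comp_upRen]

theorem rename_rename (ρ ρ' : ℕ → ℕ) (t : Tm) :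
    rename ρ (rename ρ' t) = rename (ρ ∘ ρ') t := by
  rw [rename_eq_subst, subst_rename, rename_eq_subst]; rfl

theorem rename_comp_up (ρ : ℕ → ℕ) (σ : ℕ → Tm) :
    rename (upRen ρ) ∘ up σ = up (rename ρ ∘ σ) := by
  funext k
  cases k with
  | zero => rfl
  | succ k => simp only [Function.comp, up, cons, lift, rename_rename]; rfl

theorem rename_subst (ρ : ℕ → ℕ) (σ : ℕ → Tm) (t : Tm) :
    rename ρ (subst σ t) = subst (rename ρ ∘ σ) t := by
  induction t generalizing σ ρ <;> simp_all [rename, subst, rename_comp_up]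

theorem subst_comp_up (τ σ : ℕ → Tm) : subst (up τ) ∘ up σ = up (subst τ ∘ σ) := by
  funext k
  cases k with
  | zero => rfl
  | succ k => simp only [Function.comp, up, cons, lift, subst_rename, rename_subst]; rfl

/-- Going under a binder weakens the substituted terms, so the fusion laws that involve a renaming
(`subst_rename`, `rename_subst`) have to come before this one. -/
theorem subst_subst (τ σ : ℕ → Tm) (t : Tm) : subst τ (subst σ t) = subst (subst τ ∘ σ) t := by
  induction t generalizing σ τ <;> simp_all [subst, subst_comp_up]

theorem lift_eq_subst (k : ℕ) (t : Tm) : lift k t = subst (fun j => var (j + k)) t :=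
  rename_eq_subst _ _

theorem lift_zero (t : Tm) : lift 0 t = t := by
  rw [lift_eq_subst]; exact subst_var t

theorem lift_lift (j k : ℕ) (t : Tm) : lift j (lift k t) = lift (k + j) t := by
  simp only [lift, rename_rename]; congr 1; funext i; simp [add_assoc]

theorem subst_lift_one (σ : ℕ → Tm) (t : Tm) : subst (up σ) (lift 1 t) = lift 1 (subst σ t) := by
  simp only [lift, subst_rename, rename_subst]; rfl

theorem subst_lift_two (σ : ℕ → Tm) (t : Tm) :
    subst (up (up σ)) (lift 2 t) = lift 2 (subst σ t) := by
  rw [show 2 = 1 + 1 from rfl, ← lift_lift, ← lift_lift, subst_lift_one, subst_lift_one]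

theorem inst_lift (t a : Tm) : inst (lift 1 t) a = t := by
  simp only [inst, lift, subst_rename]; exact subst_var t

theorem subst_cons_lift (σ : ℕ → Tm) (t a : Tm) : subst (cons a σ) (lift 1 t) = subst σ t := by
  simp only [lift, subst_rename]; rfl

theorem subst_inst (σ : ℕ → Tm) (B a : Tm) :
    subst σ (inst B a) = inst (subst (up σ) B) (subst σ a) := by
  simp only [inst, subst_subst]
  congr 1; funext k
  cases k with
  | zero => rfl
  | succ k => simp [Function.comp, cons, up, subst, subst_cons_lift, subst_var]

theorem subst_inst₂ (σ : ℕ → Tm) (g a b : Tm) :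
    subst σ (inst₂ g a b) = inst₂ (subst (up (up σ)) g) (subst σ a) (subst σ b) := by
  simp only [inst₂, subst_subst]
  congr 1; funext k
  rcases k with _ | _ | k
  · rfl
  · rfl
  · simp [Function.comp, cons, up, subst, subst_cons_lift, subst_var]

theorem subst_inst₃ (σ : ℕ → Tm) (C a b q : Tm) :
    subst σ (inst₃ C a b q) =
      inst₃ (subst (up (up (up σ))) C) (subst σ a) (subst σ b) (subst σ q) := by
  simp only [inst₃, subst_subst]
  congr 1; funext k
  rcases k with _ | _ | _ | k
  · rfl
  · rfl
  · rfl
  · simp [Function.comp, cons, up, subst, subst_cons_lift, subst_var]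

theorem subst_instAt_one (σ : ℕ → Tm) (C t : Tm) :
    subst (up σ) (instAt 1 C t) = instAt 1 (subst (up σ) C) (subst (up σ) t) := by
  simp only [instAt, subst_subst]
  congr 1; funext k
  cases k with
  | zero => rfl
  | succ k =>
    simp only [Function.comp, cons, up, subst, subst_cons_lift]
    rw [lift_eq_subst]

theorem subst_instAt_two (σ : ℕ → Tm) (C t : Tm) :
    subst (up (up σ)) (instAt 2 C t) = instAt 2 (subst (up σ) C) (subst (up (up σ)) t) := by
  simp only [instAt, subst_subst]
  congr 1; funext k
  cases k with
  | zero => rfl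
  | succ k =>
    simp only [Function.comp, cons, up, subst, subst_cons_lift]
    rw [lift_lift, lift_eq_subst]

theorem subst_instRefl (σ : ℕ → Tm) (C : Tm) :
    subst (up σ) (instRefl C) = instRefl (subst (up (up (up σ))) C) := by
  simp only [instRefl, subst_subst]
  congr 1; funext k
  rcases k with _ | _ | _ | k
  · rfl
  · rfl
  · rfl
  · simp only [Function.comp, cons, up, subst, subst_cons_lift]
    rw [lift_eq_subst]

/-! ### Shifting universe levels -/

/-- Raises all universe levels by `k`. -/
def shift (k : ℕ) : Tm → Tm
  | var j => var j
  | U i => U (k + i)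
  | pi A B => pi (shift k A) (shift k B)
  | lam A b => lam (shift k A) (shift k b)
  | app f a => app (shift k f) (shift k a)
  | sigma A B => sigma (shift k A) (shift k B)
  | pair a b => pair (shift k a) (shift k b)
  | sigmaInd A B C g p => sigmaInd (shift k A) (shift k B) (shift k C) (shift k g) (shift k p)
  | sum A B => sum (shift k A) (shift k B)
  | inl a => inl (shift k a)
  | inr b => inr (shift k b)
  | sumInd A B C c d e =>
      sumInd (shift k A) (shift k B) (shift k C) (shift k c) (shift k d) (shift k e)
  | empty => empty
  | emptyInd C e => emptyInd (shift k C) (shift k e)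
  | unit => unit
  | star => star
  | unitInd C c e => unitInd (shift k C) (shift k c) (shift k e)
  | nat => nat
  | zero => zero
  | succ m => succ (shift k m)
  | natInd C c₀ cₛ m => natInd (shift k C) (shift k c₀) (shift k cₛ) (shift k m)
  | id A a b => id (shift k A) (shift k a) (shift k b)
  | refl a => refl (shift k a)
  | idInd A C c a b q =>
      idInd (shift k A) (shift k C) (shift k c) (shift k a) (shift k b) (shift k q)
  | univalence i => univalence (k + i)

theorem shift_rename (k : ℕ) (ρ : ℕ → ℕ) (t : Tm) :
    shift k (rename ρ t) = rename ρ (shift k t) := by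
  induction t generalizing ρ <;> simp_all [rename, shift]

theorem shift_lift (k j : ℕ) (t : Tm) : shift k (lift j t) = lift j (shift k t) :=
  shift_rename ..

theorem shift_comp_up (k : ℕ) (σ : ℕ → Tm) : shift k ∘ up σ = up (shift k ∘ σ) := by
  funext j
  cases j with
  | zero => rfl
  | succ j => exact shift_lift ..

theorem shift_subst (k : ℕ) (σ : ℕ → Tm) (t : Tm) :
    shift k (subst σ t) = subst (shift k ∘ σ) (shift k t) := by
  induction t generalizing σ <;> simp_all [subst, shift, shift_comp_up]

theorem shift_inst (k : ℕ) (B a : Tm) : shift k (inst B a) = inst (shift k B) (shift k a) := by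
  rw [inst, shift_subst]; congr 1; funext j; cases j <;> rfl

theorem shift_inst₂ (k : ℕ) (g a b : Tm) :
    shift k (inst₂ g a b) = inst₂ (shift k g) (shift k a) (shift k b) := by
  rw [inst₂, shift_subst]; congr 1; funext j; rcases j with _ | _ | j <;> rfl

theorem shift_inst₃ (k : ℕ) (C a b q : Tm) :
    shift k (inst₃ C a b q) = inst₃ (shift k C) (shift k a) (shift k b) (shift k q) := by
  rw [inst₃, shift_subst]; congr 1; funext j; rcases j with _ | _ | _ | j <;> rfl

theorem shift_instAt (k j : ℕ) (C t : Tm) :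
    shift k (instAt j C t) = instAt j (shift k C) (shift k t) := by
  rw [instAt, shift_subst]; congr 1; funext j; cases j <;> rfl

theorem shift_instRefl (k : ℕ) (C : Tm) : shift k (instRefl C) = instRefl (shift k C) := by
  rw [instRefl, shift_subst]; congr 1; funext j; rcases j with _ | _ | _ | j <;> rfl

end Tm

end HoTT

namespace HoTT

open Tm Judgment

/-! ### Stability of derivability under substitution -/

section Stability

variable (G : Ctx → (ℕ → Tm) → Ctx → Prop)

/-- The types in the context stay types under the substitutions in `G`. -/
def CtxStable : Ctx → Prop
  | [] => True
  | A :: Γ => CtxStable Γ ∧ ∀ Δ σ, Der (ctx Δ) → G Δ σ Γ → ∃ i, Der (tm Δ (subst σ A) (U i))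

/-- The judgment stays derivable under the substitutions in `G`. -/
def Stable : Judgment → Prop
  | ctx Γ => CtxStable G Γ
  | tm Γ a A => CtxStable G Γ ∧
      ∀ Δ σ, Der (ctx Δ) → G Δ σ Γ → Der (tm Δ (subst σ a) (subst σ A))
  | eq Γ a b A => CtxStable G Γ ∧
      ∀ Δ σ, Der (ctx Δ) → G Δ σ Γ → Der (eq Δ (subst σ a) (subst σ b) (subst σ A))

variable {G}
variable (hup : ∀ {Δ σ Γ A}, G Δ σ Γ → Der (ctx (subst σ A :: Δ)) →
  G (subst σ A :: Δ) (up σ) (A :: Γ))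

/-- Rules such as `pi_intro` have no premise that says that the domain is a type, but going under
the binder needs `σ A` to be one. This is why stability of a judgment includes stability of its
context. -/
theorem CtxStable.ext {Γ Δ : Ctx} {A : Tm} {σ : ℕ → Tm} (h : CtxStable G (A :: Γ))
    (hΔ : Der (ctx Δ)) (hσ : G Δ σ Γ) : Der (ctx (subst σ A :: Δ)) :=
  let ⟨_, hi⟩ := h.2 Δ σ hΔ hσ
  Der.ctx_cons hi

include hup

theorem Stable.under {Γ Δ : Ctx} {A b B : Tm} {σ : ℕ → Tm} (h : Stable G (tm (A :: Γ) b B))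
    (hΔ : Der (ctx Δ)) (hσ : G Δ σ Γ) :
    Der (tm (subst σ A :: Δ) (subst (up σ) b) (subst (up σ) B)) :=
  h.2 _ _ (h.1.ext hΔ hσ) (hup hσ (h.1.ext hΔ hσ))

theorem Stable.under_eq {Γ Δ : Ctx} {A b b' B : Tm} {σ : ℕ → Tm}
    (h : Stable G (eq (A :: Γ) b b' B)) (hΔ : Der (ctx Δ)) (hσ : G Δ σ Γ) :
    Der (eq (subst σ A :: Δ) (subst (up σ) b) (subst (up σ) b') (subst (up σ) B)) :=
  h.2 _ _ (h.1.ext hΔ hσ) (hup hσ (h.1.ext hΔ hσ))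

theorem Stable.under₂ {Γ Δ : Ctx} {A B b C : Tm} {σ : ℕ → Tm}
    (h : Stable G (tm (B :: A :: Γ) b C)) (hΔ : Der (ctx Δ)) (hσ : G Δ σ Γ) :
    Der (tm (subst (up σ) B :: subst σ A :: Δ) (subst (up (up σ)) b) (subst (up (up σ)) C)) :=
  h.under hup (h.1.1.ext hΔ hσ) (hup hσ (h.1.1.ext hΔ hσ))

theorem Stable.under₂_eq {Γ Δ : Ctx} {A B b b' C : Tm} {σ : ℕ → Tm}
    (h : Stable G (eq (B :: A :: Γ) b b' C)) (hΔ : Der (ctx Δ)) (hσ : G Δ σ Γ) :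
    Der (eq (subst (up σ) B :: subst σ A :: Δ) (subst (up (up σ)) b) (subst (up (up σ)) b')
      (subst (up (up σ)) C)) :=
  h.under_eq hup (h.1.1.ext hΔ hσ) (hup hσ (h.1.1.ext hΔ hσ))

theorem Stable.under_id {Γ Δ : Ctx} {A b C : Tm} {σ : ℕ → Tm}
    (h : Stable G (tm (id (lift 2 A) (var 1) (var 0) :: lift 1 A :: A :: Γ) b C))
    (hΔ : Der (ctx Δ)) (hσ : G Δ σ Γ) :
    Der (tm (id (lift 2 (subst σ A)) (var 1) (var 0) :: lift 1 (subst σ A) :: subst σ A :: Δ)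
      (subst (up (up (up σ))) b) (subst (up (up (up σ))) C)) := by
  have := h.under₂ hup (h.1.1.1.ext hΔ hσ) (hup hσ (h.1.1.1.ext hΔ hσ))
  simp only [subst, subst_lift_one, subst_lift_two] at this
  exact this

theorem Stable.under_id_eq {Γ Δ : Ctx} {A b b' C : Tm} {σ : ℕ → Tm}
    (h : Stable G (eq (id (lift 2 A) (var 1) (var 0) :: lift 1 A :: A :: Γ) b b' C))
    (hΔ : Der (ctx Δ)) (hσ : G Δ σ Γ) :
    Der (eq (id (lift 2 (subst σ A)) (var 1) (var 0) :: lift 1 (subst σ A) :: subst σ A :: Δ)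
      (subst (up (up (up σ))) b) (subst (up (up (up σ))) b') (subst (up (up (up σ))) C)) := by
  have := h.under₂_eq hup (h.1.1.1.ext hΔ hσ) (hup hσ (h.1.1.1.ext hΔ hσ))
  simp only [subst, subst_lift_one, subst_lift_two] at this
  exact this

variable (hvar : ∀ {Δ σ Γ A k}, G Δ σ Γ → Der (ctx Δ) → Γ[k]? = some A →
  Der (tm Δ (σ k) (subst σ (lift (k + 1) A))))

include hvar

/-- The induction over derivations is done once, for any class of substitutions that is closed under
`up` and sends variables to terms of the right type. It is used for renamings and then for typed
substitutions, where closure under `up` needs the weakening obtained from renamings. -/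
theorem Der.stable {J : Judgment} (h : Der J) : Stable G J := by
  induction h with
  | ctx_nil => exact trivial
  | ctx_cons _ ih => exact ⟨ih.1, fun Δ σ hΔ hσ => ⟨_, ih.2 Δ σ hΔ hσ⟩⟩
  | var _ hk ih => exact ⟨ih, fun Δ σ hΔ hσ => hvar hσ hΔ hk⟩
  | eq_refl _ ih => exact ⟨ih.1, fun Δ σ hΔ hσ => .eq_refl (ih.2 Δ σ hΔ hσ)⟩
  | eq_symm _ ih => exact ⟨ih.1, fun Δ σ hΔ hσ => .eq_symm (ih.2 Δ σ hΔ hσ)⟩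
  | eq_trans _ _ ih ih' =>
    exact ⟨ih.1, fun Δ σ hΔ hσ => .eq_trans (ih.2 Δ σ hΔ hσ) (ih'.2 Δ σ hΔ hσ)⟩
  | conv _ _ ih ih' =>
    exact ⟨ih.1, fun Δ σ hΔ hσ => .conv (ih.2 Δ σ hΔ hσ) (ih'.2 Δ σ hΔ hσ)⟩
  | eq_conv _ _ ih ih' =>
    exact ⟨ih.1, fun Δ σ hΔ hσ => .eq_conv (ih.2 Δ σ hΔ hσ) (ih'.2 Δ σ hΔ hσ)⟩
  | U_intro _ ih => exact ⟨ih, fun Δ σ hΔ hσ => .U_intro hΔ⟩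
  | U_cumul _ ih => exact ⟨ih.1, fun Δ σ hΔ hσ => .U_cumul (ih.2 Δ σ hΔ hσ)⟩
  | U_cumul_eq _ ih => exact ⟨ih.1, fun Δ σ hΔ hσ => .U_cumul_eq (ih.2 Δ σ hΔ hσ)⟩
  | pi_form _ _ ihA ihB =>
    exact ⟨ihA.1, fun Δ σ hΔ hσ => .pi_form (ihA.2 Δ σ hΔ hσ) (ihB.under hup hΔ hσ)⟩
  | pi_form_eq _ _ ihA ihB =>
    exact ⟨ihA.1, fun Δ σ hΔ hσ => .pi_form_eq (ihA.2 Δ σ hΔ hσ) (ihB.under_eq hup hΔ hσ)⟩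
  | pi_intro _ ih => exact ⟨ih.1.1, fun Δ σ hΔ hσ => .pi_intro (ih.under hup hΔ hσ)⟩
  | pi_intro_eq _ _ ihA ih =>
    exact ⟨ihA.1, fun Δ σ hΔ hσ => .pi_intro_eq (ihA.2 Δ σ hΔ hσ) (ih.under_eq hup hΔ hσ)⟩
  | pi_elim _ _ ihf iha =>
    refine ⟨ihf.1, fun Δ σ hΔ hσ => ?_⟩
    rw [subst_inst]
    exact .pi_elim (ihf.2 Δ σ hΔ hσ) (iha.2 Δ σ hΔ hσ)
  | pi_elim_eq _ _ ihf iha =>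
    refine ⟨ihf.1, fun Δ σ hΔ hσ => ?_⟩
    rw [subst_inst]
    exact .pi_elim_eq (ihf.2 Δ σ hΔ hσ) (iha.2 Δ σ hΔ hσ)
  | pi_comp _ _ ihb iha =>
    refine ⟨iha.1, fun Δ σ hΔ hσ => ?_⟩
    rw [subst_inst, subst_inst]
    exact .pi_comp (ihb.under hup hΔ hσ) (iha.2 Δ σ hΔ hσ)
  | pi_uniq _ ihf =>
    refine ⟨ihf.1, fun Δ σ hΔ hσ => ?_⟩
    simp only [subst, subst_lift_one]
    exact .pi_uniq (ihf.2 Δ σ hΔ hσ)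
  | sigma_form _ _ ihA ihB =>
    exact ⟨ihA.1, fun Δ σ hΔ hσ => .sigma_form (ihA.2 Δ σ hΔ hσ) (ihB.under hup hΔ hσ)⟩
  | sigma_form_eq _ _ ihA ihB =>
    exact ⟨ihA.1, fun Δ σ hΔ hσ => .sigma_form_eq (ihA.2 Δ σ hΔ hσ) (ihB.under_eq hup hΔ hσ)⟩
  | sigma_intro _ _ _ ihB iha ihb =>
    refine ⟨iha.1, fun Δ σ hΔ hσ => ?_⟩
    have := ihb.2 Δ σ hΔ hσ
    rw [subst_inst] at this
    exact .sigma_intro (ihB.under hup hΔ hσ) (iha.2 Δ σ hΔ hσ) this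
  | sigma_intro_eq _ _ _ ihB iha ihb =>
    refine ⟨iha.1, fun Δ σ hΔ hσ => ?_⟩
    have := ihb.2 Δ σ hΔ hσ
    rw [subst_inst] at this
    exact .sigma_intro_eq (ihB.under hup hΔ hσ) (iha.2 Δ σ hΔ hσ) this
  | sigma_elim _ _ _ ihC ihg ihp =>
    refine ⟨ihp.1, fun Δ σ hΔ hσ => ?_⟩
    have := ihg.under₂ hup hΔ hσ
    rw [subst_instAt_two] at this
    rw [subst_inst]
    exact .sigma_elim (ihC.under hup hΔ hσ) this (ihp.2 Δ σ hΔ hσ)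
  | sigma_elim_eq _ _ _ _ _ ihA ihB ihC ihg ihp =>
    refine ⟨ihp.1, fun Δ σ hΔ hσ => ?_⟩
    have := ihg.under₂_eq hup hΔ hσ
    rw [subst_instAt_two] at this
    rw [subst_inst]
    exact .sigma_elim_eq (ihA.2 Δ σ hΔ hσ) (ihB.under_eq hup hΔ hσ) (ihC.under_eq hup hΔ hσ) this
      (ihp.2 Δ σ hΔ hσ)
  | sigma_comp _ _ _ _ ihC ihg iha ihb =>
    refine ⟨iha.1, fun Δ σ hΔ hσ => ?_⟩
    have hg := ihg.under₂ hup hΔ hσ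
    have hb := ihb.2 Δ σ hΔ hσ
    rw [subst_instAt_two] at hg
    rw [subst_inst] at hb
    rw [subst_inst, subst_inst₂]
    exact .sigma_comp (ihC.under hup hΔ hσ) hg (iha.2 Δ σ hΔ hσ) hb
  | sum_form _ _ ihA ihB =>
    exact ⟨ihA.1, fun Δ σ hΔ hσ => .sum_form (ihA.2 Δ σ hΔ hσ) (ihB.2 Δ σ hΔ hσ)⟩
  | sum_form_eq _ _ ihA ihB =>
    exact ⟨ihA.1, fun Δ σ hΔ hσ => .sum_form_eq (ihA.2 Δ σ hΔ hσ) (ihB.2 Δ σ hΔ hσ)⟩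
  | sum_intro_inl _ _ _ ihA ihB iha =>
    exact ⟨ihA.1, fun Δ σ hΔ hσ =>
      .sum_intro_inl (ihA.2 Δ σ hΔ hσ) (ihB.2 Δ σ hΔ hσ) (iha.2 Δ σ hΔ hσ)⟩
  | sum_intro_inr _ _ _ ihA ihB iha =>
    exact ⟨ihA.1, fun Δ σ hΔ hσ =>
      .sum_intro_inr (ihA.2 Δ σ hΔ hσ) (ihB.2 Δ σ hΔ hσ) (iha.2 Δ σ hΔ hσ)⟩
  | sum_intro_inl_eq _ _ _ ihA ihB iha =>
    exact ⟨ihA.1, fun Δ σ hΔ hσ =>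
      .sum_intro_inl_eq (ihA.2 Δ σ hΔ hσ) (ihB.2 Δ σ hΔ hσ) (iha.2 Δ σ hΔ hσ)⟩
  | sum_intro_inr_eq _ _ _ ihA ihB iha =>
    exact ⟨ihA.1, fun Δ σ hΔ hσ =>
      .sum_intro_inr_eq (ihA.2 Δ σ hΔ hσ) (ihB.2 Δ σ hΔ hσ) (iha.2 Δ σ hΔ hσ)⟩
  | sum_elim _ _ _ _ ihC ihc ihd ihe =>
    refine ⟨ihe.1, fun Δ σ hΔ hσ => ?_⟩
    have hc := ihc.under hup hΔ hσ
    have hd := ihd.under hup hΔ hσ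
    rw [subst_instAt_one] at hc hd
    rw [subst_inst]
    exact .sum_elim (ihC.under hup hΔ hσ) hc hd (ihe.2 Δ σ hΔ hσ)
  | sum_elim_eq _ _ _ _ _ _ ihA ihB ihC ihc ihd ihe =>
    refine ⟨ihe.1, fun Δ σ hΔ hσ => ?_⟩
    have hc := ihc.under_eq hup hΔ hσ
    have hd := ihd.under_eq hup hΔ hσ
    rw [subst_instAt_one] at hc hd
    rw [subst_inst]
    exact .sum_elim_eq (ihA.2 Δ σ hΔ hσ) (ihB.2 Δ σ hΔ hσ) (ihC.under_eq hup hΔ hσ) hc hd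
      (ihe.2 Δ σ hΔ hσ)
  | sum_comp_inl _ _ _ _ ihC ihc ihd ihe =>
    refine ⟨ihe.1, fun Δ σ hΔ hσ => ?_⟩
    have hc := ihc.under hup hΔ hσ
    have hd := ihd.under hup hΔ hσ
    rw [subst_instAt_one] at hc hd
    rw [subst_inst, subst_inst]
    exact .sum_comp_inl (ihC.under hup hΔ hσ) hc hd (ihe.2 Δ σ hΔ hσ)
  | sum_comp_inr _ _ _ _ ihC ihc ihd ihe =>
    refine ⟨ihe.1, fun Δ σ hΔ hσ => ?_⟩
    have hc := ihc.under hup hΔ hσ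
    have hd := ihd.under hup hΔ hσ
    rw [subst_instAt_one] at hc hd
    rw [subst_inst, subst_inst]
    exact .sum_comp_inr (ihC.under hup hΔ hσ) hc hd (ihe.2 Δ σ hΔ hσ)
  | empty_form _ ih => exact ⟨ih, fun Δ σ hΔ hσ => .empty_form hΔ⟩
  | empty_elim _ _ ihC ihe =>
    refine ⟨ihe.1, fun Δ σ hΔ hσ => ?_⟩
    rw [subst_inst]
    exact .empty_elim (ihC.under hup hΔ hσ) (ihe.2 Δ σ hΔ hσ)
  | empty_elim_eq _ _ ihC ihe =>
    refine ⟨ihe.1, fun Δ σ hΔ hσ => ?_⟩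
    rw [subst_inst]
    exact .empty_elim_eq (ihC.under_eq hup hΔ hσ) (ihe.2 Δ σ hΔ hσ)
  | unit_form _ ih => exact ⟨ih, fun Δ σ hΔ hσ => .unit_form hΔ⟩
  | unit_intro _ ih => exact ⟨ih, fun Δ σ hΔ hσ => .unit_intro hΔ⟩
  | unit_elim _ _ _ ihC ihc ihe =>
    refine ⟨ihe.1, fun Δ σ hΔ hσ => ?_⟩
    have hc := ihc.2 Δ σ hΔ hσ
    rw [subst_inst] at hc ⊢
    exact .unit_elim (ihC.under hup hΔ hσ) hc (ihe.2 Δ σ hΔ hσ)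
  | unit_elim_eq _ _ _ ihC ihc ihe =>
    refine ⟨ihe.1, fun Δ σ hΔ hσ => ?_⟩
    have hc := ihc.2 Δ σ hΔ hσ
    rw [subst_inst] at hc ⊢
    exact .unit_elim_eq (ihC.under_eq hup hΔ hσ) hc (ihe.2 Δ σ hΔ hσ)
  | unit_comp _ _ ihC ihc =>
    refine ⟨ihc.1, fun Δ σ hΔ hσ => ?_⟩
    have hc := ihc.2 Δ σ hΔ hσ
    rw [subst_inst] at hc ⊢
    exact .unit_comp (ihC.under hup hΔ hσ) hc
  | nat_form _ ih => exact ⟨ih, fun Δ σ hΔ hσ => .nat_form hΔ⟩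
  | nat_intro_zero _ ih => exact ⟨ih, fun Δ σ hΔ hσ => .nat_intro_zero hΔ⟩
  | nat_intro_succ _ ih => exact ⟨ih.1, fun Δ σ hΔ hσ => .nat_intro_succ (ih.2 Δ σ hΔ hσ)⟩
  | nat_intro_succ_eq _ ih =>
    exact ⟨ih.1, fun Δ σ hΔ hσ => .nat_intro_succ_eq (ih.2 Δ σ hΔ hσ)⟩
  | nat_elim _ _ _ _ ihC ihz ihs ihm =>
    refine ⟨ihm.1, fun Δ σ hΔ hσ => ?_⟩
    have hz := ihz.2 Δ σ hΔ hσ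
    have hs := ihs.under₂ hup hΔ hσ
    rw [subst_inst] at hz ⊢
    rw [subst_instAt_two] at hs
    exact .nat_elim (ihC.under hup hΔ hσ) hz hs (ihm.2 Δ σ hΔ hσ)
  | nat_elim_eq _ _ _ _ ihC ihz ihs ihm =>
    refine ⟨ihm.1, fun Δ σ hΔ hσ => ?_⟩
    have hz := ihz.2 Δ σ hΔ hσ
    have hs := ihs.under₂_eq hup hΔ hσ
    rw [subst_inst] at hz ⊢
    rw [subst_instAt_two] at hs
    exact .nat_elim_eq (ihC.under_eq hup hΔ hσ) hz hs (ihm.2 Δ σ hΔ hσ)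
  | nat_comp_zero _ _ _ ihC ihz ihs =>
    refine ⟨ihz.1, fun Δ σ hΔ hσ => ?_⟩
    have hz := ihz.2 Δ σ hΔ hσ
    have hs := ihs.under₂ hup hΔ hσ
    rw [subst_inst] at hz ⊢
    rw [subst_instAt_two] at hs
    exact .nat_comp_zero (ihC.under hup hΔ hσ) hz hs
  | nat_comp_succ _ _ _ _ ihC ihz ihs ihm =>
    refine ⟨ihm.1, fun Δ σ hΔ hσ => ?_⟩
    have hz := ihz.2 Δ σ hΔ hσ
    have hs := ihs.under₂ hup hΔ hσ
    rw [subst_inst] at hz ⊢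
    rw [subst_instAt_two] at hs
    rw [subst_inst₂]
    exact .nat_comp_succ (ihC.under hup hΔ hσ) hz hs (ihm.2 Δ σ hΔ hσ)
  | id_form _ _ _ ihA iha ihb =>
    exact ⟨ihA.1, fun Δ σ hΔ hσ =>
      .id_form (ihA.2 Δ σ hΔ hσ) (iha.2 Δ σ hΔ hσ) (ihb.2 Δ σ hΔ hσ)⟩
  | id_form_eq _ _ _ ihA iha ihb =>
    exact ⟨ihA.1, fun Δ σ hΔ hσ =>
      .id_form_eq (ihA.2 Δ σ hΔ hσ) (iha.2 Δ σ hΔ hσ) (ihb.2 Δ σ hΔ hσ)⟩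
  | id_intro _ _ ihA iha =>
    exact ⟨ihA.1, fun Δ σ hΔ hσ => .id_intro (ihA.2 Δ σ hΔ hσ) (iha.2 Δ σ hΔ hσ)⟩
  | id_intro_eq _ _ ihA iha =>
    exact ⟨ihA.1, fun Δ σ hΔ hσ => .id_intro_eq (ihA.2 Δ σ hΔ hσ) (iha.2 Δ σ hΔ hσ)⟩
  | id_elim _ _ _ _ _ ihC ihc iha ihb ihq =>
    refine ⟨iha.1, fun Δ σ hΔ hσ => ?_⟩
    have hc := ihc.under hup hΔ hσ
    rw [subst_instRefl] at hc
    rw [subst_inst₃]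
    exact .id_elim (ihC.under_id hup hΔ hσ) hc (iha.2 Δ σ hΔ hσ) (ihb.2 Δ σ hΔ hσ)
      (ihq.2 Δ σ hΔ hσ)
  | id_elim_eq _ _ _ _ _ _ ihA ihC ihc iha ihb ihq =>
    refine ⟨iha.1, fun Δ σ hΔ hσ => ?_⟩
    have hc := ihc.under_eq hup hΔ hσ
    rw [subst_instRefl] at hc
    rw [subst_inst₃]
    exact .id_elim_eq (ihA.2 Δ σ hΔ hσ) (ihC.under_id_eq hup hΔ hσ) hc (iha.2 Δ σ hΔ hσ)
      (ihb.2 Δ σ hΔ hσ) (ihq.2 Δ σ hΔ hσ)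
  | id_comp _ _ _ ihC ihc iha =>
    refine ⟨iha.1, fun Δ σ hΔ hσ => ?_⟩
    have hc := ihc.under hup hΔ hσ
    rw [subst_instRefl] at hc
    rw [subst_inst₃, subst_inst]
    exact .id_comp (ihC.under_id hup hΔ hσ) hc (iha.2 Δ σ hΔ hσ)
  | univalence_intro _ ih => exact ⟨ih, fun Δ σ hΔ hσ => .univalence_intro hΔ⟩

end Stability

/-! ### Weakening and substitution -/

/-- Every context of a derivable judgment is derivable, and so are the types in it. -/
def WfCtx : Ctx → Prop
  | [] => True
  | A :: Γ => WfCtx Γ ∧ Der (ctx Γ) ∧ ∃ i, Der (tm Γ A (U i))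

/-- Every rule about terms has a premise in the context of its conclusion, apart from `pi_intro`.
There the premise lives in the extended context, and the claim is read off from the tail. -/
theorem Der.wfCtx {J : Judgment} (h : Der J) :
    match J with
    | ctx Γ => Der (ctx Γ) ∧ WfCtx Γ
    | tm Γ _ _ => Der (ctx Γ) ∧ WfCtx Γ
    | eq Γ _ _ _ => Der (ctx Γ) ∧ WfCtx Γ := by
  induction h with
  | ctx_nil => exact ⟨.ctx_nil, trivial⟩
  | ctx_cons h ih => exact ⟨.ctx_cons h, ih.2, ih.1, _, h⟩
  | pi_intro _ ih => exact ⟨ih.2.2.1, ih.2.1⟩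
  | _ => assumption

theorem Der.ctx_of_tm {Γ : Ctx} {a A : Tm} (h : Der (tm Γ a A)) : Der (ctx Γ) := h.wfCtx.1

theorem Der.ctx_tail {Γ : Ctx} {A : Tm} (h : Der (ctx (A :: Γ))) : Der (ctx Γ) := h.wfCtx.2.2.1

theorem Der.ctx_head {Γ : Ctx} {A : Tm} (h : Der (ctx (A :: Γ))) : ∃ i, Der (tm Γ A (U i)) :=
  h.wfCtx.2.2.2

/-- `σ` is a renaming that respects the types of the variables. -/
def IsRen (Δ : Ctx) (σ : ℕ → Tm) (Γ : Ctx) : Prop :=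
  ∃ ρ : ℕ → ℕ, σ = Tm.var ∘ ρ ∧
    ∀ k A, Γ[k]? = some A → ∃ B, Δ[ρ k]? = some B ∧ lift (ρ k + 1) B = rename ρ (lift (k + 1) A)

theorem IsRen.up {Δ Γ : Ctx} {σ : ℕ → Tm} {A : Tm} (h : IsRen Δ σ Γ) :
    IsRen (subst σ A :: Δ) (Tm.up σ) (A :: Γ) := by
  obtain ⟨ρ, rfl, h⟩ := h
  refine ⟨upRen ρ, up_var_comp ρ, ?_⟩
  rintro (_ | k) B hk
  · obtain rfl : A = B := by simpa using hk
    refine ⟨_, rfl, ?_⟩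
    rw [← rename_eq_subst]
    simp only [lift, rename_rename]
    rfl
  · obtain ⟨C, hC, e⟩ := h k B (by simpa using hk)
    refine ⟨C, by simpa [upRen] using hC, ?_⟩
    have := congrArg (lift 1) e
    rw [lift_lift] at this
    rw [show upRen ρ (k + 1) + 1 = ρ k + 1 + 1 from rfl, this]
    simp only [lift, rename_rename]
    rfl

theorem Der.rename {J : Judgment} (h : Der J) : Stable IsRen J := by
  refine h.stable (fun h _ => h.up) ?_
  rintro Δ σ Γ A k ⟨ρ, rfl, h⟩ hΔ hk
  obtain ⟨B, hB, e⟩ := h k A hk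
  rw [← rename_eq_subst, ← e]
  exact .var hΔ hB

theorem isRen_lift (Γ : Ctx) (A : Tm) : IsRen (A :: Γ) (fun k => Tm.var (k + 1)) Γ :=
  ⟨fun k => k + 1, rfl, fun k B hk => ⟨B, by simpa using hk, by
    simp only [lift, rename_rename]; congr 1⟩⟩

theorem Der.weaken {Γ : Ctx} {a A B : Tm} (h : Der (tm Γ a A)) (hB : Der (ctx (B :: Γ))) :
    Der (tm (B :: Γ) (lift 1 a) (lift 1 A)) := by
  simp only [lift_eq_subst]
  exact h.rename.2 _ _ hB (isRen_lift Γ B)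

theorem Der.weaken_eq {Γ : Ctx} {a b A B : Tm} (h : Der (eq Γ a b A)) (hB : Der (ctx (B :: Γ))) :
    Der (eq (B :: Γ) (lift 1 a) (lift 1 b) (lift 1 A)) := by
  simp only [lift_eq_subst]
  exact h.rename.2 _ _ hB (isRen_lift Γ B)

/-- `σ` is a substitution for the variables of `Γ` by terms over `Δ`. -/
def IsSub (Δ : Ctx) (σ : ℕ → Tm) (Γ : Ctx) : Prop :=
  ∀ k A, Γ[k]? = some A → Der (tm Δ (σ k) (Tm.subst σ (lift (k + 1) A)))

theorem IsSub.cons {Δ Γ : Ctx} {σ : ℕ → Tm} {a A : Tm} (h : IsSub Δ σ Γ)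
    (ha : Der (tm Δ a (Tm.subst σ A))) : IsSub Δ (Tm.cons a σ) (A :: Γ) := by
  rintro (_ | k) B hk
  · obtain rfl : A = B := by simpa using hk
    rw [subst_cons_lift]; exact ha
  · rw [show k + 1 + 1 = (k + 1) + 1 from rfl, ← lift_lift, subst_cons_lift]
    exact h k B (by simpa using hk)

theorem IsSub.weaken {Δ Γ : Ctx} {σ : ℕ → Tm} {B : Tm} (h : IsSub Δ σ Γ)
    (hB : Der (ctx (B :: Δ))) : IsSub (B :: Δ) (fun k => lift 1 (σ k)) Γ := by
  intro k A hk
  have := (h k A hk).weaken hB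
  rwa [lift, lift, rename_subst] at this

theorem IsSub.up {Δ Γ : Ctx} {σ : ℕ → Tm} {A : Tm} (h : IsSub Δ σ Γ)
    (hA : Der (ctx (Tm.subst σ A :: Δ))) : IsSub (Tm.subst σ A :: Δ) (Tm.up σ) (A :: Γ) := by
  refine (h.weaken hA).cons ?_
  have := Der.var (k := 0) hA rfl
  rwa [lift, rename_subst] at this

theorem IsSub.refl {Γ : Ctx} (h : Der (ctx Γ)) : IsSub Γ Tm.var Γ := by
  intro k A hk
  rw [subst_var]
  exact .var h hk

theorem Der.subst {J : Judgment} (h : Der J) : Stable IsSub J :=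
  h.stable (fun h hA => h.up hA) (fun h _ hk => h _ _ hk)

theorem Der.subst_tm {Γ Δ : Ctx} {σ : ℕ → Tm} {a A : Tm} (h : Der (tm Γ a A))
    (hΔ : Der (ctx Δ)) (hσ : IsSub Δ σ Γ) : Der (tm Δ (Tm.subst σ a) (Tm.subst σ A)) :=
  h.subst.2 Δ σ hΔ hσ

theorem Der.subst_eq {Γ Δ : Ctx} {σ : ℕ → Tm} {a b A : Tm} (h : Der (eq Γ a b A))
    (hΔ : Der (ctx Δ)) (hσ : IsSub Δ σ Γ) :
    Der (eq Δ (Tm.subst σ a) (Tm.subst σ b) (Tm.subst σ A)) :=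
  h.subst.2 Δ σ hΔ hσ

theorem Der.inst_tm {Γ : Ctx} {a A b B : Tm} (h : Der (tm (A :: Γ) b B)) (ha : Der (tm Γ a A)) :
    Der (tm Γ (inst b a) (inst B a)) :=
  h.subst_tm ha.ctx_of_tm ((IsSub.refl ha.ctx_of_tm).cons (by rwa [subst_var]))

theorem Der.inst_ty {Γ : Ctx} {a A B : Tm} {i : ℕ} (h : Der (tm (A :: Γ) B (U i)))
    (ha : Der (tm Γ a A)) : Der (tm Γ (inst B a) (U i)) :=
  h.inst_tm ha

/-! ### Shifting universe levels -/

/-- Raises all universe levels in a judgment by `k`. -/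
def Judgment.shift (k : ℕ) : Judgment → Judgment
  | ctx Γ => ctx (Γ.map (Tm.shift k))
  | tm Γ a A => tm (Γ.map (Tm.shift k)) (Tm.shift k a) (Tm.shift k A)
  | eq Γ a b A => eq (Γ.map (Tm.shift k)) (Tm.shift k a) (Tm.shift k b) (Tm.shift k A)

/-- The rules mention universe levels only through a level and its successor, so adding a constant
to all levels preserves them. Statements derived in the lowest universes thereby hold at every
height of the hierarchy. -/
theorem Der.shift (k : ℕ) {J : Judgment} (h : Der J) : Der (J.shift k) := by
  induction h with
  | ctx_nil => exact .ctx_nil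
  | ctx_cons _ ih => exact .ctx_cons ih
  | var _ hk ih =>
    simp only [Judgment.shift, shift_lift]
    exact .var ih (by simp [hk])
  | pi_elim _ _ ih₁ ih₂ =>
    simp only [Judgment.shift, shift_inst]
    exact .pi_elim ih₁ ih₂
  | pi_elim_eq _ _ ih₁ ih₂ =>
    simp only [Judgment.shift, shift_inst]
    exact .pi_elim_eq ih₁ ih₂
  | pi_comp _ _ ih₁ ih₂ =>
    simp only [Judgment.shift, shift_inst]
    exact .pi_comp ih₁ ih₂
  | pi_uniq _ ih =>
    have := Der.pi_uniq ih
    rwa [← shift_lift] at this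
  | sigma_intro _ _ _ ih₁ ih₂ ih₃ =>
    simp only [Judgment.shift, shift_inst] at ih₃
    exact .sigma_intro ih₁ ih₂ ih₃
  | sigma_intro_eq _ _ _ ih₁ ih₂ ih₃ =>
    simp only [Judgment.shift, shift_inst] at ih₃
    exact .sigma_intro_eq ih₁ ih₂ ih₃
  | sigma_elim _ _ _ ih₁ ih₂ ih₃ =>
    simp only [Judgment.shift, shift_instAt, shift_inst] at ih₂ ⊢
    exact .sigma_elim ih₁ ih₂ ih₃
  | sigma_elim_eq _ _ _ _ _ ih₁ ih₂ ih₃ ih₄ ih₅ =>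
    simp only [Judgment.shift, shift_instAt, shift_inst] at ih₄ ⊢
    exact .sigma_elim_eq ih₁ ih₂ ih₃ ih₄ ih₅
  | sigma_comp _ _ _ _ ih₁ ih₂ ih₃ ih₄ =>
    simp only [Judgment.shift, shift_instAt, shift_inst, shift_inst₂] at ih₂ ih₄ ⊢
    exact .sigma_comp ih₁ ih₂ ih₃ ih₄
  | sum_elim _ _ _ _ ih₁ ih₂ ih₃ ih₄ =>
    simp only [Judgment.shift, shift_instAt, shift_inst] at ih₂ ih₃ ⊢
    exact .sum_elim ih₁ ih₂ ih₃ ih₄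
  | sum_elim_eq _ _ _ _ _ _ ih₁ ih₂ ih₃ ih₄ ih₅ ih₆ =>
    simp only [Judgment.shift, shift_instAt, shift_inst] at ih₄ ih₅ ⊢
    exact .sum_elim_eq ih₁ ih₂ ih₃ ih₄ ih₅ ih₆
  | sum_comp_inl _ _ _ _ ih₁ ih₂ ih₃ ih₄ =>
    simp only [Judgment.shift, shift_instAt, shift_inst] at ih₂ ih₃ ⊢
    exact .sum_comp_inl ih₁ ih₂ ih₃ ih₄
  | sum_comp_inr _ _ _ _ ih₁ ih₂ ih₃ ih₄ =>
    simp only [Judgment.shift, shift_instAt, shift_inst] at ih₂ ih₃ ⊢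
    exact .sum_comp_inr ih₁ ih₂ ih₃ ih₄
  | empty_elim _ _ ih₁ ih₂ =>
    simp only [Judgment.shift, shift_inst]
    exact .empty_elim ih₁ ih₂
  | empty_elim_eq _ _ ih₁ ih₂ =>
    simp only [Judgment.shift, shift_inst]
    exact .empty_elim_eq ih₁ ih₂
  | unit_elim _ _ _ ih₁ ih₂ ih₃ =>
    simp only [Judgment.shift, shift_inst] at ih₂ ⊢
    exact .unit_elim ih₁ ih₂ ih₃
  | unit_elim_eq _ _ _ ih₁ ih₂ ih₃ =>
    simp only [Judgment.shift, shift_inst] at ih₂ ⊢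
    exact .unit_elim_eq ih₁ ih₂ ih₃
  | unit_comp _ _ ih₁ ih₂ =>
    simp only [Judgment.shift, shift_inst] at ih₂ ⊢
    exact .unit_comp ih₁ ih₂
  | nat_elim _ _ _ _ ih₁ ih₂ ih₃ ih₄ =>
    simp only [Judgment.shift, shift_instAt, shift_inst] at ih₂ ih₃ ⊢
    exact .nat_elim ih₁ ih₂ ih₃ ih₄
  | nat_elim_eq _ _ _ _ ih₁ ih₂ ih₃ ih₄ =>
    simp only [Judgment.shift, shift_instAt, shift_inst] at ih₂ ih₃ ⊢
    exact .nat_elim_eq ih₁ ih₂ ih₃ ih₄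
  | nat_comp_zero _ _ _ ih₁ ih₂ ih₃ =>
    simp only [Judgment.shift, shift_instAt, shift_inst] at ih₂ ih₃ ⊢
    exact .nat_comp_zero ih₁ ih₂ ih₃
  | nat_comp_succ _ _ _ _ ih₁ ih₂ ih₃ ih₄ =>
    simp only [Judgment.shift, shift_instAt, shift_inst, shift_inst₂] at ih₂ ih₃ ⊢
    exact .nat_comp_succ ih₁ ih₂ ih₃ ih₄
  | id_elim _ _ _ _ _ ih₁ ih₂ ih₃ ih₄ ih₅ =>
    simp only [Judgment.shift, List.map_cons, Tm.shift, shift_instRefl, shift_inst₃, shift_lift]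
      at ih₁ ih₂ ⊢
    exact .id_elim ih₁ ih₂ ih₃ ih₄ ih₅
  | id_elim_eq _ _ _ _ _ _ ih₁ ih₂ ih₃ ih₄ ih₅ ih₆ =>
    simp only [Judgment.shift, List.map_cons, Tm.shift, shift_instRefl, shift_inst₃, shift_lift]
      at ih₂ ih₃ ⊢
    exact .id_elim_eq ih₁ ih₂ ih₃ ih₄ ih₅ ih₆
  | id_comp _ _ _ ih₁ ih₂ ih₃ =>
    simp only [Judgment.shift, List.map_cons, Tm.shift, shift_instRefl, shift_inst₃, shift_inst,
      shift_lift] at ih₁ ih₂ ⊢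
    exact .id_comp ih₁ ih₂ ih₃
  | conv _ _ ih ih' => exact .conv ih ih'
  | eq_refl _ ih₁ => exact .eq_refl ih₁
  | eq_symm _ ih₁ => exact .eq_symm ih₁
  | eq_trans _ _ ih₁ ih₂ => exact .eq_trans ih₁ ih₂
  | eq_conv _ _ ih₁ ih₂ => exact .eq_conv ih₁ ih₂
  | U_intro _ ih₁ => exact .U_intro ih₁
  | U_cumul _ ih₁ => exact .U_cumul ih₁
  | U_cumul_eq _ ih₁ => exact .U_cumul_eq ih₁
  | pi_form _ _ ih₁ ih₂ => exact .pi_form ih₁ ih₂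
  | pi_form_eq _ _ ih₁ ih₂ => exact .pi_form_eq ih₁ ih₂
  | pi_intro _ ih₁ => exact .pi_intro ih₁
  | pi_intro_eq _ _ ih₁ ih₂ => exact .pi_intro_eq ih₁ ih₂
  | sigma_form _ _ ih₁ ih₂ => exact .sigma_form ih₁ ih₂
  | sigma_form_eq _ _ ih₁ ih₂ => exact .sigma_form_eq ih₁ ih₂
  | sum_form _ _ ih₁ ih₂ => exact .sum_form ih₁ ih₂
  | sum_form_eq _ _ ih₁ ih₂ => exact .sum_form_eq ih₁ ih₂
  | sum_intro_inl _ _ _ ih₁ ih₂ ih₃ => exact .sum_intro_inl ih₁ ih₂ ih₃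
  | sum_intro_inr _ _ _ ih₁ ih₂ ih₃ => exact .sum_intro_inr ih₁ ih₂ ih₃
  | sum_intro_inl_eq _ _ _ ih₁ ih₂ ih₃ => exact .sum_intro_inl_eq ih₁ ih₂ ih₃
  | sum_intro_inr_eq _ _ _ ih₁ ih₂ ih₃ => exact .sum_intro_inr_eq ih₁ ih₂ ih₃
  | empty_form _ ih₁ => exact .empty_form ih₁
  | unit_form _ ih₁ => exact .unit_form ih₁
  | unit_intro _ ih₁ => exact .unit_intro ih₁
  | nat_form _ ih₁ => exact .nat_form ih₁
  | nat_intro_zero _ ih₁ => exact .nat_intro_zero ih₁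
  | nat_intro_succ _ ih₁ => exact .nat_intro_succ ih₁
  | nat_intro_succ_eq _ ih₁ => exact .nat_intro_succ_eq ih₁
  | id_form _ _ _ ih₁ ih₂ ih₃ => exact .id_form ih₁ ih₂ ih₃
  | id_form_eq _ _ _ ih₁ ih₂ ih₃ => exact .id_form_eq ih₁ ih₂ ih₃
  | id_intro _ _ ih₁ ih₂ => exact .id_intro ih₁ ih₂
  | id_intro_eq _ _ ih₁ ih₂ => exact .id_intro_eq ih₁ ih₂
  | univalence_intro _ ih₁ => exact .univalence_intro ih₁

end HoTT

/-! ### A type-directed normalizer that the kernel can run, and its soundness. -/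

namespace HoTT

open Tm Judgment

namespace Tm

/-! ### Substitution with a depth counter -/

/-- Adds `k` to the variables from a given one on. -/
noncomputable def flift (k : ℕ) (t : Tm) : ℕ → Tm :=
  Tm.rec (motive := fun _ => ℕ → Tm)
    (fun j d => var (bif Nat.blt j d then j else j + k))
    (fun i _ => U i)
    (fun _ _ a b n => pi (a n) (b (n + 1)))
    (fun _ _ a b n => lam (a n) (b (n + 1)))
    (fun _ _ a b n => app (a n) (b n))
    (fun _ _ a b n => sigma (a n) (b (n + 1)))
    (fun _ _ a b n => pair (a n) (b n))
    (fun _ _ _ _ _ a b c d e n => sigmaInd (a n) (b (n + 1)) (c (n + 1)) (d (n + 2)) (e n))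
    (fun _ _ a b n => sum (a n) (b n))
    (fun _ a n => inl (a n))
    (fun _ a n => inr (a n))
    (fun _ _ _ _ _ _ a b c d e f n => sumInd (a n) (b n) (c (n + 1)) (d (n + 1)) (e (n + 1)) (f n))
    (fun _ => empty)
    (fun _ _ a b n => emptyInd (a (n + 1)) (b n))
    (fun _ => unit)
    (fun _ => star)
    (fun _ _ _ a b c n => unitInd (a (n + 1)) (b n) (c n))
    (fun _ => nat)
    (fun _ => zero)
    (fun _ a n => succ (a n))
    (fun _ _ _ _ a b c d n => natInd (a (n + 1)) (b n) (c (n + 2)) (d n))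
    (fun _ _ _ a b c n => id (a n) (b n) (c n))
    (fun _ a n => refl (a n))
    (fun _ _ _ _ _ _ a b c d e f n => idInd (a n) (b (n + 3)) (c (n + 1)) (d n) (e n) (f n))
    (fun i _ => univalence i)
    t

/-- Applies `σ` to the variables from a given one on. -/
noncomputable def fsubst (σ : ℕ → Tm) (t : Tm) : ℕ → Tm :=
  Tm.rec (motive := fun _ => ℕ → Tm)
    (fun j d => bif Nat.blt j d then var j else flift d (σ (j - d)) 0)
    (fun i _ => U i)
    (fun _ _ a b n => pi (a n) (b (n + 1)))
    (fun _ _ a b n => lam (a n) (b (n + 1)))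
    (fun _ _ a b n => app (a n) (b n))
    (fun _ _ a b n => sigma (a n) (b (n + 1)))
    (fun _ _ a b n => pair (a n) (b n))
    (fun _ _ _ _ _ a b c d e n => sigmaInd (a n) (b (n + 1)) (c (n + 1)) (d (n + 2)) (e n))
    (fun _ _ a b n => sum (a n) (b n))
    (fun _ a n => inl (a n))
    (fun _ a n => inr (a n))
    (fun _ _ _ _ _ _ a b c d e f n => sumInd (a n) (b n) (c (n + 1)) (d (n + 1)) (e (n + 1)) (f n))
    (fun _ => empty)
    (fun _ _ a b n => emptyInd (a (n + 1)) (b n))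
    (fun _ => unit)
    (fun _ => star)
    (fun _ _ _ a b c n => unitInd (a (n + 1)) (b n) (c n))
    (fun _ => nat)
    (fun _ => zero)
    (fun _ a n => succ (a n))
    (fun _ _ _ _ a b c d n => natInd (a (n + 1)) (b n) (c (n + 2)) (d n))
    (fun _ _ _ a b c n => id (a n) (b n) (c n))
    (fun _ a n => refl (a n))
    (fun _ _ _ _ _ _ a b c d e f n => idInd (a n) (b (n + 3)) (c (n + 1)) (d n) (e n) (f n))
    (fun i _ => univalence i)
    t

theorem blt_eq_decide (j c : ℕ) : Nat.blt j c = decide (j < c) := by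
  rw [Bool.eq_iff_iff]; simp [Nat.blt]

theorem upRen_iterate (k c j : ℕ) :
    upRen^[c] (fun j => j + k) j = bif Nat.blt j c then j else j + k := by
  induction c generalizing j with
  | zero => simp [blt_eq_decide]
  | succ c ih =>
    rw [Function.iterate_succ_apply']
    cases j with
    | zero => simp [upRen, blt_eq_decide]
    | succ j =>
      rw [upRen, ih]
      by_cases h : j < c <;> simp [blt_eq_decide, h]
      omega

theorem flift_eq_rename (k c : ℕ) (t : Tm) :
    flift k t c = rename (upRen^[c] fun j => j + k) t := by
  induction t generalizing c <;>
    simp_all [flift, rename, upRen_iterate, ← Function.iterate_succ_apply']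

theorem flift_zero (k : ℕ) (t : Tm) : flift k t 0 = lift k t := flift_eq_rename k 0 t

theorem up_iterate (σ : ℕ → Tm) (d j : ℕ) :
    up^[d] σ j = bif Nat.blt j d then var j else lift d (σ (j - d)) := by
  induction d generalizing j with
  | zero => simp [blt_eq_decide, lift_zero]
  | succ d ih =>
    rw [Function.iterate_succ_apply']
    cases j with
    | zero => simp [up, cons, blt_eq_decide]
    | succ j =>
      rw [up, cons, ih]
      by_cases h : j < d <;> simp [blt_eq_decide, h, lift_lift]
      rfl

/-- The counter `d` stands for `d` applications of `up`. Evaluation then compares a variable with a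
number, rather than running through a tower of extended substitutions. -/
theorem fsubst_eq_subst (σ : ℕ → Tm) (d : ℕ) (t : Tm) :
    fsubst σ t d = subst (up^[d] σ) t := by
  induction t generalizing d <;>
    simp_all [fsubst, subst, up_iterate, flift_zero, ← Function.iterate_succ_apply']

theorem fsubst_zero (σ : ℕ → Tm) (t : Tm) : fsubst σ t 0 = subst σ t := fsubst_eq_subst σ 0 t

/-! ### Boolean tests -/

/-- Syntactic equality. -/
noncomputable def beq (t : Tm) : Tm → Bool :=
  Tm.rec (motive := fun _ => Tm → Bool)
    (fun i u => match u with | var j => Nat.beq i j | _ => false)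
    (fun i u => match u with | U j => Nat.beq i j | _ => false)
    (fun _ _ a b u => match u with
      | pi a' b' => bif a a' then b b' else false
      | _ => false)
    (fun _ _ a b u => match u with
      | lam a' b' => bif a a' then b b' else false
      | _ => false)
    (fun _ _ a b u => match u with
      | app a' b' => bif a a' then b b' else false
      | _ => false)
    (fun _ _ a b u => match u with
      | sigma a' b' => bif a a' then b b' else false
      | _ => false)
    (fun _ _ a b u => match u with
      | pair a' b' => bif a a' then b b' else false
      | _ => false)
    (fun _ _ _ _ _ a b c d e u => match u with
      | sigmaInd a' b' c' d' e' => bif e e' then bif a a' then bif b b' then bif c c' then d d' else false else false else false else false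
      | _ => false)
    (fun _ _ a b u => match u with
      | sum a' b' => bif a a' then b b' else false
      | _ => false)
    (fun _ a u => match u with
      | inl a' => a a'
      | _ => false)
    (fun _ a u => match u with
      | inr a' => a a'
      | _ => false)
    (fun _ _ _ _ _ _ a b c d e f u => match u with
      | sumInd a' b' c' d' e' f' => bif f f' then bif a a' then bif b b' then bif c c' then bif d d' then e e' else false else false else false else false else false
      | _ => false)
    (fun u => match u with | empty => true | _ => false)
    (fun _ _ a b u => match u with
      | emptyInd a' b' => bif b b' then a a' else false
      | _ => false)
    (fun u => match u with | unit => true | _ => false)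
    (fun u => match u with | star => true | _ => false)
    (fun _ _ _ a b c u => match u with
      | unitInd a' b' c' => bif c c' then bif a a' then b b' else false else false
      | _ => false)
    (fun u => match u with | nat => true | _ => false)
    (fun u => match u with | zero => true | _ => false)
    (fun _ a u => match u with
      | succ a' => a a'
      | _ => false)
    (fun _ _ _ _ a b c d u => match u with
      | natInd a' b' c' d' => bif d d' then bif a a' then bif b b' then c c' else false else false else false
      | _ => false)
    (fun _ _ _ a b c u => match u with
      | id a' b' c' => bif b b' then bif c c' then a a' else false else false
      | _ => false)
    (fun _ a u => match u with
      | refl a' => a a'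
      | _ => false)
    (fun _ _ _ _ _ _ a b c d e f u => match u with
      | idInd a' b' c' d' e' f' => bif f f' then bif d d' then bif e e' then bif a a' then bif b b' then c c' else false else false else false else false else false
      | _ => false)
    (fun i u => match u with | univalence j => Nat.beq i j | _ => false)
    t

theorem and_of_cond {x y : Bool} (h : (bif x then y else false) = true) : x = true ∧ y = true := by
  cases x
  · cases h
  · exact ⟨rfl, h⟩

/-- Only this direction matters: a test that wrongly fails could make a check fail but cannot make
it unsound. -/
theorem eq_of_beq {t u : Tm} (h : beq t u = true) : t = u := by
  induction t generalizing u with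
  | var => cases u <;> first | exact Bool.noConfusion h | exact congrArg _ (Nat.eq_of_beq_eq_true h)
  | U => cases u <;> first | exact Bool.noConfusion h | exact congrArg _ (Nat.eq_of_beq_eq_true h)
  | pi _ _ ha hb =>
    cases u <;> first | exact Bool.noConfusion h | skip
    obtain ⟨a', b'⟩ := and_of_cond h
    rw [ha a', hb b']
  | lam _ _ ha hb =>
    cases u <;> first | exact Bool.noConfusion h | skip
    obtain ⟨a', b'⟩ := and_of_cond h
    rw [ha a', hb b']
  | app _ _ ha hb =>
    cases u <;> first | exact Bool.noConfusion h | skip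
    obtain ⟨a', b'⟩ := and_of_cond h
    rw [ha a', hb b']
  | sigma _ _ ha hb =>
    cases u <;> first | exact Bool.noConfusion h | skip
    obtain ⟨a', b'⟩ := and_of_cond h
    rw [ha a', hb b']
  | pair _ _ ha hb =>
    cases u <;> first | exact Bool.noConfusion h | skip
    obtain ⟨a', b'⟩ := and_of_cond h
    rw [ha a', hb b']
  | sigmaInd _ _ _ _ _ ha hb hc hd he =>
    cases u <;> first | exact Bool.noConfusion h | skip
    obtain ⟨e', h⟩ := and_of_cond h
    obtain ⟨a', h⟩ := and_of_cond h
    obtain ⟨b', h⟩ := and_of_cond h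
    obtain ⟨c', d'⟩ := and_of_cond h
    rw [ha a', hb b', hc c', hd d', he e']
  | sum _ _ ha hb =>
    cases u <;> first | exact Bool.noConfusion h | skip
    obtain ⟨a', b'⟩ := and_of_cond h
    rw [ha a', hb b']
  | inl _ ha => cases u <;> first | exact Bool.noConfusion h | rw [ha h]
  | inr _ ha => cases u <;> first | exact Bool.noConfusion h | rw [ha h]
  | sumInd _ _ _ _ _ _ ha hb hc hd he hf =>
    cases u <;> first | exact Bool.noConfusion h | skip
    obtain ⟨f', h⟩ := and_of_cond h
    obtain ⟨a', h⟩ := and_of_cond h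
    obtain ⟨b', h⟩ := and_of_cond h
    obtain ⟨c', h⟩ := and_of_cond h
    obtain ⟨d', e'⟩ := and_of_cond h
    rw [ha a', hb b', hc c', hd d', he e', hf f']
  | empty => cases u <;> first | exact Bool.noConfusion h | rfl
  | emptyInd _ _ ha hb =>
    cases u <;> first | exact Bool.noConfusion h | skip
    obtain ⟨b', a'⟩ := and_of_cond h
    rw [ha a', hb b']
  | unit => cases u <;> first | exact Bool.noConfusion h | rfl
  | star => cases u <;> first | exact Bool.noConfusion h | rfl
  | unitInd _ _ _ ha hb hc =>
    cases u <;> first | exact Bool.noConfusion h | skip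
    obtain ⟨c', h⟩ := and_of_cond h
    obtain ⟨a', b'⟩ := and_of_cond h
    rw [ha a', hb b', hc c']
  | nat => cases u <;> first | exact Bool.noConfusion h | rfl
  | zero => cases u <;> first | exact Bool.noConfusion h | rfl
  | succ _ ha => cases u <;> first | exact Bool.noConfusion h | rw [ha h]
  | natInd _ _ _ _ ha hb hc hd =>
    cases u <;> first | exact Bool.noConfusion h | skip
    obtain ⟨d', h⟩ := and_of_cond h
    obtain ⟨a', h⟩ := and_of_cond h
    obtain ⟨b', c'⟩ := and_of_cond h
    rw [ha a', hb b', hc c', hd d']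
  | id _ _ _ ha hb hc =>
    cases u <;> first | exact Bool.noConfusion h | skip
    obtain ⟨b', h⟩ := and_of_cond h
    obtain ⟨c', a'⟩ := and_of_cond h
    rw [ha a', hb b', hc c']
  | refl _ ha => cases u <;> first | exact Bool.noConfusion h | rw [ha h]
  | idInd _ _ _ _ _ _ ha hb hc hd he hf =>
    cases u <;> first | exact Bool.noConfusion h | skip
    obtain ⟨f', h⟩ := and_of_cond h
    obtain ⟨d', h⟩ := and_of_cond h
    obtain ⟨e', h⟩ := and_of_cond h
    obtain ⟨a', h⟩ := and_of_cond h
    obtain ⟨b', c'⟩ := and_of_cond h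
    rw [ha a', hb b', hc c', hd d', he e', hf f']
  | univalence => cases u <;> first | exact Bool.noConfusion h | exact congrArg _ (Nat.eq_of_beq_eq_true h)

/-- `lower t` is `s` if `t = lift 1 s`. -/
noncomputable def lower (t : Tm) : Tm := fsubst (fun j => var (j - 1)) t 0

/-- Is the term an introduction form that an eliminator would consume? -/
def isIntro : Tm → Bool
  | lam _ _ => true
  | pair _ _ => true
  | inl _ => true
  | inr _ => true
  | star => true
  | zero => true
  | succ _ => true
  | refl _ => true
  | _ => false

/-- Does the body of a `λ` have the form `f x`, with `x` not occurring in `f`? -/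
noncomputable def isEta : Tm → Bool
  | app g (var 0) => beq (flift 1 (lower g) 0) g
  | _ => false

/-- Does the term contain a `β`- or `η`-redex? -/
noncomputable def hasRedex (t : Tm) : Bool :=
  Tm.rec (motive := fun _ => Bool)
    (fun _ => false)
    (fun _ => false)
    (fun _ _ a b => bif a then true else b)
    (fun _ t a b => bif isEta t then true else bif a then true else b)
    (fun t _ a b => bif isIntro t then true else bif a then true else b)
    (fun _ _ a b => bif a then true else b)
    (fun _ _ a b => bif a then true else b)
    (fun _ _ _ _ t a b c d e => bif isIntro t then true else bif a then true else bif b then true else bif c then true else bif d then true else e)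
    (fun _ _ a b => bif a then true else b)
    (fun _ a => a)
    (fun _ a => a)
    (fun _ _ _ _ _ t a b c d e f => bif isIntro t then true else bif a then true else bif b then true else bif c then true else bif d then true else bif e then true else f)
    false
    (fun _ _ a b => bif a then true else b)
    false
    false
    (fun _ _ t a b c => bif isIntro t then true else bif a then true else bif b then true else c)
    false
    false
    (fun _ a => a)
    (fun _ _ _ t a b c d => bif isIntro t then true else bif a then true else bif b then true else bif c then true else d)
    (fun _ _ _ a b c => bif a then true else bif b then true else c)
    (fun _ a => a)
    (fun _ _ _ _ _ t a b c d e f => bif isIntro t then true else bif a then true else bif b then true else bif c then true else bif d then true else bif e then true else f)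
    (fun _ => false)
    t

end Tm

/-! ### Well-typed equations -/

/-- `t` equals the well-typed term `t'` of the well-formed type `S`. -/
structure EqD (Γ : Ctx) (t t' S : Tm) : Prop where
  tm : Der (tm Γ t' S)
  eq : Der (eq Γ t t' S)
  ty : ∃ i, Der (Judgment.tm Γ S (U i))

theorem Der.cumul_le {Γ : Ctx} {A : Tm} {i j : ℕ} (h : Der (tm Γ A (U i))) (hij : i ≤ j) :
    Der (tm Γ A (U j)) := by
  induction hij with
  | refl => exact h
  | step _ ih => exact .U_cumul ih

theorem Der.cumul_eq_le {Γ : Ctx} {A B : Tm} {i j : ℕ} (h : Der (eq Γ A B (U i))) (hij : i ≤ j) :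
    Der (eq Γ A B (U j)) := by
  induction hij with
  | refl => exact h
  | step _ ih => exact .U_cumul_eq ih

/-- A type judgment for a `Π`-term can end only in formation, conversion or cumulativity, and the
last two keep the term. Descending through them reaches the formation rule, without any injectivity
of `Π`. -/
theorem Der.inv_pi {Γ : Ctx} {A B X : Tm} (h : Der (tm Γ (pi A B) X)) :
    ∃ i, Der (tm Γ A (U i)) ∧ Der (tm (A :: Γ) B (U i)) := by
  generalize hJ : tm Γ (pi A B) X = J at h
  induction h generalizing X with
  | pi_form hA hB => cases hJ; exact ⟨_, hA, hB⟩
  | conv _ _ ih => cases hJ; exact ih rfl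
  | U_cumul _ ih => cases hJ; exact ih rfl
  | _ => cases hJ

theorem Der.inv_sigma {Γ : Ctx} {A B X : Tm} (h : Der (tm Γ (sigma A B) X)) :
    ∃ i, Der (tm Γ A (U i)) ∧ Der (tm (A :: Γ) B (U i)) := by
  generalize hJ : tm Γ (sigma A B) X = J at h
  induction h generalizing X with
  | sigma_form hA hB => cases hJ; exact ⟨_, hA, hB⟩
  | conv _ _ ih => cases hJ; exact ih rfl
  | U_cumul _ ih => cases hJ; exact ih rfl
  | _ => cases hJ

theorem Der.inv_sum {Γ : Ctx} {A B X : Tm} (h : Der (tm Γ (sum A B) X)) :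
    ∃ i, Der (tm Γ A (U i)) ∧ Der (tm Γ B (U i)) := by
  generalize hJ : tm Γ (sum A B) X = J at h
  induction h generalizing X with
  | sum_form hA hB => cases hJ; exact ⟨_, hA, hB⟩
  | conv _ _ ih => cases hJ; exact ih rfl
  | U_cumul _ ih => cases hJ; exact ih rfl
  | _ => cases hJ

theorem Der.inv_id {Γ : Ctx} {A a b X : Tm} (h : Der (tm Γ (id A a b) X)) :
    (∃ i, Der (tm Γ A (U i))) ∧ Der (tm Γ a A) ∧ Der (tm Γ b A) := by
  generalize hJ : tm Γ (id A a b) X = J at h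
  induction h generalizing X with
  | id_form hA ha hb => cases hJ; exact ⟨⟨_, hA⟩, ha, hb⟩
  | conv _ _ ih => cases hJ; exact ih rfl
  | U_cumul _ ih => cases hJ; exact ih rfl
  | _ => cases hJ

theorem Der.var_ty {Γ : Ctx} {A : Tm} {k : ℕ} (h : Der (ctx Γ)) (hk : Γ[k]? = some A) :
    ∃ i, Der (tm Γ (lift (k + 1) A) (U i)) := by
  induction Γ generalizing k with
  | nil => cases hk
  | cons B Γ ih =>
    cases k with
    | zero =>
      obtain rfl : B = A := by simpa using hk
      obtain ⟨i, hi⟩ := h.ctx_head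
      exact ⟨i, hi.weaken h⟩
    | succ k =>
      obtain ⟨i, hi⟩ := ih h.ctx_tail (by simpa using hk)
      have := hi.weaken h
      rw [lift_lift] at this
      exact ⟨i, this⟩

namespace EqD

variable {Γ : Ctx}

theorem refl {t S : Tm} {i : ℕ} (h : Der (Judgment.tm Γ t S)) (hS : Der (Judgment.tm Γ S (U i))) :
    EqD Γ t t S :=
  ⟨h, .eq_refl h, _, hS⟩

theorem trans {t t' t'' S : Tm} (h : EqD Γ t t' S) (h' : EqD Γ t' t'' S) : EqD Γ t t'' S :=
  ⟨h'.tm, .eq_trans h.eq h'.eq, h.ty⟩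

theorem ctx {t t' S : Tm} (h : EqD Γ t t' S) : Der (ctx Γ) := h.tm.ctx_of_tm

theorem conv {t t' S S' : Tm} {i : ℕ} (h : EqD Γ t t' S) (hS : EqD Γ S S' (U i)) :
    EqD Γ t t' S' :=
  ⟨.conv h.tm hS.eq, .eq_conv h.eq hS.eq, _, hS.tm⟩

theorem conv_symm {t t' S S' : Tm} {i : ℕ} (h : EqD Γ t t' S') (hS : EqD Γ S S' (U i))
    (hS' : ∃ j, Der (Judgment.tm Γ S (U j))) : EqD Γ t t' S :=
  ⟨.conv h.tm hS.eq.eq_symm, .eq_conv h.eq hS.eq.eq_symm, hS'⟩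

theorem U_ty (h : Der (Judgment.ctx Γ)) (i : ℕ) : ∃ j, Der (Judgment.tm Γ (U i) (U j)) :=
  ⟨_, .U_intro h⟩

theorem cumul {A A' : Tm} {i j : ℕ} (h : EqD Γ A A' (U i)) (hij : i ≤ j) : EqD Γ A A' (U j) :=
  ⟨h.tm.cumul_le hij, h.eq.cumul_eq_le hij, U_ty h.ctx j⟩

theorem pi {A A' B B' : Tm} {i j : ℕ} (hA : EqD Γ A A' (U i)) (hB : EqD (A' :: Γ) B B' (U j)) :
    EqD Γ (Tm.pi A B) (Tm.pi A' B') (U (max i j)) := by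
  have hA := hA.cumul (le_max_left i j)
  have hB := hB.cumul (le_max_right i j)
  -- The body is known over the new domain `A'`, whereas the congruence rule types it over the
  -- left-hand one. The rule is therefore applied to the reversed equations; the same happens for
  -- the other constructors with dependent premises.
  exact ⟨.pi_form hA.tm hB.tm,
    .eq_symm (.pi_form_eq hA.eq.eq_symm hB.eq.eq_symm), U_ty hA.ctx _⟩

theorem sigma {A A' B B' : Tm} {i j : ℕ} (hA : EqD Γ A A' (U i))
    (hB : EqD (A' :: Γ) B B' (U j)) :
    EqD Γ (Tm.sigma A B) (Tm.sigma A' B') (U (max i j)) := by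
  have hA := hA.cumul (le_max_left i j)
  have hB := hB.cumul (le_max_right i j)
  exact ⟨.sigma_form hA.tm hB.tm,
    .eq_symm (.sigma_form_eq hA.eq.eq_symm hB.eq.eq_symm), U_ty hA.ctx _⟩

theorem sum {A A' B B' : Tm} {i j : ℕ} (hA : EqD Γ A A' (U i)) (hB : EqD Γ B B' (U j)) :
    EqD Γ (Tm.sum A B) (Tm.sum A' B') (U (max i j)) := by
  have hA := hA.cumul (le_max_left i j)
  have hB := hB.cumul (le_max_right i j)
  exact ⟨.sum_form hA.tm hB.tm, .sum_form_eq hA.eq hB.eq, U_ty hA.ctx _⟩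

theorem id {A A' a a' b b' : Tm} {i : ℕ} (hA : EqD Γ A A' (U i)) (ha : EqD Γ a a' A')
    (hb : EqD Γ b b' A') : EqD Γ (Tm.id A a b) (Tm.id A' a' b') (U i) :=
  ⟨.id_form hA.tm ha.tm hb.tm,
    .eq_symm (.id_form_eq hA.eq.eq_symm ha.eq.eq_symm hb.eq.eq_symm), U_ty hA.ctx _⟩

theorem lam {A A' b b' B : Tm} {i : ℕ} (hA : EqD Γ A A' (U i)) (hb : EqD (A' :: Γ) b b' B) :
    EqD Γ (Tm.lam A b) (Tm.lam A' b') (Tm.pi A' B) := by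
  obtain ⟨j, hB⟩ := hb.ty
  exact ⟨.pi_intro hb.tm, .eq_symm (.pi_intro_eq hA.eq.eq_symm hb.eq.eq_symm), _,
    .pi_form (hA.tm.cumul_le (le_max_left i j)) (hB.cumul_le (le_max_right i j))⟩

theorem app {A B f f' a a' : Tm} (hf : EqD Γ f f' (Tm.pi A B)) (ha : EqD Γ a a' A) :
    EqD Γ (Tm.app f a) (Tm.app f' a') (inst B a') := by
  obtain ⟨_, hp⟩ := hf.ty
  obtain ⟨_, _, hB⟩ := hp.inv_pi
  exact ⟨.pi_elim hf.tm ha.tm, .eq_symm (.pi_elim_eq hf.eq.eq_symm ha.eq.eq_symm), _,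
    hB.inst_ty ha.tm⟩

theorem beta {A B b b' a : Tm} (hA : ∃ i, Der (Judgment.tm Γ A (U i)))
    (hb : EqD (A :: Γ) b b' B) (ha : Der (Judgment.tm Γ a A)) :
    EqD Γ (Tm.app (Tm.lam A b) a) (inst b' a) (inst B a) := by
  obtain ⟨_, hA⟩ := hA
  obtain ⟨_, hB⟩ := hb.ty
  exact ⟨hb.tm.inst_tm ha,
    .eq_trans (.pi_elim_eq (.pi_intro_eq (.eq_refl hA) hb.eq) (.eq_refl ha))
      (.pi_comp hb.tm ha), _, hB.inst_ty ha⟩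

theorem eta {A B f : Tm} (hf : Der (Judgment.tm Γ f (Tm.pi A B)))
    (hp : ∃ i, Der (Judgment.tm Γ (Tm.pi A B) (U i))) :
    EqD Γ (Tm.lam A (Tm.app (lift 1 f) (Tm.var 0))) f (Tm.pi A B) :=
  ⟨hf, .eq_symm (.pi_uniq hf), hp⟩

theorem pair {A B a a' b b' : Tm} (hS : ∃ i, Der (Judgment.tm Γ (Tm.sigma A B) (U i)))
    (ha : EqD Γ a a' A) (hb : EqD Γ b b' (inst B a')) :
    EqD Γ (Tm.pair a b) (Tm.pair a' b') (Tm.sigma A B) := by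
  obtain ⟨_, hS⟩ := hS
  obtain ⟨_, _, hB⟩ := hS.inv_sigma
  exact ⟨.sigma_intro hB ha.tm hb.tm,
    .eq_symm (.sigma_intro_eq hB ha.eq.eq_symm hb.eq.eq_symm), _, hS⟩

theorem inl {A B a a' : Tm} (hS : ∃ i, Der (Judgment.tm Γ (Tm.sum A B) (U i)))
    (ha : EqD Γ a a' A) : EqD Γ (Tm.inl a) (Tm.inl a') (Tm.sum A B) := by
  obtain ⟨_, hS⟩ := hS
  obtain ⟨_, hA, hB⟩ := hS.inv_sum
  exact ⟨.sum_intro_inl hA hB ha.tm, .sum_intro_inl_eq hA hB ha.eq, _, hS⟩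

theorem inr {A B b b' : Tm} (hS : ∃ i, Der (Judgment.tm Γ (Tm.sum A B) (U i)))
    (hb : EqD Γ b b' B) : EqD Γ (Tm.inr b) (Tm.inr b') (Tm.sum A B) := by
  obtain ⟨_, hS⟩ := hS
  obtain ⟨_, hA, hB⟩ := hS.inv_sum
  exact ⟨.sum_intro_inr hA hB hb.tm, .sum_intro_inr_eq hA hB hb.eq, _, hS⟩

theorem succ {m m' : Tm} (hm : EqD Γ m m' Tm.nat) : EqD Γ (Tm.succ m) (Tm.succ m') Tm.nat :=
  ⟨.nat_intro_succ hm.tm, .nat_intro_succ_eq hm.eq, hm.ty⟩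

theorem reflexivity {A a a' : Tm} (ha : EqD Γ a a' A) :
    EqD Γ (Tm.refl a) (Tm.refl a') (Tm.id A a' a') := by
  obtain ⟨_, hA⟩ := ha.ty
  exact ⟨.id_intro hA ha.tm, .eq_symm (.id_intro_eq hA ha.eq.eq_symm), _,
    .id_form hA ha.tm ha.tm⟩

theorem sigmaInd {A A' B B' C C' g g' p p' : Tm} {i j k : ℕ} (hA : EqD Γ A A' (U i))
    (hB : EqD (A' :: Γ) B B' (U j)) (hC : EqD (Tm.sigma A' B' :: Γ) C C' (U k))
    (hg : EqD (B' :: A' :: Γ) g g' (instAt 2 C' (Tm.pair (Tm.var 1) (Tm.var 0))))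
    (hp : EqD Γ p p' (Tm.sigma A' B')) :
    EqD Γ (Tm.sigmaInd A B C g p) (Tm.sigmaInd A' B' C' g' p') (inst C' p') := by
  have hA := hA.cumul (le_max_left i j)
  have hB := hB.cumul (le_max_right i j)
  exact ⟨.sigma_elim hC.tm hg.tm hp.tm,
    .eq_symm (.sigma_elim_eq hA.eq.eq_symm hB.eq.eq_symm hC.eq.eq_symm hg.eq.eq_symm
      hp.eq.eq_symm), _, hC.tm.inst_ty hp.tm⟩

theorem sumInd {A A' B B' C C' c c' d d' e e' : Tm} {i j k : ℕ} (hA : EqD Γ A A' (U i))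
    (hB : EqD Γ B B' (U j)) (hC : EqD (Tm.sum A' B' :: Γ) C C' (U k))
    (hc : EqD (A' :: Γ) c c' (instAt 1 C' (Tm.inl (Tm.var 0))))
    (hd : EqD (B' :: Γ) d d' (instAt 1 C' (Tm.inr (Tm.var 0))))
    (he : EqD Γ e e' (Tm.sum A' B')) :
    EqD Γ (Tm.sumInd A B C c d e) (Tm.sumInd A' B' C' c' d' e') (inst C' e') := by
  have hA := hA.cumul (le_max_left i j)
  have hB := hB.cumul (le_max_right i j)
  exact ⟨.sum_elim hC.tm hc.tm hd.tm he.tm,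
    .eq_symm (.sum_elim_eq hA.eq.eq_symm hB.eq.eq_symm hC.eq.eq_symm hc.eq.eq_symm
      hd.eq.eq_symm he.eq.eq_symm), _, hC.tm.inst_ty he.tm⟩

theorem emptyInd {C C' e e' : Tm} {k : ℕ} (hC : EqD (Tm.empty :: Γ) C C' (U k))
    (he : EqD Γ e e' Tm.empty) : EqD Γ (Tm.emptyInd C e) (Tm.emptyInd C' e') (inst C' e') :=
  ⟨.empty_elim hC.tm he.tm, .eq_symm (.empty_elim_eq hC.eq.eq_symm he.eq.eq_symm), _,
    hC.tm.inst_ty he.tm⟩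

theorem unitInd {C C' c c' e e' : Tm} {k : ℕ} (hC : EqD (Tm.unit :: Γ) C C' (U k))
    (hc : EqD Γ c c' (inst C' Tm.star)) (he : EqD Γ e e' Tm.unit) :
    EqD Γ (Tm.unitInd C c e) (Tm.unitInd C' c' e') (inst C' e') :=
  ⟨.unit_elim hC.tm hc.tm he.tm,
    .eq_symm (.unit_elim_eq hC.eq.eq_symm hc.eq.eq_symm he.eq.eq_symm), _,
    hC.tm.inst_ty he.tm⟩

theorem natInd {C C' c c' d d' m m' : Tm} {k : ℕ} (hC : EqD (Tm.nat :: Γ) C C' (U k))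
    (hc : EqD Γ c c' (inst C' Tm.zero))
    (hd : EqD (C' :: Tm.nat :: Γ) d d' (instAt 2 C' (Tm.succ (Tm.var 1))))
    (hm : EqD Γ m m' Tm.nat) :
    EqD Γ (Tm.natInd C c d m) (Tm.natInd C' c' d' m') (inst C' m') :=
  ⟨.nat_elim hC.tm hc.tm hd.tm hm.tm,
    .eq_symm (.nat_elim_eq hC.eq.eq_symm hc.eq.eq_symm hd.eq.eq_symm hm.eq.eq_symm), _,
    hC.tm.inst_ty hm.tm⟩

end EqD

theorem Der.inst₂_tm {Γ : Ctx} {a b A B g C : Tm} (h : Der (tm (B :: A :: Γ) g C))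
    (ha : Der (tm Γ a A)) (hb : Der (tm Γ b (inst B a))) :
    Der (tm Γ (inst₂ g a b) (inst₂ C a b)) :=
  h.subst_tm ha.ctx_of_tm (((IsSub.refl ha.ctx_of_tm).cons (by rwa [subst_var])).cons hb)

theorem inst₂_lift_one (A a b : Tm) : inst₂ (lift 1 A) a b = inst A a := by
  rw [inst₂, subst_cons_lift]; rfl

theorem inst₂_lift_two (A a b : Tm) : inst₂ (lift 2 A) a b = A := by
  rw [show 2 = 1 + 1 from rfl, ← lift_lift, inst₂_lift_one, inst_lift]

theorem Der.inst₃_tm {Γ : Ctx} {a b q A c C : Tm}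
    (h : Der (tm (Tm.id (lift 2 A) (Tm.var 1) (Tm.var 0) :: lift 1 A :: A :: Γ) c C))
    (ha : Der (tm Γ a A)) (hb : Der (tm Γ b A)) (hq : Der (tm Γ q (Tm.id A a b))) :
    Der (tm Γ (inst₃ c a b q) (inst₃ C a b q)) := by
  refine h.subst_tm ha.ctx_of_tm ((((IsSub.refl ha.ctx_of_tm).cons ?_).cons ?_).cons ?_)
  · rwa [subst_var]
  · rwa [subst_cons_lift, subst_var]
  · have : Tm.subst (Tm.cons b (Tm.cons a Tm.var)) (lift 2 A) = A := inst₂_lift_two A a b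
    simpa only [Tm.subst, this, Tm.cons] using hq

theorem inst_instRefl (C a : Tm) : inst (instRefl C) a = inst₃ C a a (Tm.refl a) := by
  rw [inst, instRefl, subst_subst, inst₃]
  congr 1; funext k; rcases k with _ | _ | _ | k <;> rfl

theorem inst₂_instAt_pair (C a b : Tm) :
    inst₂ (instAt 2 C (Tm.pair (Tm.var 1) (Tm.var 0))) a b = inst C (Tm.pair a b) := by
  rw [inst₂, instAt, subst_subst, inst]
  congr 1; funext k; rcases k with _ | k <;> rfl

theorem inst₂_instAt_succ (C a b : Tm) :
    inst₂ (instAt 2 C (Tm.succ (Tm.var 1))) a b = inst C (Tm.succ a) := by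
  rw [inst₂, instAt, subst_subst, inst]
  congr 1; funext k; rcases k with _ | k <;> rfl

theorem inst_instAt_inl (C a : Tm) :
    inst (instAt 1 C (Tm.inl (Tm.var 0))) a = inst C (Tm.inl a) := by
  rw [inst, instAt, subst_subst, inst]
  congr 1; funext k; rcases k with _ | k <;> rfl

theorem inst_instAt_inr (C a : Tm) :
    inst (instAt 1 C (Tm.inr (Tm.var 0))) a = inst C (Tm.inr a) := by
  rw [inst, instAt, subst_subst, inst]
  congr 1; funext k; rcases k with _ | k <;> rfl

namespace EqD

variable {Γ : Ctx}

theorem idInd {A A' C C' c c' a a' b b' q q' : Tm} {i k : ℕ} (hA : EqD Γ A A' (U i))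
    (hC : EqD (Tm.id (lift 2 A') (Tm.var 1) (Tm.var 0) :: lift 1 A' :: A' :: Γ) C C' (U k))
    (hc : EqD (A' :: Γ) c c' (instRefl C')) (ha : EqD Γ a a' A') (hb : EqD Γ b b' A')
    (hq : EqD Γ q q' (Tm.id A' a' b')) :
    EqD Γ (Tm.idInd A C c a b q) (Tm.idInd A' C' c' a' b' q') (inst₃ C' a' b' q') :=
  ⟨.id_elim hC.tm hc.tm ha.tm hb.tm hq.tm,
    .eq_symm (.id_elim_eq hA.eq.eq_symm hC.eq.eq_symm hc.eq.eq_symm ha.eq.eq_symm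
      hb.eq.eq_symm hq.eq.eq_symm), _, hC.tm.inst₃_tm ha.tm hb.tm hq.tm⟩

end EqD

end HoTT

namespace HoTT

open Tm Judgment

/-! ### A normalizer that infers types -/

/-- Functions that, in a context, normalize a term and infer its type, or check it against a given
type. -/
abbrev Run := Ctx → Tm → Option Tm → Option (Tm × Tm)

/-- The results of `r` are derivable. -/
def Run.Sound (r : Run) : Prop :=
  ∀ Γ t e s, Der (ctx Γ) → (∀ T, e = some T → ∃ i, Der (tm Γ T (U i))) → r Γ t e = some s →
    EqD Γ t s.1 s.2 ∧ ∀ T, e = some T → s.2 = T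

noncomputable section

/-- `inst` computed by `fsubst`. -/
def finst (B a : Tm) : Tm := fsubst (cons a Tm.var) B 0

/-- `inst₂` computed by `fsubst`. -/
def finst₂ (g a b : Tm) : Tm := fsubst (cons b (cons a Tm.var)) g 0

/-- `inst₃` computed by `fsubst`. -/
def finst₃ (C a b q : Tm) : Tm := fsubst (cons q (cons b (cons a Tm.var))) C 0

/-- `instAt` computed by `fsubst`. -/
def finstAt (j : ℕ) (C t : Tm) : Tm := fsubst (cons t (fun k => Tm.var (k + j))) C 0

/-- `instRefl` computed by `fsubst`. -/
def finstRefl (C : Tm) : Tm :=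
  fsubst (cons (refl (Tm.var 0)) (cons (Tm.var 0) (cons (Tm.var 0) (fun k => Tm.var (k + 1))))) C 0

/-- Compares an inferred type with the expected one. -/
def fin (e : Option Tm) (t S : Tm) : Option (Tm × Tm) :=
  match e with
  | none => some (t, S)
  | some T => bif beq S T then some (t, S) else
    -- Cumulativity is used only between universes themselves, not underneath `Π` or `Σ`.
    match S with
    | U i => match T with
      | U j => bif Nat.ble i j then some (t, U j) else none
      | _ => none
    | _ => none

variable (r : Run)

/-- Normalizes a type and infers its universe. -/
def Run.ty (Γ : Ctx) (A : Tm) : Option (Tm × ℕ) :=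
  (r Γ A none).bind fun s => match s.2 with
    | U i => some (s.1, i)
    | _ => none

/-- Normalizes a well-formed type. -/
def Run.nty (Γ : Ctx) (A : Tm) : Option Tm :=
  bif hasRedex A then (r.ty Γ A).bind fun s => some s.1 else some A

/-- Normalizes and checks a term. -/
def Run.chk (Γ : Ctx) (t T : Tm) : Option Tm := (r Γ t (some T)).bind fun s => some s.1

/-- Normalizes a well-typed term. -/
def Run.post (Γ : Ctx) (t T : Tm) : Option Tm :=
  bif hasRedex t then r.chk Γ t T else some t

def Run.stepPi (Γ : Ctx) (A B : Tm) (e : Option Tm) : Option (Tm × Tm) :=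
  (r.ty Γ A).bind fun A' => (r.ty (A'.1 :: Γ) B).bind fun B' =>
    fin e (Tm.pi A'.1 B'.1) (U (max A'.2 B'.2))

def Run.stepSigma (Γ : Ctx) (A B : Tm) (e : Option Tm) : Option (Tm × Tm) :=
  (r.ty Γ A).bind fun A' => (r.ty (A'.1 :: Γ) B).bind fun B' =>
    fin e (Tm.sigma A'.1 B'.1) (U (max A'.2 B'.2))

def Run.stepSum (Γ : Ctx) (A B : Tm) (e : Option Tm) : Option (Tm × Tm) :=
  (r.ty Γ A).bind fun A' => (r.ty Γ B).bind fun B' =>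
    fin e (Tm.sum A'.1 B'.1) (U (max A'.2 B'.2))

def Run.stepId (Γ : Ctx) (A a b : Tm) (e : Option Tm) : Option (Tm × Tm) :=
  (r.ty Γ A).bind fun A' => (r.chk Γ a A'.1).bind fun a' => (r.chk Γ b A'.1).bind fun b' =>
    fin e (Tm.id A'.1 a' b') (U A'.2)

/-- Contracts the function `λ (x : A), b` of type `Π (x : A), B` if it is an `η`-redex. -/
def Run.eta (Γ : Ctx) (A b B : Tm) : Option Tm :=
  bif isEta b then
    match b with
    | Tm.app g _ => (r.chk Γ (lower g) (Tm.pi A B)).bind fun f =>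
        bif beq f (lower g) then some f else none
    | _ => none
  else some (Tm.lam A b)

def Run.stepLam (Γ : Ctx) (A b : Tm) (e : Option Tm) : Option (Tm × Tm) :=
  (r.ty Γ A).bind fun A' =>
    match e with
    | some (Tm.pi A₁ B) => bif beq A'.1 A₁ then
        (r.chk (A'.1 :: Γ) b B).bind fun b' =>
          (r.eta Γ A'.1 b' B).bind fun t => some (t, Tm.pi A'.1 B)
        else none
    | _ => (r (A'.1 :: Γ) b none).bind fun b' =>
        (r.eta Γ A'.1 b'.1 b'.2).bind fun t => fin e t (Tm.pi A'.1 b'.2)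

/-- A type over one more variable that, at `a`, becomes `T`. -/
def abst (a T : Tm) : Tm :=
  match a with
  | Tm.var k => fsubst (fun j => bif Nat.beq j k then Tm.var 0 else Tm.var (j + 1)) T 0
  | _ => flift 1 T 0

/-- The type of the argument `a` of the function `f`. -/
def Run.dom (Γ : Ctx) (f a : Tm) : Option (Tm × ℕ) :=
  match f with
  | Tm.lam A _ => r.ty Γ A
  | _ => (r Γ a none).bind fun a' => r.ty Γ a'.2

/-- Normalizes a function that is applied to `a`; if its type cannot be inferred, then it is
guessed from the expected type of the application. -/
def Run.head (Γ : Ctx) (f a : Tm) (e : Option Tm) : Option (Tm × Tm) :=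
  match r Γ f none with
  | some F => some F
  | none => match e with
    | some T => (r.dom Γ f a).bind fun A => (r.chk Γ a A.1).bind fun a' =>
        (r.ty (A.1 :: Γ) (abst a' T)).bind fun B => r Γ f (some (Tm.pi A.1 B.1))
    | none => none

def Run.stepApp (Γ : Ctx) (f a : Tm) (e : Option Tm) : Option (Tm × Tm) :=
  (r.head Γ f a e).bind fun F =>
    match F.2 with
    | Tm.pi A B => (r.chk Γ a A).bind fun a' => (r.nty Γ (finst B a')).bind fun T =>
        match F.1 with
        | Tm.lam A₁ b => bif beq A₁ A then
            -- A typing of `λ` at a given `Π`-type does not yield one of its body without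
            -- injectivity of `Π`, so the body is checked again before the contraction.
            (r.chk (A :: Γ) b B).bind fun b' => (r.post Γ (finst b' a') T).bind fun t => fin e t T
            else none
        | _ => fin e (Tm.app F.1 a') T
    | _ => none

def Run.stepPair (Γ : Ctx) (a b : Tm) (e : Option Tm) : Option (Tm × Tm) :=
  match e with
  | some (Tm.sigma A B) => (r.chk Γ a A).bind fun a' => (r.nty Γ (finst B a')).bind fun T =>
      (r.chk Γ b T).bind fun b' => some (Tm.pair a' b', Tm.sigma A B)
  | _ => none

def Run.stepInl (Γ : Ctx) (a : Tm) (e : Option Tm) : Option (Tm × Tm) :=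
  match e with
  | some (Tm.sum A B) => (r.chk Γ a A).bind fun a' => some (Tm.inl a', Tm.sum A B)
  | _ => none

def Run.stepInr (Γ : Ctx) (a : Tm) (e : Option Tm) : Option (Tm × Tm) :=
  match e with
  | some (Tm.sum A B) => (r.chk Γ a B).bind fun a' => some (Tm.inr a', Tm.sum A B)
  | _ => none

def Run.stepRefl (Γ : Ctx) (a : Tm) (e : Option Tm) : Option (Tm × Tm) :=
  match e with
  | some (Tm.id A x y) => (r.chk Γ a A).bind fun a' =>
      bif beq a' x then bif beq a' y then some (Tm.refl a', Tm.id A x y) else none else none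
  | _ => (r Γ a none).bind fun a' => fin e (Tm.refl a'.1) (Tm.id a'.2 a'.1 a'.1)

def Run.stepSigmaInd (Γ : Ctx) (A B C g p : Tm) (e : Option Tm) : Option (Tm × Tm) :=
  (r.ty Γ A).bind fun A' => (r.ty (A'.1 :: Γ) B).bind fun B' =>
  (r.ty (Tm.sigma A'.1 B'.1 :: Γ) C).bind fun C' =>
  (r.nty (B'.1 :: A'.1 :: Γ) (finstAt 2 C'.1 (Tm.pair (Tm.var 1) (Tm.var 0)))).bind fun G =>
  (r.chk (B'.1 :: A'.1 :: Γ) g G).bind fun g' => (r.chk Γ p (Tm.sigma A'.1 B'.1)).bind fun p' =>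
    match p' with
    -- As for `λ`, the typing of a pair is not inverted; its components are checked again.
    | Tm.pair x y => (r.chk Γ x A'.1).bind fun x' => (r.nty Γ (finst B'.1 x')).bind fun Y =>
        (r.chk Γ y Y).bind fun y' => (r.nty Γ (finst C'.1 (Tm.pair x' y'))).bind fun T =>
          (r.post Γ (finst₂ g' x' y') T).bind fun t => fin e t T
    | _ => (r.nty Γ (finst C'.1 p')).bind fun T =>
        fin e (Tm.sigmaInd A'.1 B'.1 C'.1 g' p') T

def Run.stepSumInd (Γ : Ctx) (A B C c d p : Tm) (e : Option Tm) : Option (Tm × Tm) :=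
  (r.ty Γ A).bind fun A' => (r.ty Γ B).bind fun B' =>
  (r.ty (Tm.sum A'.1 B'.1 :: Γ) C).bind fun C' =>
  (r.nty (A'.1 :: Γ) (finstAt 1 C'.1 (Tm.inl (Tm.var 0)))).bind fun G =>
  (r.nty (B'.1 :: Γ) (finstAt 1 C'.1 (Tm.inr (Tm.var 0)))).bind fun H =>
  (r.chk (A'.1 :: Γ) c G).bind fun c' => (r.chk (B'.1 :: Γ) d H).bind fun d' =>
  (r.chk Γ p (Tm.sum A'.1 B'.1)).bind fun p' =>
    match p' with
    | Tm.inl x => (r.chk Γ x A'.1).bind fun x' => (r.nty Γ (finst C'.1 (Tm.inl x'))).bind fun T =>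
          (r.post Γ (finst c' x') T).bind fun t => fin e t T
    | Tm.inr x => (r.chk Γ x B'.1).bind fun x' => (r.nty Γ (finst C'.1 (Tm.inr x'))).bind fun T =>
          (r.post Γ (finst d' x') T).bind fun t => fin e t T
    | _ => (r.nty Γ (finst C'.1 p')).bind fun T =>
        fin e (Tm.sumInd A'.1 B'.1 C'.1 c' d' p') T

def Run.stepEmptyInd (Γ : Ctx) (C p : Tm) (e : Option Tm) : Option (Tm × Tm) :=
  (r.ty (Tm.empty :: Γ) C).bind fun C' => (r.chk Γ p Tm.empty).bind fun p' =>
  (r.nty Γ (finst C'.1 p')).bind fun T => fin e (Tm.emptyInd C'.1 p') T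

def Run.stepUnitInd (Γ : Ctx) (C c p : Tm) (e : Option Tm) : Option (Tm × Tm) :=
  (r.ty (Tm.unit :: Γ) C).bind fun C' => (r.nty Γ (finst C'.1 Tm.star)).bind fun G =>
  (r.chk Γ c G).bind fun c' => (r.chk Γ p Tm.unit).bind fun p' =>
    match p' with
    | Tm.star => fin e c' G
    | _ => (r.nty Γ (finst C'.1 p')).bind fun T => fin e (Tm.unitInd C'.1 c' p') T

def Run.stepNatInd (Γ : Ctx) (C c d m : Tm) (e : Option Tm) : Option (Tm × Tm) :=
  (r.ty (Tm.nat :: Γ) C).bind fun C' => (r.nty Γ (finst C'.1 Tm.zero)).bind fun G =>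
  (r.nty (C'.1 :: Tm.nat :: Γ) (finstAt 2 C'.1 (Tm.succ (Tm.var 1)))).bind fun H =>
  (r.chk Γ c G).bind fun c' => (r.chk (C'.1 :: Tm.nat :: Γ) d H).bind fun d' =>
  (r.chk Γ m Tm.nat).bind fun m' =>
    match m' with
    | Tm.zero => fin e c' G
    | Tm.succ k => (r.nty Γ (finst C'.1 (Tm.succ k))).bind fun T =>
        (r.post Γ (finst₂ d' k (Tm.natInd C'.1 c' d' k)) T).bind fun t => fin e t T
    | _ => (r.nty Γ (finst C'.1 m')).bind fun T => fin e (Tm.natInd C'.1 c' d' m') T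

def Run.stepIdInd (Γ : Ctx) (A C c a b q : Tm) (e : Option Tm) : Option (Tm × Tm) :=
  (r.ty Γ A).bind fun A' =>
  (r.ty (Tm.id (flift 2 A'.1 0) (Tm.var 1) (Tm.var 0) :: flift 1 A'.1 0 :: A'.1 :: Γ) C).bind
    fun C' =>
  (r.nty (A'.1 :: Γ) (finstRefl C'.1)).bind fun G => (r.chk (A'.1 :: Γ) c G).bind fun c' =>
  (r.chk Γ a A'.1).bind fun a' => (r.chk Γ b A'.1).bind fun b' =>
  (r.chk Γ q (Tm.id A'.1 a' b')).bind fun q' => (r.nty Γ (finst₃ C'.1 a' b' q')).bind fun T =>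
    match q' with
    | Tm.refl x => bif beq a' x then bif beq b' x then
        (r.post Γ (finst c' x) T).bind fun t => fin e t T else none else none
    | _ => fin e (Tm.idInd A'.1 C'.1 c' a' b' q') T

/-- One level of the normalizer. -/
def Run.step (Γ : Ctx) (t : Tm) (e : Option Tm) : Option (Tm × Tm) :=
  match t with
  | Tm.var k => Γ[k]?.bind fun A => fin e (Tm.var k) (flift (k + 1) A 0)
  | U i => fin e (U i) (U (i + 1))
  | Tm.pi A B => r.stepPi Γ A B e
  | Tm.lam A b => r.stepLam Γ A b e
  | Tm.app f a => r.stepApp Γ f a e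
  | Tm.sigma A B => r.stepSigma Γ A B e
  | Tm.pair a b => r.stepPair Γ a b e
  | Tm.sigmaInd A B C g p => r.stepSigmaInd Γ A B C g p e
  | Tm.sum A B => r.stepSum Γ A B e
  | Tm.inl a => r.stepInl Γ a e
  | Tm.inr b => r.stepInr Γ b e
  | Tm.sumInd A B C c d p => r.stepSumInd Γ A B C c d p e
  | Tm.empty => fin e Tm.empty (U 0)
  | Tm.emptyInd C p => r.stepEmptyInd Γ C p e
  | Tm.unit => fin e Tm.unit (U 0)
  | Tm.star => fin e Tm.star Tm.unit
  | Tm.unitInd C c p => r.stepUnitInd Γ C c p e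
  | Tm.nat => fin e Tm.nat (U 0)
  | Tm.zero => fin e Tm.zero Tm.nat
  | Tm.succ m => (r.chk Γ m Tm.nat).bind fun m' => fin e (Tm.succ m') Tm.nat
  | Tm.natInd C c d m => r.stepNatInd Γ C c d m e
  | Tm.id A a b => r.stepId Γ A a b e
  | Tm.refl a => r.stepRefl Γ a e
  | Tm.idInd A C c a b q => r.stepIdInd Γ A C c a b q e
  -- The normalizer rejects the axiom. Univalence is available to checked terms only as a variable
  -- of the context.
  | Tm.univalence _ => none

/-- The normalizer, with recursion depth at most `n`. -/
def nrm (n : ℕ) : Run :=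
  Nat.rec (motive := fun _ => Run) (fun _ _ _ => none) (fun _ r => r.step) n

end

theorem finst_eq (B a : Tm) : finst B a = inst B a := fsubst_zero _ _

theorem finst₂_eq (g a b : Tm) : finst₂ g a b = inst₂ g a b := fsubst_zero _ _

theorem finst₃_eq (C a b q : Tm) : finst₃ C a b q = inst₃ C a b q := fsubst_zero _ _

theorem finstAt_eq (j : ℕ) (C t : Tm) : finstAt j C t = instAt j C t := fsubst_zero _ _

theorem finstRefl_eq (C : Tm) : finstRefl C = instRefl C := fsubst_zero _ _

theorem of_guard {α : Type*} {c : Bool} {x : Option α} {y : α}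
    (h : (bif c then x else none) = some y) : c = true ∧ x = some y := by
  cases c
  · cases h
  · exact ⟨rfl, h⟩

/-- Unlike for `λ` and pairs, inversion is possible here: the premise is at the fixed type `ℕ`,
whatever type the conclusion has been converted to. -/
theorem Der.inv_succ {Γ : Ctx} {m X : Tm} (h : Der (tm Γ (Tm.succ m) X)) :
    Der (tm Γ m Tm.nat) := by
  generalize hJ : tm Γ (Tm.succ m) X = J at h
  induction h generalizing X with
  | nat_intro_succ hm => cases hJ; exact hm
  | conv _ _ ih => cases hJ; exact ih rfl
  | U_cumul _ ih => cases hJ; exact ih rfl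
  | _ => cases hJ

/-! ### The types of the branches of the eliminators -/

theorem isSub_lift {Γ Δ : Ctx} (j : ℕ) (hΔ : Der (ctx Δ)) (h : ∀ k, Δ[k + j]? = Γ[k]?) :
    IsSub Δ (fun k => Tm.var (k + j)) Γ := by
  intro k A hk
  rw [← lift_eq_subst, lift_lift]
  have := Der.var (k := k + j) hΔ (by rw [h, hk])
  rwa [show k + j + 1 = k + 1 + j by omega] at this

theorem Der.instAt_pair {Γ : Ctx} {A B C : Tm} {i j k : ℕ}
    (hC : Der (tm (Tm.sigma A B :: Γ) C (U k))) (hA : Der (tm Γ A (U i)))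
    (hB : Der (tm (A :: Γ) B (U j))) :
    Der (tm (B :: A :: Γ) (instAt 2 C (Tm.pair (Tm.var 1) (Tm.var 0))) (U k)) := by
  have hc := Der.ctx_cons hB
  have hs : IsSub (B :: A :: Γ) (fun k => Tm.var (k + 2)) Γ := isSub_lift 2 hc fun k => by simp
  refine hC.subst_tm hc (hs.cons ?_)
  rw [← lift_eq_subst]
  have hA' := (hA.weaken hA.ctx_cons).weaken hc
  rw [lift_lift] at hA'
  have hs' : IsSub (lift 2 A :: B :: A :: Γ) (Tm.up fun k => Tm.var (k + 2)) (A :: Γ) := by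
    have := hs.up (A := A) (by rw [← lift_eq_subst]; exact .ctx_cons hA')
    rwa [← lift_eq_subst] at this
  have hB' := hB.subst_tm (.ctx_cons hA') hs'
  have e : lift 2 (Tm.sigma A B) = Tm.sigma (lift 2 A) (Tm.subst (Tm.up fun k => Tm.var (k + 2)) B) := by
    rw [lift_eq_subst, Tm.subst, ← lift_eq_subst]
  rw [e]
  refine .sigma_intro hB' (.var hc rfl) ?_
  have e' : inst (Tm.subst (Tm.up fun k => Tm.var (k + 2)) B) (Tm.var 1) = lift 1 B := by
    rw [inst, subst_subst, lift_eq_subst]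
    congr 1; funext k; cases k <;> rfl
  rw [e']
  exact .var hc rfl

theorem Der.instAt_inl {Γ : Ctx} {A B C : Tm} {i k : ℕ}
    (hC : Der (tm (Tm.sum A B :: Γ) C (U k))) (hA : Der (tm Γ A (U i))) (hB : Der (tm Γ B (U i))) :
    Der (tm (A :: Γ) (instAt 1 C (Tm.inl (Tm.var 0))) (U k)) := by
  have hc := Der.ctx_cons hA
  refine hC.subst_tm hc ((isSub_lift 1 hc fun k => by simp).cons ?_)
  rw [← lift_eq_subst]
  exact .sum_intro_inl (hA.weaken hc) (hB.weaken hc) (.var hc rfl)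

theorem Der.instAt_inr {Γ : Ctx} {A B C : Tm} {i k : ℕ}
    (hC : Der (tm (Tm.sum A B :: Γ) C (U k))) (hA : Der (tm Γ A (U i))) (hB : Der (tm Γ B (U i))) :
    Der (tm (B :: Γ) (instAt 1 C (Tm.inr (Tm.var 0))) (U k)) := by
  have hc := Der.ctx_cons hB
  refine hC.subst_tm hc ((isSub_lift 1 hc fun k => by simp).cons ?_)
  rw [← lift_eq_subst]
  exact .sum_intro_inr (hA.weaken hc) (hB.weaken hc) (.var hc rfl)

theorem Der.instAt_succ {Γ : Ctx} {C : Tm} {k : ℕ} (hC : Der (tm (Tm.nat :: Γ) C (U k))) :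
    Der (tm (C :: Tm.nat :: Γ) (instAt 2 C (Tm.succ (Tm.var 1))) (U k)) := by
  have hc := Der.ctx_cons hC
  exact hC.subst_tm hc ((isSub_lift 2 hc fun k => by simp).cons
    (.nat_intro_succ (m := Tm.var 1) (.var (A := Tm.nat) hc rfl)))

theorem Der.ctx_id {Γ : Ctx} {A : Tm} {i : ℕ} (hA : Der (tm Γ A (U i))) :
    Der (ctx (Tm.id (lift 2 A) (Tm.var 1) (Tm.var 0) :: lift 1 A :: A :: Γ)) := by
  have h1 := hA.weaken (.ctx_cons hA)
  have h2 := h1.weaken (.ctx_cons h1)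
  rw [lift_lift] at h2
  refine .ctx_cons (.id_form h2 (.var (.ctx_cons h1) rfl) ?_)
  have := Der.var (k := 0) (.ctx_cons h1) rfl
  rwa [lift_lift] at this

theorem Der.instRefl_ty {Γ : Ctx} {A C : Tm} {k : ℕ}
    (hC : Der (tm (Tm.id (lift 2 A) (Tm.var 1) (Tm.var 0) :: lift 1 A :: A :: Γ) C (U k))) :
    Der (tm (A :: Γ) (instRefl C) (U k)) := by
  have hc := hC.ctx_of_tm.ctx_tail.ctx_tail
  have h0 : Der (tm (A :: Γ) (Tm.var 0) (lift 1 A)) := .var hc rfl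
  have hA := hc.var_ty (k := 0) rfl
  have h1 := (isSub_lift (Γ := Γ) 1 hc fun k => by simp).cons (A := A)
    (by rw [← lift_eq_subst]; exact h0)
  have h2 := h1.cons (A := lift 1 A) (by rw [subst_cons_lift, ← lift_eq_subst]; exact h0)
  refine hC.subst_tm hc (h2.cons ?_)
  have e : Tm.subst (Tm.cons (Tm.var 0) (Tm.cons (Tm.var 0) fun k => Tm.var (k + 1))) (lift 2 A) =
      lift 1 A := by
    rw [show 2 = 1 + 1 from rfl, ← lift_lift, subst_cons_lift, subst_cons_lift, ← lift_eq_subst]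
  simp only [Tm.subst, e]
  exact .id_intro hA.choose_spec h0

variable {Γ : Ctx}

theorem EqD.fin {t t' S : Tm} {e : Option Tm} {s : Tm × Tm} (h : EqD Γ t t' S)
    (hs : fin e t' S = some s) : EqD Γ t s.1 s.2 ∧ ∀ T, e = some T → s.2 = T := by
  unfold HoTT.fin at hs
  split at hs
  · cases hs
    exact ⟨h, fun _ h => by cases h⟩
  · rename_i T
    cases hb : beq S T
    · rw [hb] at hs
      simp only [cond_false] at hs
      split at hs
      · split at hs
        · obtain ⟨hle, hs⟩ := of_guard hs
          cases hs
          exact ⟨h.cumul (Nat.le_of_ble_eq_true hle), fun _ h => by cases h; rfl⟩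
        · cases hs
      · cases hs
    · rw [hb] at hs
      simp only [cond_true] at hs
      cases hs
      exact ⟨h, fun _ h => by cases h; exact eq_of_beq hb⟩

namespace Run.Sound

variable {r : Run} (hr : r.Sound)
include hr

theorem ty {A : Tm} {s : Tm × ℕ} (hΓ : Der (ctx Γ)) (h : r.ty Γ A = some s) :
    EqD Γ A s.1 (U s.2) := by
  obtain ⟨⟨A', S⟩, h1, h⟩ := Option.bind_eq_some_iff.1 h
  have := (hr Γ A none _ hΓ (fun _ h => by cases h) h1).1
  dsimp only at h this
  split at h
  · cases h; exact this
  · cases h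

theorem chk {t t' T : Tm} (hT : ∃ i, Der (tm Γ T (U i))) (h : r.chk Γ t T = some t') :
    EqD Γ t t' T := by
  obtain ⟨⟨a, S⟩, h1, h⟩ := Option.bind_eq_some_iff.1 h
  have hΓ : Der (ctx Γ) := hT.elim fun _ h => h.ctx_of_tm
  obtain ⟨h2, h3⟩ := hr Γ t (some T) _ hΓ (fun _ h => by cases h; exact hT) h1
  cases h
  obtain rfl : S = T := h3 _ rfl
  exact h2

theorem nty {A A' : Tm} (hA : ∃ i, Der (tm Γ A (U i))) (h : r.nty Γ A = some A') :
    ∃ i, EqD Γ A A' (U i) := by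
  obtain ⟨i, hA⟩ := hA
  unfold Run.nty at h
  cases hb : hasRedex A
  · rw [hb] at h
    cases h
    exact ⟨i, EqD.refl hA (.U_intro hA.ctx_of_tm)⟩
  · rw [hb] at h
    obtain ⟨s, h1, h⟩ := Option.bind_eq_some_iff.1 h
    cases h
    exact ⟨_, hr.ty hA.ctx_of_tm h1⟩

theorem post {t t' T : Tm} (ht : Der (tm Γ t T)) (hT : ∃ i, Der (tm Γ T (U i)))
    (h : r.post Γ t T = some t') : EqD Γ t t' T := by
  unfold Run.post at h
  cases hb : hasRedex t
  · rw [hb] at h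
    cases h
    exact EqD.refl ht hT.choose_spec
  · rw [hb] at h
    exact hr.chk hT h


theorem stepPi {A B : Tm} {e : Option Tm} {s : Tm × Tm} (hΓ : Der (ctx Γ))
    (h : r.stepPi Γ A B e = some s) :
    EqD Γ (Tm.pi A B) s.1 s.2 ∧ ∀ T, e = some T → s.2 = T := by
  obtain ⟨A', h1, h⟩ := Option.bind_eq_some_iff.1 h
  obtain ⟨B', h2, h⟩ := Option.bind_eq_some_iff.1 h
  have hA := hr.ty hΓ h1
  exact (hA.pi (hr.ty (.ctx_cons hA.tm) h2)).fin h

theorem stepSigma {A B : Tm} {e : Option Tm} {s : Tm × Tm} (hΓ : Der (ctx Γ))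
    (h : r.stepSigma Γ A B e = some s) :
    EqD Γ (Tm.sigma A B) s.1 s.2 ∧ ∀ T, e = some T → s.2 = T := by
  obtain ⟨A', h1, h⟩ := Option.bind_eq_some_iff.1 h
  obtain ⟨B', h2, h⟩ := Option.bind_eq_some_iff.1 h
  have hA := hr.ty hΓ h1
  exact (hA.sigma (hr.ty (.ctx_cons hA.tm) h2)).fin h

theorem stepSum {A B : Tm} {e : Option Tm} {s : Tm × Tm} (hΓ : Der (ctx Γ))
    (h : r.stepSum Γ A B e = some s) :
    EqD Γ (Tm.sum A B) s.1 s.2 ∧ ∀ T, e = some T → s.2 = T := by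
  obtain ⟨A', h1, h⟩ := Option.bind_eq_some_iff.1 h
  obtain ⟨B', h2, h⟩ := Option.bind_eq_some_iff.1 h
  exact ((hr.ty hΓ h1).sum (hr.ty hΓ h2)).fin h

theorem stepId {A a b : Tm} {e : Option Tm} {s : Tm × Tm} (hΓ : Der (ctx Γ))
    (h : r.stepId Γ A a b e = some s) :
    EqD Γ (Tm.id A a b) s.1 s.2 ∧ ∀ T, e = some T → s.2 = T := by
  obtain ⟨A', h1, h⟩ := Option.bind_eq_some_iff.1 h
  obtain ⟨a', h2, h⟩ := Option.bind_eq_some_iff.1 h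
  obtain ⟨b', h3, h⟩ := Option.bind_eq_some_iff.1 h
  have hA := hr.ty hΓ h1
  exact (hA.id (hr.chk ⟨_, hA.tm⟩ h2) (hr.chk ⟨_, hA.tm⟩ h3)).fin h

theorem eta {A b B t : Tm} (hb : EqD Γ (Tm.lam A b) (Tm.lam A b) (Tm.pi A B))
    (h : r.eta Γ A b B = some t) : EqD Γ (Tm.lam A b) t (Tm.pi A B) := by
  unfold Run.eta at h
  cases he : isEta b
  · rw [he] at h
    cases h
    exact hb
  · rw [he] at h
    simp only [cond_true] at h
    split at h
    · rename_i g x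
      obtain ⟨f, h1, h⟩ := Option.bind_eq_some_iff.1 h
      obtain ⟨h2, h⟩ := of_guard h
      cases h
      have e1 := eq_of_beq h2
      have h3 := hr.chk hb.ty h1
      unfold isEta at he
      split at he
      · rename_i _ g' heq
        cases heq
        have e2 := eq_of_beq he
        rw [← e1, flift_zero] at e2
        rw [← e2]
        exact EqD.eta h3.tm hb.ty
      · cases he
    · cases h

theorem stepLam {A b : Tm} {e : Option Tm} {s : Tm × Tm} (hΓ : Der (ctx Γ))
    (he : ∀ T, e = some T → ∃ i, Der (tm Γ T (U i))) (h : r.stepLam Γ A b e = some s) :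
    EqD Γ (Tm.lam A b) s.1 s.2 ∧ ∀ T, e = some T → s.2 = T := by
  obtain ⟨A', h1, h⟩ := Option.bind_eq_some_iff.1 h
  have hA := hr.ty hΓ h1
  have key : ∀ {b' B t}, EqD (A'.1 :: Γ) b b' B → r.eta Γ A'.1 b' B = some t →
      EqD Γ (Tm.lam A b) t (Tm.pi A'.1 B) := fun hb ht => by
    have := hA.lam hb
    exact this.trans (hr.eta ⟨this.tm, .eq_refl this.tm, this.ty⟩ ht)
  split at h
  · rename_i A₁ B
    obtain ⟨h2, h⟩ := of_guard h
    obtain ⟨b', h3, h⟩ := Option.bind_eq_some_iff.1 h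
    obtain ⟨t, h4, h⟩ := Option.bind_eq_some_iff.1 h
    have e2 := eq_of_beq h2
    obtain ⟨_, hp⟩ := he _ rfl
    obtain ⟨_, _, hB⟩ := hp.inv_pi
    rw [← e2] at hB
    cases h
    exact ⟨key (hr.chk ⟨_, hB⟩ h3) h4, fun T h => by cases h; rw [e2]⟩
  · obtain ⟨b', h3, h⟩ := Option.bind_eq_some_iff.1 h
    obtain ⟨t, h4, h⟩ := Option.bind_eq_some_iff.1 h
    exact (key (hr _ _ _ _ (.ctx_cons hA.tm) (fun _ h => by cases h) h3).1 h4).fin h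

theorem dom {f a : Tm} {A : Tm × ℕ} (hΓ : Der (ctx Γ)) (h : r.dom Γ f a = some A) :
    Der (tm Γ A.1 (U A.2)) := by
  unfold Run.dom at h
  split at h
  · exact (hr.ty hΓ h).tm
  · obtain ⟨a', _, h⟩ := Option.bind_eq_some_iff.1 h
    exact (hr.ty hΓ h).tm

/-- The guessed `Π`-type needs no justification beyond being well-formed, since the function is then
checked against it. -/
theorem head {f a : Tm} {e : Option Tm} {s : Tm × Tm} (hΓ : Der (ctx Γ))
    (h : r.head Γ f a e = some s) : EqD Γ f s.1 s.2 := by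
  unfold Run.head at h
  split at h
  · rename_i h1
    cases h
    exact (hr _ _ _ _ hΓ (fun _ h => by cases h) h1).1
  · split at h
    · obtain ⟨A, h1, h⟩ := Option.bind_eq_some_iff.1 h
      obtain ⟨a', _, h⟩ := Option.bind_eq_some_iff.1 h
      obtain ⟨B, h2, h⟩ := Option.bind_eq_some_iff.1 h
      have hA := dom hr hΓ h1
      have hB := (hr.ty (.ctx_cons hA) h2).tm
      refine (hr _ _ _ _ hΓ (fun T hT => ?_) h).1
      cases hT
      exact ⟨max A.2 B.2, .pi_form (hA.cumul_le (le_max_left ..)) (hB.cumul_le (le_max_right ..))⟩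
    · cases h

theorem stepApp {f a : Tm} {e : Option Tm} {s : Tm × Tm} (hΓ : Der (ctx Γ))
    (h : r.stepApp Γ f a e = some s) :
    EqD Γ (Tm.app f a) s.1 s.2 ∧ ∀ T, e = some T → s.2 = T := by
  obtain ⟨⟨f', F⟩, h1, h⟩ := Option.bind_eq_some_iff.1 h
  have hf := head hr hΓ h1
  dsimp only at h hf
  split at h
  · rename_i A B
    obtain ⟨a', h2, h⟩ := Option.bind_eq_some_iff.1 h
    obtain ⟨T, h3, h⟩ := Option.bind_eq_some_iff.1 h
    obtain ⟨_, hp⟩ := hf.ty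
    obtain ⟨_, hA, hB⟩ := hp.inv_pi
    have ha := hr.chk ⟨_, hA⟩ h2
    rw [finst_eq] at h3
    obtain ⟨_, hT⟩ := hr.nty ⟨_, hB.inst_ty ha.tm⟩ h3
    have hfa := (hf.app ha).conv hT
    split at h
    · rename_i A₁ b
      obtain ⟨h4, h⟩ := of_guard h
      obtain ⟨b', h5, h⟩ := Option.bind_eq_some_iff.1 h
      obtain ⟨t, h6, h⟩ := Option.bind_eq_some_iff.1 h
      have e4 := eq_of_beq h4
      rw [e4] at hfa
      rw [finst_eq] at h6
      have hb := (EqD.beta ⟨_, hA⟩ (hr.chk ⟨_, hB⟩ h5) ha.tm).conv hT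
      exact ((hfa.trans hb).trans (hr.post hb.tm hb.ty h6)).fin h
    · exact hfa.fin h
  · cases h

theorem stepPair {a b : Tm} {e : Option Tm} {s : Tm × Tm}
    (he : ∀ T, e = some T → ∃ i, Der (tm Γ T (U i))) (h : r.stepPair Γ a b e = some s) :
    EqD Γ (Tm.pair a b) s.1 s.2 ∧ ∀ T, e = some T → s.2 = T := by
  unfold Run.stepPair at h
  split at h
  · rename_i A B
    obtain ⟨a', h1, h⟩ := Option.bind_eq_some_iff.1 h
    obtain ⟨T, h2, h⟩ := Option.bind_eq_some_iff.1 h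
    obtain ⟨b', h3, h⟩ := Option.bind_eq_some_iff.1 h
    cases h
    obtain ⟨_, hS⟩ := he _ rfl
    obtain ⟨_, hA, hB⟩ := hS.inv_sigma
    have ha := hr.chk ⟨_, hA⟩ h1
    rw [finst_eq] at h2
    have hI := hB.inst_ty ha.tm
    obtain ⟨_, hT⟩ := hr.nty ⟨_, hI⟩ h2
    have hb := (hr.chk ⟨_, hT.tm⟩ h3).conv_symm hT ⟨_, hI⟩
    exact ⟨EqD.pair ⟨_, hS⟩ ha hb, fun T h => by cases h; rfl⟩
  · cases h

theorem stepInl {a : Tm} {e : Option Tm} {s : Tm × Tm}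
    (he : ∀ T, e = some T → ∃ i, Der (tm Γ T (U i))) (h : r.stepInl Γ a e = some s) :
    EqD Γ (Tm.inl a) s.1 s.2 ∧ ∀ T, e = some T → s.2 = T := by
  unfold Run.stepInl at h
  split at h
  · obtain ⟨a', h1, h⟩ := Option.bind_eq_some_iff.1 h
    cases h
    obtain ⟨_, hS⟩ := he _ rfl
    obtain ⟨_, hA, _⟩ := hS.inv_sum
    exact ⟨EqD.inl ⟨_, hS⟩ (hr.chk ⟨_, hA⟩ h1), fun T h => by cases h; rfl⟩
  · cases h

theorem stepInr {a : Tm} {e : Option Tm} {s : Tm × Tm}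
    (he : ∀ T, e = some T → ∃ i, Der (tm Γ T (U i))) (h : r.stepInr Γ a e = some s) :
    EqD Γ (Tm.inr a) s.1 s.2 ∧ ∀ T, e = some T → s.2 = T := by
  unfold Run.stepInr at h
  split at h
  · obtain ⟨a', h1, h⟩ := Option.bind_eq_some_iff.1 h
    cases h
    obtain ⟨_, hS⟩ := he _ rfl
    obtain ⟨_, _, hB⟩ := hS.inv_sum
    exact ⟨EqD.inr ⟨_, hS⟩ (hr.chk ⟨_, hB⟩ h1), fun T h => by cases h; rfl⟩
  · cases h

theorem stepRefl {a : Tm} {e : Option Tm} {s : Tm × Tm} (hΓ : Der (ctx Γ))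
    (he : ∀ T, e = some T → ∃ i, Der (tm Γ T (U i))) (h : r.stepRefl Γ a e = some s) :
    EqD Γ (Tm.refl a) s.1 s.2 ∧ ∀ T, e = some T → s.2 = T := by
  unfold Run.stepRefl at h
  split at h
  · obtain ⟨a', h1, h⟩ := Option.bind_eq_some_iff.1 h
    obtain ⟨h2, h⟩ := of_guard h
    obtain ⟨h3, h⟩ := of_guard h
    cases h
    have e2 := eq_of_beq h2
    have e3 := eq_of_beq h3
    subst e2
    obtain ⟨_, hS⟩ := he _ rfl
    obtain ⟨hA, _⟩ := hS.inv_id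
    subst e3
    exact ⟨(hr.chk hA h1).reflexivity, fun T h => by cases h; rfl⟩
  · obtain ⟨a', h1, h⟩ := Option.bind_eq_some_iff.1 h
    exact ((hr _ _ _ _ hΓ (fun _ h => by cases h) h1).1.reflexivity).fin h

theorem stepSigmaInd {A B C g p : Tm} {e : Option Tm} {s : Tm × Tm} (hΓ : Der (ctx Γ))
    (h : r.stepSigmaInd Γ A B C g p e = some s) :
    EqD Γ (Tm.sigmaInd A B C g p) s.1 s.2 ∧ ∀ T, e = some T → s.2 = T := by
  obtain ⟨A', h1, h⟩ := Option.bind_eq_some_iff.1 h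
  obtain ⟨B', h2, h⟩ := Option.bind_eq_some_iff.1 h
  obtain ⟨C', h3, h⟩ := Option.bind_eq_some_iff.1 h
  obtain ⟨G, h4, h⟩ := Option.bind_eq_some_iff.1 h
  obtain ⟨g', h5, h⟩ := Option.bind_eq_some_iff.1 h
  obtain ⟨p', h6, h⟩ := Option.bind_eq_some_iff.1 h
  have hA := hr.ty hΓ h1
  have hB := hr.ty (.ctx_cons hA.tm) h2
  have hS : Der (tm Γ (Tm.sigma A'.1 B'.1) (U (max A'.2 B'.2))) :=
    .sigma_form (hA.tm.cumul_le (le_max_left _ _)) (hB.tm.cumul_le (le_max_right _ _))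
  have hC := hr.ty (.ctx_cons hS) h3
  rw [finstAt_eq] at h4
  have hG := hC.tm.instAt_pair hA.tm hB.tm
  obtain ⟨_, hGG⟩ := hr.nty ⟨_, hG⟩ h4
  have hg := (hr.chk ⟨_, hGG.tm⟩ h5).conv_symm hGG ⟨_, hG⟩
  have hp := hr.chk ⟨_, hS⟩ h6
  split at h
  · rename_i x y
    obtain ⟨x', h7, h⟩ := Option.bind_eq_some_iff.1 h
    obtain ⟨Y, h8, h⟩ := Option.bind_eq_some_iff.1 h
    obtain ⟨y', h9, h⟩ := Option.bind_eq_some_iff.1 h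
    obtain ⟨T, h10, h⟩ := Option.bind_eq_some_iff.1 h
    obtain ⟨t, h11, h⟩ := Option.bind_eq_some_iff.1 h
    have hx := hr.chk ⟨_, hA.tm⟩ h7
    rw [finst_eq] at h8 h10
    rw [finst₂_eq] at h11
    have hI := hB.tm.inst_ty hx.tm
    obtain ⟨_, hY⟩ := hr.nty ⟨_, hI⟩ h8
    have hy := (hr.chk ⟨_, hY.tm⟩ h9).conv_symm hY ⟨_, hI⟩
    have hp := hp.trans (EqD.pair ⟨_, hS⟩ hx hy)
    obtain ⟨_, hT⟩ := hr.nty ⟨_, hC.tm.inst_ty hp.tm⟩ h10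
    have hind := (hA.sigmaInd hB hC hg hp).conv hT
    have ht := hg.tm.inst₂_tm hx.tm hy.tm
    rw [inst₂_instAt_pair] at ht
    have hc := EqD.conv ⟨ht, .sigma_comp hC.tm hg.tm hx.tm hy.tm, _, hC.tm.inst_ty hp.tm⟩ hT
    exact ((hind.trans hc).trans (hr.post hc.tm hc.ty h11)).fin h
  · obtain ⟨T, h7, h⟩ := Option.bind_eq_some_iff.1 h
    rw [finst_eq] at h7
    obtain ⟨_, hT⟩ := hr.nty ⟨_, hC.tm.inst_ty hp.tm⟩ h7
    exact ((hA.sigmaInd hB hC hg hp).conv hT).fin h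

theorem stepSumInd {A B C c d p : Tm} {e : Option Tm} {s : Tm × Tm} (hΓ : Der (ctx Γ))
    (h : r.stepSumInd Γ A B C c d p e = some s) :
    EqD Γ (Tm.sumInd A B C c d p) s.1 s.2 ∧ ∀ T, e = some T → s.2 = T := by
  obtain ⟨A', h1, h⟩ := Option.bind_eq_some_iff.1 h
  obtain ⟨B', h2, h⟩ := Option.bind_eq_some_iff.1 h
  obtain ⟨C', h3, h⟩ := Option.bind_eq_some_iff.1 h
  obtain ⟨G, h4, h⟩ := Option.bind_eq_some_iff.1 h
  obtain ⟨H, h4', h⟩ := Option.bind_eq_some_iff.1 h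
  obtain ⟨c', h5, h⟩ := Option.bind_eq_some_iff.1 h
  obtain ⟨d', h5', h⟩ := Option.bind_eq_some_iff.1 h
  obtain ⟨p', h6, h⟩ := Option.bind_eq_some_iff.1 h
  have hA := hr.ty hΓ h1
  have hB := hr.ty hΓ h2
  have hA' := hA.tm.cumul_le (le_max_left A'.2 B'.2)
  have hB' := hB.tm.cumul_le (le_max_right A'.2 B'.2)
  have hS : Der (tm Γ (Tm.sum A'.1 B'.1) (U (max A'.2 B'.2))) := .sum_form hA' hB'
  have hC := hr.ty (.ctx_cons hS) h3
  rw [finstAt_eq] at h4 h4'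
  have hG := hC.tm.instAt_inl hA' hB'
  have hH := hC.tm.instAt_inr hA' hB'
  obtain ⟨_, hGG⟩ := hr.nty ⟨_, hG⟩ h4
  obtain ⟨_, hHH⟩ := hr.nty ⟨_, hH⟩ h4'
  have hc := (hr.chk ⟨_, hGG.tm⟩ h5).conv_symm hGG ⟨_, hG⟩
  have hd := (hr.chk ⟨_, hHH.tm⟩ h5').conv_symm hHH ⟨_, hH⟩
  have hp := hr.chk ⟨_, hS⟩ h6
  split at h
  · rename_i x
    obtain ⟨x', h7, h⟩ := Option.bind_eq_some_iff.1 h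
    obtain ⟨T, h10, h⟩ := Option.bind_eq_some_iff.1 h
    obtain ⟨t, h11, h⟩ := Option.bind_eq_some_iff.1 h
    have hx := hr.chk ⟨_, hA.tm⟩ h7
    rw [finst_eq] at h10 h11
    have hp := hp.trans (EqD.inl ⟨_, hS⟩ hx)
    obtain ⟨_, hT⟩ := hr.nty ⟨_, hC.tm.inst_ty hp.tm⟩ h10
    have hind := (hA.sumInd hB hC hc hd hp).conv hT
    have ht := hc.tm.inst_tm hx.tm
    rw [inst_instAt_inl] at ht
    have hc := EqD.conv ⟨ht, .sum_comp_inl hC.tm hc.tm hd.tm hx.tm, _, hC.tm.inst_ty hp.tm⟩ hT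
    exact ((hind.trans hc).trans (hr.post hc.tm hc.ty h11)).fin h
  · rename_i x
    obtain ⟨x', h7, h⟩ := Option.bind_eq_some_iff.1 h
    obtain ⟨T, h10, h⟩ := Option.bind_eq_some_iff.1 h
    obtain ⟨t, h11, h⟩ := Option.bind_eq_some_iff.1 h
    have hx := hr.chk ⟨_, hB.tm⟩ h7
    rw [finst_eq] at h10 h11
    have hp := hp.trans (EqD.inr ⟨_, hS⟩ hx)
    obtain ⟨_, hT⟩ := hr.nty ⟨_, hC.tm.inst_ty hp.tm⟩ h10
    have hind := (hA.sumInd hB hC hc hd hp).conv hT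
    have ht := hd.tm.inst_tm hx.tm
    rw [inst_instAt_inr] at ht
    have hc := EqD.conv ⟨ht, .sum_comp_inr hC.tm hc.tm hd.tm hx.tm, _, hC.tm.inst_ty hp.tm⟩ hT
    exact ((hind.trans hc).trans (hr.post hc.tm hc.ty h11)).fin h
  · obtain ⟨T, h7, h⟩ := Option.bind_eq_some_iff.1 h
    rw [finst_eq] at h7
    obtain ⟨_, hT⟩ := hr.nty ⟨_, hC.tm.inst_ty hp.tm⟩ h7
    exact ((hA.sumInd hB hC hc hd hp).conv hT).fin h

theorem stepEmptyInd {C p : Tm} {e : Option Tm} {s : Tm × Tm} (hΓ : Der (ctx Γ))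
    (h : r.stepEmptyInd Γ C p e = some s) :
    EqD Γ (Tm.emptyInd C p) s.1 s.2 ∧ ∀ T, e = some T → s.2 = T := by
  obtain ⟨C', h3, h⟩ := Option.bind_eq_some_iff.1 h
  obtain ⟨p', h6, h⟩ := Option.bind_eq_some_iff.1 h
  obtain ⟨T, h7, h⟩ := Option.bind_eq_some_iff.1 h
  have hC := hr.ty (.ctx_cons (i := 0) (.empty_form hΓ)) h3
  have hp := hr.chk ⟨0, .empty_form hΓ⟩ h6
  rw [finst_eq] at h7
  obtain ⟨_, hT⟩ := hr.nty ⟨_, hC.tm.inst_ty hp.tm⟩ h7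
  exact ((hC.emptyInd hp).conv hT).fin h

theorem stepUnitInd {C c p : Tm} {e : Option Tm} {s : Tm × Tm} (hΓ : Der (ctx Γ))
    (h : r.stepUnitInd Γ C c p e = some s) :
    EqD Γ (Tm.unitInd C c p) s.1 s.2 ∧ ∀ T, e = some T → s.2 = T := by
  obtain ⟨C', h3, h⟩ := Option.bind_eq_some_iff.1 h
  obtain ⟨G, h4, h⟩ := Option.bind_eq_some_iff.1 h
  obtain ⟨c', h5, h⟩ := Option.bind_eq_some_iff.1 h
  obtain ⟨p', h6, h⟩ := Option.bind_eq_some_iff.1 h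
  have hC := hr.ty (.ctx_cons (i := 0) (.unit_form hΓ)) h3
  rw [finst_eq] at h4
  have hG := hC.tm.inst_ty (.unit_intro hΓ)
  obtain ⟨_, hGG⟩ := hr.nty ⟨_, hG⟩ h4
  have hc' := hr.chk ⟨_, hGG.tm⟩ h5
  have hc := hc'.conv_symm hGG ⟨_, hG⟩
  have hp := hr.chk ⟨0, .unit_form hΓ⟩ h6
  split at h
  · have hind := (hC.unitInd hc hp).conv hGG
    exact (hind.trans (EqD.conv ⟨hc.tm, .unit_comp hC.tm hc.tm, hc.ty⟩ hGG)).fin h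
  · obtain ⟨T, h7, h⟩ := Option.bind_eq_some_iff.1 h
    rw [finst_eq] at h7
    obtain ⟨_, hT⟩ := hr.nty ⟨_, hC.tm.inst_ty hp.tm⟩ h7
    exact ((hC.unitInd hc hp).conv hT).fin h

theorem stepNatInd {C c d m : Tm} {e : Option Tm} {s : Tm × Tm} (hΓ : Der (ctx Γ))
    (h : r.stepNatInd Γ C c d m e = some s) :
    EqD Γ (Tm.natInd C c d m) s.1 s.2 ∧ ∀ T, e = some T → s.2 = T := by
  obtain ⟨C', h3, h⟩ := Option.bind_eq_some_iff.1 h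
  obtain ⟨G, h4, h⟩ := Option.bind_eq_some_iff.1 h
  obtain ⟨H, h4', h⟩ := Option.bind_eq_some_iff.1 h
  obtain ⟨c', h5, h⟩ := Option.bind_eq_some_iff.1 h
  obtain ⟨d', h5', h⟩ := Option.bind_eq_some_iff.1 h
  obtain ⟨m', h6, h⟩ := Option.bind_eq_some_iff.1 h
  have hC := hr.ty (.ctx_cons (i := 0) (.nat_form hΓ)) h3
  rw [finst_eq] at h4
  rw [finstAt_eq] at h4'
  have hG := hC.tm.inst_ty (.nat_intro_zero hΓ)
  have hH := hC.tm.instAt_succ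
  obtain ⟨_, hGG⟩ := hr.nty ⟨_, hG⟩ h4
  obtain ⟨_, hHH⟩ := hr.nty ⟨_, hH⟩ h4'
  have hc := (hr.chk ⟨_, hGG.tm⟩ h5).conv_symm hGG ⟨_, hG⟩
  have hd := (hr.chk ⟨_, hHH.tm⟩ h5').conv_symm hHH ⟨_, hH⟩
  have hm := hr.chk ⟨0, .nat_form hΓ⟩ h6
  split at h
  · have hind := (hC.natInd hc hd hm).conv hGG
    exact (hind.trans (EqD.conv ⟨hc.tm, .nat_comp_zero hC.tm hc.tm hd.tm, hc.ty⟩ hGG)).fin h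
  · rename_i k
    obtain ⟨T, h7, h⟩ := Option.bind_eq_some_iff.1 h
    obtain ⟨t, h8, h⟩ := Option.bind_eq_some_iff.1 h
    rw [finst_eq] at h7
    rw [finst₂_eq] at h8
    have hk := hm.tm.inv_succ
    obtain ⟨_, hT⟩ := hr.nty ⟨_, hC.tm.inst_ty hm.tm⟩ h7
    have hind := (hC.natInd hc hd hm).conv hT
    have ht := hd.tm.inst₂_tm hk (.nat_elim hC.tm hc.tm hd.tm hk)
    rw [inst₂_instAt_succ] at ht
    have hc := EqD.conv ⟨ht, .nat_comp_succ hC.tm hc.tm hd.tm hk, _, hC.tm.inst_ty hm.tm⟩ hT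
    exact ((hind.trans hc).trans (hr.post hc.tm hc.ty h8)).fin h
  · obtain ⟨T, h7, h⟩ := Option.bind_eq_some_iff.1 h
    rw [finst_eq] at h7
    obtain ⟨_, hT⟩ := hr.nty ⟨_, hC.tm.inst_ty hm.tm⟩ h7
    exact ((hC.natInd hc hd hm).conv hT).fin h

theorem stepIdInd {A C c a b q : Tm} {e : Option Tm} {s : Tm × Tm} (hΓ : Der (ctx Γ))
    (h : r.stepIdInd Γ A C c a b q e = some s) :
    EqD Γ (Tm.idInd A C c a b q) s.1 s.2 ∧ ∀ T, e = some T → s.2 = T := by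
  obtain ⟨A', h1, h⟩ := Option.bind_eq_some_iff.1 h
  obtain ⟨C', h2, h⟩ := Option.bind_eq_some_iff.1 h
  obtain ⟨G, h3, h⟩ := Option.bind_eq_some_iff.1 h
  obtain ⟨c', h4, h⟩ := Option.bind_eq_some_iff.1 h
  obtain ⟨a', h5, h⟩ := Option.bind_eq_some_iff.1 h
  obtain ⟨b', h6, h⟩ := Option.bind_eq_some_iff.1 h
  obtain ⟨q', h7, h⟩ := Option.bind_eq_some_iff.1 h
  obtain ⟨T, h8, h⟩ := Option.bind_eq_some_iff.1 h
  rw [flift_zero, flift_zero] at h2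
  rw [finstRefl_eq] at h3
  rw [finst₃_eq] at h8
  have hA := hr.ty hΓ h1
  have hC := hr.ty hA.tm.ctx_id h2
  have hG := hC.tm.instRefl_ty
  obtain ⟨_, hGG⟩ := hr.nty ⟨_, hG⟩ h3
  have hc := (hr.chk ⟨_, hGG.tm⟩ h4).conv_symm hGG ⟨_, hG⟩
  have ha := hr.chk ⟨_, hA.tm⟩ h5
  have hb := hr.chk ⟨_, hA.tm⟩ h6
  have hq := hr.chk ⟨_, .id_form hA.tm ha.tm hb.tm⟩ h7
  have hind := hA.idInd hC hc ha hb hq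
  obtain ⟨_, hT⟩ := hr.nty hind.ty h8
  have hind := hind.conv hT
  split at h
  · rename_i x
    obtain ⟨h9, h⟩ := of_guard h
    obtain ⟨h10, h⟩ := of_guard h
    obtain ⟨t, h11, h12⟩ := Option.bind_eq_some_iff.1 h
    have e9 := eq_of_beq h9
    have e10 := eq_of_beq h10
    subst e9
    subst e10
    rw [finst_eq] at h11
    have ht := hc.tm.inst_tm ha.tm
    rw [inst_instRefl] at ht
    have hc := EqD.conv ⟨ht, .id_comp hC.tm hc.tm ha.tm, _,
      hC.tm.inst₃_tm ha.tm hb.tm hq.tm⟩ hT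
    exact ((hind.trans hc).trans (hr.post hc.tm hc.ty h11)).fin h12
  · exact hind.fin h

theorem step : Run.Sound r.step := by
  intro Γ t e s hΓ he h
  cases t with
  | var k =>
    obtain ⟨A, hA, h⟩ := Option.bind_eq_some_iff.1 h
    rw [flift_zero] at h
    exact (EqD.refl (.var hΓ hA) (hΓ.var_ty hA).choose_spec).fin h
  | U i => exact (EqD.refl (.U_intro hΓ) (.U_intro hΓ)).fin h
  | pi A B => exact hr.stepPi hΓ h
  | lam A b => exact hr.stepLam hΓ he h
  | app f a => exact hr.stepApp hΓ h
  | sigma A B => exact hr.stepSigma hΓ h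
  | pair a b => exact hr.stepPair he h
  | sigmaInd A B C g p => exact hr.stepSigmaInd hΓ h
  | sum A B => exact hr.stepSum hΓ h
  | inl a => exact hr.stepInl he h
  | inr b => exact hr.stepInr he h
  | sumInd A B C c d p => exact hr.stepSumInd hΓ h
  | empty => exact (EqD.refl (.empty_form hΓ) (.U_intro hΓ)).fin h
  | emptyInd C p => exact hr.stepEmptyInd hΓ h
  | unit => exact (EqD.refl (.unit_form hΓ) (.U_intro hΓ)).fin h
  | star => exact (EqD.refl (i := 0) (.unit_intro hΓ) (.unit_form hΓ)).fin h
  | unitInd C c p => exact hr.stepUnitInd hΓ h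
  | nat => exact (EqD.refl (.nat_form hΓ) (.U_intro hΓ)).fin h
  | zero => exact (EqD.refl (i := 0) (.nat_intro_zero hΓ) (.nat_form hΓ)).fin h
  | succ m =>
    obtain ⟨m', h1, h⟩ := Option.bind_eq_some_iff.1 h
    exact (hr.chk ⟨0, .nat_form hΓ⟩ h1).succ.fin h
  | natInd C c d m => exact hr.stepNatInd hΓ h
  | id A a b => exact hr.stepId hΓ h
  | refl a => exact hr.stepRefl hΓ he h
  | idInd A C c a b q => exact hr.stepIdInd hΓ h
  | univalence i => cases h

end Run.Sound

/-- At depth zero the result is `none`, about which nothing is claimed, so the bound on the depth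
does not affect soundness. -/
theorem nrm_sound (n : ℕ) : Run.Sound (nrm n) := by
  induction n with
  | zero => intro Γ t e s _ _ h; cases h
  | succ n ih => exact Run.Sound.step ih

end HoTT

/-! ### A front end for the normalizer: surface terms with named binders. -/

namespace HoTT

open Tm Judgment

/-! ### Elaboration of terms written in higher-order abstract syntax -/

theorem EqD.fin_self {Γ : Ctx} {t t' S : Tm} {e : Option Tm} {s : Tm × Tm} (h : EqD Γ t t' S)
    (hs : HoTT.fin e t' S = some s) : EqD Γ s.1 s.1 s.2 ∧ ∀ T, e = some T → s.2 = T :=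
  have := h.fin hs
  ⟨⟨this.1.tm, .eq_refl this.1.tm, this.1.ty⟩, this.2⟩

/-- A surface term: in a context it elaborates to a well-typed term, given the expected type or
not. -/
structure Exp : Type where
  run : Ctx → Option Tm → Option (Tm × Tm)
  sound : ∀ {Γ e s}, Der (ctx Γ) → (∀ T, e = some T → ∃ i, Der (tm Γ T (U i))) →
    run Γ e = some s → EqD Γ s.1 s.1 s.2 ∧ ∀ T, e = some T → s.2 = T

/-- The normalizer used in elaboration. -/
noncomputable def nf : Run := nrm 1000

theorem nf_sound : Run.Sound nf := nrm_sound _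

namespace Exp

variable {Γ : Ctx}

/-- Elaborates a term, inferring its type. -/
def inf (a : Exp) (Γ : Ctx) : Option (Tm × Tm) := a.run Γ none

/-- Elaborates a term of a given type. -/
def chk (a : Exp) (Γ : Ctx) (T : Tm) : Option Tm := (a.run Γ (some T)).bind fun s => some s.1

/-- Elaborates a type. -/
noncomputable def ty (a : Exp) (Γ : Ctx) : Option (Tm × ℕ) :=
  (a.run Γ none).bind fun s => match s.2 with
    | Tm.U i => bif hasRedex s.1 then nf.ty Γ s.1 else some (s.1, i)
    | _ => none

theorem inf_sound {a : Exp} {s : Tm × Tm} (hΓ : Der (ctx Γ)) (h : a.inf Γ = some s) :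
    EqD Γ s.1 s.1 s.2 :=
  (a.sound hΓ (fun _ h => by cases h) h).1

theorem chk_sound {a : Exp} {t T : Tm} (hT : ∃ i, Der (tm Γ T (Tm.U i)))
    (h : a.chk Γ T = some t) : EqD Γ t t T := by
  obtain ⟨s, h1, h⟩ := Option.bind_eq_some_iff.1 h
  obtain ⟨h2, h3⟩ := a.sound (hT.elim fun _ h => h.ctx_of_tm) (fun _ h => by cases h; exact hT) h1
  cases h
  rwa [← h3 _ rfl]

theorem ty_sound {a : Exp} {s : Tm × ℕ} (hΓ : Der (ctx Γ)) (h : a.ty Γ = some s) :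
    EqD Γ s.1 s.1 (Tm.U s.2) := by
  obtain ⟨⟨A, S⟩, h1, h⟩ := Option.bind_eq_some_iff.1 h
  have h2 := inf_sound hΓ h1
  dsimp only at h h2
  split at h
  · cases hb : hasRedex A
    · rw [hb] at h
      cases h
      exact h2
    · rw [hb] at h
      have h3 := nf_sound.ty hΓ h
      exact ⟨h3.tm, .eq_refl h3.tm, h3.ty⟩
  · cases h

/-- The variable of de Bruijn level `l`. -/
noncomputable def v (l : ℕ) : Exp where
  run Γ e := Γ[Γ.length - l - 1]?.bind fun A =>
    fin e (Tm.var (Γ.length - l - 1)) (flift (Γ.length - l - 1 + 1) A 0)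
  sound hΓ _ h := by
    obtain ⟨A, hA, h⟩ := Option.bind_eq_some_iff.1 h
    rw [flift_zero] at h
    exact (EqD.refl (.var hΓ hA) (hΓ.var_ty hA).choose_spec).fin_self h

/-- A closed or open raw term, checked by the normalizer. -/
noncomputable def raw (t : Tm) : Exp where
  run Γ e := (nf.ty Γ t).bind fun s => fin e s.1 (Tm.U s.2)
  sound hΓ _ h := by
    obtain ⟨s, hs, h⟩ := Option.bind_eq_some_iff.1 h
    have := nf_sound.ty hΓ hs
    exact (EqD.refl this.tm this.ty.choose_spec).fin_self h

noncomputable def U (i : ℕ) : Exp where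
  run _ e := fin e (Tm.U i) (Tm.U (i + 1))
  sound hΓ _ h := (EqD.refl (.U_intro hΓ) (.U_intro hΓ)).fin_self h

noncomputable def empty : Exp where
  run _ e := fin e Tm.empty (Tm.U 0)
  sound hΓ _ h := (EqD.refl (.empty_form hΓ) (.U_intro hΓ)).fin_self h

noncomputable def unit : Exp where
  run _ e := fin e Tm.unit (Tm.U 0)
  sound hΓ _ h := (EqD.refl (.unit_form hΓ) (.U_intro hΓ)).fin_self h

noncomputable def star : Exp where
  run _ e := fin e Tm.star Tm.unit
  sound hΓ _ h := (EqD.refl (i := 0) (.unit_intro hΓ) (.unit_form hΓ)).fin_self h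

noncomputable def nat : Exp where
  run _ e := fin e Tm.nat (Tm.U 0)
  sound hΓ _ h := (EqD.refl (.nat_form hΓ) (.U_intro hΓ)).fin_self h

noncomputable def zero : Exp where
  run _ e := fin e Tm.zero Tm.nat
  sound hΓ _ h := (EqD.refl (i := 0) (.nat_intro_zero hΓ) (.nat_form hΓ)).fin_self h

noncomputable def succ (m : Exp) : Exp where
  run Γ e := (m.chk Γ Tm.nat).bind fun m' => fin e (Tm.succ m') Tm.nat
  sound hΓ _ h := by
    obtain ⟨m', h1, h⟩ := Option.bind_eq_some_iff.1 h
    exact (chk_sound ⟨0, .nat_form hΓ⟩ h1).succ.fin_self h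

noncomputable def pi (A : Exp) (B : Exp → Exp) : Exp where
  -- `v Γ.length` is the variable about to be bound. Levels, in contrast to indices, do not change
  -- when the context grows, so surface terms never have to be weakened.
  run Γ e := (A.ty Γ).bind fun A' => ((B (v Γ.length)).ty (A'.1 :: Γ)).bind fun B' =>
    fin e (Tm.pi A'.1 B'.1) (Tm.U (max A'.2 B'.2))
  sound hΓ _ h := by
    obtain ⟨A', h1, h⟩ := Option.bind_eq_some_iff.1 h
    obtain ⟨B', h2, h⟩ := Option.bind_eq_some_iff.1 h
    have hA := ty_sound hΓ h1
    exact (hA.pi (ty_sound (.ctx_cons hA.tm) h2)).fin_self h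

noncomputable def sigma (A : Exp) (B : Exp → Exp) : Exp where
  run Γ e := (A.ty Γ).bind fun A' => ((B (v Γ.length)).ty (A'.1 :: Γ)).bind fun B' =>
    fin e (Tm.sigma A'.1 B'.1) (Tm.U (max A'.2 B'.2))
  sound hΓ _ h := by
    obtain ⟨A', h1, h⟩ := Option.bind_eq_some_iff.1 h
    obtain ⟨B', h2, h⟩ := Option.bind_eq_some_iff.1 h
    have hA := ty_sound hΓ h1
    exact (hA.sigma (ty_sound (.ctx_cons hA.tm) h2)).fin_self h

noncomputable def sum (A B : Exp) : Exp where
  run Γ e := (A.ty Γ).bind fun A' => (B.ty Γ).bind fun B' =>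
    fin e (Tm.sum A'.1 B'.1) (Tm.U (max A'.2 B'.2))
  sound hΓ _ h := by
    obtain ⟨A', h1, h⟩ := Option.bind_eq_some_iff.1 h
    obtain ⟨B', h2, h⟩ := Option.bind_eq_some_iff.1 h
    exact ((ty_sound hΓ h1).sum (ty_sound hΓ h2)).fin_self h

/-- The identity type of two elements of `A`. -/
noncomputable def idT (A a b : Exp) : Exp where
  run Γ e := (A.ty Γ).bind fun A' => (a.chk Γ A'.1).bind fun a' => (b.chk Γ A'.1).bind fun b' =>
    fin e (Tm.id A'.1 a' b') (Tm.U A'.2)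
  sound hΓ _ h := by
    obtain ⟨A', h1, h⟩ := Option.bind_eq_some_iff.1 h
    obtain ⟨a', h2, h⟩ := Option.bind_eq_some_iff.1 h
    obtain ⟨b', h3, h⟩ := Option.bind_eq_some_iff.1 h
    have hA := ty_sound hΓ h1
    exact (hA.id (chk_sound ⟨_, hA.tm⟩ h2) (chk_sound ⟨_, hA.tm⟩ h3)).fin_self h

/-- A term of a given type. -/
noncomputable def ann (a A : Exp) : Exp where
  run Γ e := (A.ty Γ).bind fun A' => (a.chk Γ A'.1).bind fun a' => fin e a' A'.1
  sound hΓ _ h := by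
    obtain ⟨A', h1, h⟩ := Option.bind_eq_some_iff.1 h
    obtain ⟨a', h2, h⟩ := Option.bind_eq_some_iff.1 h
    exact (chk_sound ⟨_, (ty_sound hΓ h1).tm⟩ h2).fin_self h

/-- `λ x, b`, checked against the expected type. -/
noncomputable def lam (b : Exp → Exp) : Exp where
  run Γ e := match e with
    | some (Tm.pi A B) => ((b (v Γ.length)).chk (A :: Γ) B).bind fun b' =>
        some (Tm.lam A b', Tm.pi A B)
    | _ => none
  sound hΓ he h := by
    split at h
    · obtain ⟨b', h1, h⟩ := Option.bind_eq_some_iff.1 h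
      cases h
      obtain ⟨_, hp⟩ := he _ rfl
      obtain ⟨_, hA, hB⟩ := hp.inv_pi
      exact ⟨(EqD.refl hA (.U_intro hΓ)).lam (chk_sound ⟨_, hB⟩ h1), fun T h => by cases h; rfl⟩
    · cases h

/-- `λ (x : A), b`. -/
noncomputable def lamT (A : Exp) (b : Exp → Exp) : Exp where
  run Γ e := (A.ty Γ).bind fun A' => ((b (v Γ.length)).inf (A'.1 :: Γ)).bind fun b' =>
    fin e (Tm.lam A'.1 b'.1) (Tm.pi A'.1 b'.2)
  sound hΓ _ h := by
    obtain ⟨A', h1, h⟩ := Option.bind_eq_some_iff.1 h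
    obtain ⟨b', h2, h⟩ := Option.bind_eq_some_iff.1 h
    have hA := ty_sound hΓ h1
    exact (hA.lam (inf_sound (.ctx_cons hA.tm) h2)).fin_self h

noncomputable def app (f a : Exp) : Exp where
  run Γ e := (f.inf Γ).bind fun F => match F.2 with
    | Tm.pi A B => (a.chk Γ A).bind fun a' => (nf.nty Γ (finst B a')).bind fun T =>
        fin e (Tm.app F.1 a') T
    | _ => none
  sound hΓ _ h := by
    obtain ⟨⟨f', F⟩, h1, h⟩ := Option.bind_eq_some_iff.1 h
    have hf := inf_sound hΓ h1
    dsimp only at h hf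
    split at h
    · obtain ⟨a', h2, h⟩ := Option.bind_eq_some_iff.1 h
      obtain ⟨T, h3, h⟩ := Option.bind_eq_some_iff.1 h
      obtain ⟨_, hp⟩ := hf.ty
      obtain ⟨_, hA, hB⟩ := hp.inv_pi
      have ha := chk_sound ⟨_, hA⟩ h2
      rw [finst_eq] at h3
      obtain ⟨_, hT⟩ := nf_sound.nty ⟨_, hB.inst_ty ha.tm⟩ h3
      exact ((hf.app ha).conv hT).fin_self h
    · cases h

noncomputable def pair (a b : Exp) : Exp where
  run Γ e := match e with
    | some (Tm.sigma A B) => (a.chk Γ A).bind fun a' => (nf.nty Γ (finst B a')).bind fun T =>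
        (b.chk Γ T).bind fun b' => some (Tm.pair a' b', Tm.sigma A B)
    | _ => none
  sound hΓ he h := by
    split at h
    · obtain ⟨a', h1, h⟩ := Option.bind_eq_some_iff.1 h
      obtain ⟨T, h2, h⟩ := Option.bind_eq_some_iff.1 h
      obtain ⟨b', h3, h⟩ := Option.bind_eq_some_iff.1 h
      cases h
      obtain ⟨_, hS⟩ := he _ rfl
      obtain ⟨_, hA, hB⟩ := hS.inv_sigma
      have ha := chk_sound ⟨_, hA⟩ h1
      rw [finst_eq] at h2
      have hI := hB.inst_ty ha.tm
      obtain ⟨_, hT⟩ := nf_sound.nty ⟨_, hI⟩ h2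
      exact ⟨EqD.pair ⟨_, hS⟩ ha ((chk_sound ⟨_, hT.tm⟩ h3).conv_symm hT ⟨_, hI⟩),
        fun T h => by cases h; rfl⟩
    · cases h

noncomputable def inl (a : Exp) : Exp where
  run Γ e := match e with
    | some (Tm.sum A B) => (a.chk Γ A).bind fun a' => some (Tm.inl a', Tm.sum A B)
    | _ => none
  sound hΓ he h := by
    split at h
    · obtain ⟨a', h1, h⟩ := Option.bind_eq_some_iff.1 h
      cases h
      obtain ⟨_, hS⟩ := he _ rfl
      obtain ⟨_, hA, _⟩ := hS.inv_sum
      exact ⟨EqD.inl ⟨_, hS⟩ (chk_sound ⟨_, hA⟩ h1), fun T h => by cases h; rfl⟩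
    · cases h

noncomputable def inr (a : Exp) : Exp where
  run Γ e := match e with
    | some (Tm.sum A B) => (a.chk Γ B).bind fun a' => some (Tm.inr a', Tm.sum A B)
    | _ => none
  sound hΓ he h := by
    split at h
    · obtain ⟨a', h1, h⟩ := Option.bind_eq_some_iff.1 h
      cases h
      obtain ⟨_, hS⟩ := he _ rfl
      obtain ⟨_, _, hB⟩ := hS.inv_sum
      exact ⟨EqD.inr ⟨_, hS⟩ (chk_sound ⟨_, hB⟩ h1), fun T h => by cases h; rfl⟩
    · cases h

/-- `refl`, checked against the expected type. -/
noncomputable def rfl' : Exp where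
  run _ e := match e with
    | some (Tm.id A x y) => bif beq x y then some (Tm.refl x, Tm.id A x y) else none
    | _ => none
  sound hΓ he h := by
    split at h
    · rename_i A x y
      obtain ⟨h1, h⟩ := of_guard h
      cases h
      have e1 := eq_of_beq h1
      subst e1
      obtain ⟨_, hS⟩ := he _ rfl
      obtain ⟨⟨_, hA⟩, hx, _⟩ := hS.inv_id
      exact ⟨(EqD.refl hx hA).reflexivity, fun T h => by cases h; rfl⟩
    · cases h

/-- `refl_a`. -/
noncomputable def refl (a : Exp) : Exp where
  run Γ e := (a.inf Γ).bind fun a' => (nf.nty Γ (Tm.id a'.2 a'.1 a'.1)).bind fun T =>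
    fin e (Tm.refl a'.1) T
  sound hΓ _ h := by
    obtain ⟨a', h1, h⟩ := Option.bind_eq_some_iff.1 h
    obtain ⟨T, h2, h⟩ := Option.bind_eq_some_iff.1 h
    have ha := (inf_sound hΓ h1).reflexivity
    obtain ⟨_, hT⟩ := nf_sound.nty ha.ty h2
    exact (ha.conv hT).fin_self h

/-- `ind_0`, with the expected type as motive. -/
noncomputable def absurd (p : Exp) : Exp where
  run Γ e := match e with
    | some T => (p.chk Γ Tm.empty).bind fun p' => some (Tm.emptyInd (flift 1 T 0) p', T)
    | none => none
  sound hΓ he h := by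
    split at h
    · rename_i T
      obtain ⟨p', h1, h⟩ := Option.bind_eq_some_iff.1 h
      cases h
      obtain ⟨_, hT⟩ := he _ rfl
      rw [flift_zero]
      have hc := Der.ctx_cons (i := 0) (.empty_form hΓ)
      have := (EqD.refl (hT.weaken hc) (.U_intro hc)).emptyInd (chk_sound ⟨0, .empty_form hΓ⟩ h1)
      rw [inst_lift] at this
      exact ⟨this, fun T h => by cases h; rfl⟩
    · cases h

/-- Induction on a pair; the motive can depend on the length of the context, `A` and `B`, where
`Σ (x : A), B` is the type of `p`. -/
noncomputable def sigmaRecT (C : ℕ → Tm → Tm → Exp → Exp) (p : Exp) (g : Exp → Exp → Exp) : Exp where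
  run Γ e := (p.inf Γ).bind fun p' => match p'.2 with
    | Tm.sigma A B => ((C Γ.length A B (v Γ.length)).ty (Tm.sigma A B :: Γ)).bind fun C' =>
      (nf.nty (B :: A :: Γ) (finstAt 2 C'.1 (Tm.pair (Tm.var 1) (Tm.var 0)))).bind fun G =>
      ((g (v Γ.length) (v (Γ.length + 1))).chk (B :: A :: Γ) G).bind fun g' =>
      (nf.nty Γ (finst C'.1 p'.1)).bind fun T => fin e (Tm.sigmaInd A B C'.1 g' p'.1) T
    | _ => none
  sound hΓ _ h := by
    obtain ⟨⟨p', P⟩, h1, h⟩ := Option.bind_eq_some_iff.1 h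
    have hp := inf_sound hΓ h1
    dsimp only at h hp
    split at h
    · obtain ⟨C', h2, h⟩ := Option.bind_eq_some_iff.1 h
      obtain ⟨G, h3, h⟩ := Option.bind_eq_some_iff.1 h
      obtain ⟨g', h4, h⟩ := Option.bind_eq_some_iff.1 h
      obtain ⟨T, h5, h⟩ := Option.bind_eq_some_iff.1 h
      obtain ⟨_, hS⟩ := hp.ty
      obtain ⟨_, hA, hB⟩ := hS.inv_sigma
      have hC := ty_sound (.ctx_cons hS) h2
      rw [finstAt_eq] at h3
      rw [finst_eq] at h5
      have hG := hC.tm.instAt_pair hA hB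
      obtain ⟨_, hGG⟩ := nf_sound.nty ⟨_, hG⟩ h3
      have hg := (chk_sound ⟨_, hGG.tm⟩ h4).conv_symm hGG ⟨_, hG⟩
      have := (EqD.refl hA (.U_intro hΓ)).sigmaInd (EqD.refl hB (.U_intro hB.ctx_of_tm)) hC hg hp
      obtain ⟨_, hT⟩ := nf_sound.nty this.ty h5
      exact (this.conv hT).fin_self h
    · cases h

noncomputable def sigmaRec (C : Exp → Exp) (p : Exp) (g : Exp → Exp → Exp) : Exp :=
  sigmaRecT (fun _ _ _ => C) p g

/-- The term `t` over `k` variables, in an extended context. -/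
noncomputable def quote (k : ℕ) (t : Tm) : Exp where
  run Γ e := nf Γ (flift (Γ.length - k) t 0) e
  sound hΓ he h := by
    have := nf_sound _ _ _ _ hΓ he h
    exact ⟨⟨this.1.tm, .eq_refl this.1.tm, this.1.ty⟩, this.2⟩

/-- `B[a]`, where `B` is over `k` variables and one of type `A`. -/
noncomputable def quoteInst (k : ℕ) (A B : Tm) (a : Exp) : Exp where
  run Γ e := (a.chk Γ (flift (Γ.length - k) A 0)).bind fun a' =>
    nf Γ (finst (flift (Γ.length - k) B 1) a') e
  sound hΓ he h := by
    obtain ⟨a', _, h⟩ := Option.bind_eq_some_iff.1 h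
    have := nf_sound _ _ _ _ hΓ he h
    exact ⟨⟨this.1.tm, .eq_refl this.1.tm, this.1.ty⟩, this.2⟩

/-- The motive is the type inferred for the first component. It lives over the `k` variables present
where the pair occurs and is quoted into the larger context of the motive. -/
noncomputable def fst (p : Exp) : Exp :=
  sigmaRecT (fun k A _ _ => quote k A) p fun a _ => a

noncomputable def snd (p : Exp) : Exp :=
  sigmaRecT (fun k A B z => quoteInst k A B (fst z)) p fun _ b => b

/-- `let (x, y) := p in g`, with the expected type as motive. -/
noncomputable def split (p : Exp) (g : Exp → Exp → Exp) : Exp where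
  run Γ e := match e with
    | some T => (p.inf Γ).bind fun p' => match p'.2 with
      | Tm.sigma A B =>
        ((g (v Γ.length) (v (Γ.length + 1))).chk (B :: A :: Γ) (flift 2 T 0)).bind fun g' =>
          some (Tm.sigmaInd A B (flift 1 T 0) g' p'.1, T)
      | _ => none
    | none => none
  sound hΓ he h := by
    split at h
    · rename_i T
      obtain ⟨⟨p', P⟩, h1, h⟩ := Option.bind_eq_some_iff.1 h
      have hp := inf_sound hΓ h1
      dsimp only at h hp
      split at h
      · rename_i A B
        obtain ⟨g', h4, h⟩ := Option.bind_eq_some_iff.1 h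
        cases h
        rw [flift_zero] at h4 ⊢
        obtain ⟨_, hT⟩ := he _ rfl
        obtain ⟨_, hS⟩ := hp.ty
        obtain ⟨_, hA, hB⟩ := hS.inv_sigma
        have hc := Der.ctx_cons hS
        have hC := EqD.refl (hT.weaken hc) (.U_intro hc)
        have e1 : instAt 2 (lift 1 T) (Tm.pair (Tm.var 1) (Tm.var 0)) = lift 2 T := by
          rw [instAt, subst_cons_lift, lift_eq_subst]
        have hG := hC.tm.instAt_pair hA hB
        rw [e1] at hG
        have hg := chk_sound ⟨_, hG⟩ h4
        rw [← e1] at hg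
        have := (EqD.refl hA (.U_intro hΓ)).sigmaInd (EqD.refl hB (.U_intro hB.ctx_of_tm)) hC hg hp
        rw [inst_lift] at this
        exact ⟨this, fun T h => by cases h; rfl⟩
      · cases h
    · cases h

noncomputable def sumRec (C : Exp → Exp) (p : Exp) (c d : Exp → Exp) : Exp where
  run Γ e := (p.inf Γ).bind fun p' => match p'.2 with
    | Tm.sum A B => ((C (v Γ.length)).ty (Tm.sum A B :: Γ)).bind fun C' =>
      (nf.nty (A :: Γ) (finstAt 1 C'.1 (Tm.inl (Tm.var 0)))).bind fun G =>
      (nf.nty (B :: Γ) (finstAt 1 C'.1 (Tm.inr (Tm.var 0)))).bind fun H =>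
      ((c (v Γ.length)).chk (A :: Γ) G).bind fun c' =>
      ((d (v Γ.length)).chk (B :: Γ) H).bind fun d' =>
      (nf.nty Γ (finst C'.1 p'.1)).bind fun T => fin e (Tm.sumInd A B C'.1 c' d' p'.1) T
    | _ => none
  sound hΓ _ h := by
    obtain ⟨⟨p', P⟩, h1, h⟩ := Option.bind_eq_some_iff.1 h
    have hp := inf_sound hΓ h1
    dsimp only at h hp
    split at h
    · obtain ⟨C', h2, h⟩ := Option.bind_eq_some_iff.1 h
      obtain ⟨G, h3, h⟩ := Option.bind_eq_some_iff.1 h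
      obtain ⟨H, h3', h⟩ := Option.bind_eq_some_iff.1 h
      obtain ⟨c', h4, h⟩ := Option.bind_eq_some_iff.1 h
      obtain ⟨d', h4', h⟩ := Option.bind_eq_some_iff.1 h
      obtain ⟨T, h5, h⟩ := Option.bind_eq_some_iff.1 h
      obtain ⟨_, hS⟩ := hp.ty
      obtain ⟨_, hA, hB⟩ := hS.inv_sum
      have hC := ty_sound (.ctx_cons hS) h2
      rw [finstAt_eq] at h3 h3'
      rw [finst_eq] at h5
      have hG := hC.tm.instAt_inl hA hB
      have hH := hC.tm.instAt_inr hA hB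
      obtain ⟨_, hGG⟩ := nf_sound.nty ⟨_, hG⟩ h3
      obtain ⟨_, hHH⟩ := nf_sound.nty ⟨_, hH⟩ h3'
      have hc := (chk_sound ⟨_, hGG.tm⟩ h4).conv_symm hGG ⟨_, hG⟩
      have hd := (chk_sound ⟨_, hHH.tm⟩ h4').conv_symm hHH ⟨_, hH⟩
      have := (EqD.refl hA (.U_intro hΓ)).sumInd (EqD.refl hB (.U_intro hΓ)) hC hc hd hp
      obtain ⟨_, hT⟩ := nf_sound.nty this.ty h5
      exact (this.conv hT).fin_self h
    · cases h

noncomputable def unitRec (C : Exp → Exp) (p c : Exp) : Exp where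
  run Γ e := (p.chk Γ Tm.unit).bind fun p' => ((C (v Γ.length)).ty (Tm.unit :: Γ)).bind fun C' =>
    (nf.nty Γ (finst C'.1 Tm.star)).bind fun G => (c.chk Γ G).bind fun c' =>
    (nf.nty Γ (finst C'.1 p')).bind fun T => fin e (Tm.unitInd C'.1 c' p') T
  sound hΓ _ h := by
    obtain ⟨p', h1, h⟩ := Option.bind_eq_some_iff.1 h
    obtain ⟨C', h2, h⟩ := Option.bind_eq_some_iff.1 h
    obtain ⟨G, h3, h⟩ := Option.bind_eq_some_iff.1 h
    obtain ⟨c', h4, h⟩ := Option.bind_eq_some_iff.1 h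
    obtain ⟨T, h5, h⟩ := Option.bind_eq_some_iff.1 h
    have hp := chk_sound ⟨0, .unit_form hΓ⟩ h1
    have hC := ty_sound (.ctx_cons (i := 0) (.unit_form hΓ)) h2
    rw [finst_eq] at h3 h5
    have hG := hC.tm.inst_ty (.unit_intro hΓ)
    obtain ⟨_, hGG⟩ := nf_sound.nty ⟨_, hG⟩ h3
    have hc := (chk_sound ⟨_, hGG.tm⟩ h4).conv_symm hGG ⟨_, hG⟩
    have := hC.unitInd hc hp
    obtain ⟨_, hT⟩ := nf_sound.nty this.ty h5
    exact (this.conv hT).fin_self h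

noncomputable def natRec (C : Exp → Exp) (m c : Exp) (d : Exp → Exp → Exp) : Exp where
  run Γ e := (m.chk Γ Tm.nat).bind fun m' => ((C (v Γ.length)).ty (Tm.nat :: Γ)).bind fun C' =>
    (nf.nty Γ (finst C'.1 Tm.zero)).bind fun G => (c.chk Γ G).bind fun c' =>
    (nf.nty (C'.1 :: Tm.nat :: Γ) (finstAt 2 C'.1 (Tm.succ (Tm.var 1)))).bind fun H =>
    ((d (v Γ.length) (v (Γ.length + 1))).chk (C'.1 :: Tm.nat :: Γ) H).bind fun d' =>
    (nf.nty Γ (finst C'.1 m')).bind fun T => fin e (Tm.natInd C'.1 c' d' m') T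
  sound hΓ _ h := by
    obtain ⟨m', h1, h⟩ := Option.bind_eq_some_iff.1 h
    obtain ⟨C', h2, h⟩ := Option.bind_eq_some_iff.1 h
    obtain ⟨G, h3, h⟩ := Option.bind_eq_some_iff.1 h
    obtain ⟨c', h4, h⟩ := Option.bind_eq_some_iff.1 h
    obtain ⟨H, h3', h⟩ := Option.bind_eq_some_iff.1 h
    obtain ⟨d', h4', h⟩ := Option.bind_eq_some_iff.1 h
    obtain ⟨T, h5, h⟩ := Option.bind_eq_some_iff.1 h
    have hm := chk_sound ⟨0, .nat_form hΓ⟩ h1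
    have hC := ty_sound (.ctx_cons (i := 0) (.nat_form hΓ)) h2
    rw [finst_eq] at h3 h5
    rw [finstAt_eq] at h3'
    have hG := hC.tm.inst_ty (.nat_intro_zero hΓ)
    have hH := hC.tm.instAt_succ
    obtain ⟨_, hGG⟩ := nf_sound.nty ⟨_, hG⟩ h3
    obtain ⟨_, hHH⟩ := nf_sound.nty ⟨_, hH⟩ h3'
    have hc := (chk_sound ⟨_, hGG.tm⟩ h4).conv_symm hGG ⟨_, hG⟩
    have hd := (chk_sound ⟨_, hHH.tm⟩ h4').conv_symm hHH ⟨_, hH⟩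
    have := hC.natInd hc hd hm
    obtain ⟨_, hT⟩ := nf_sound.nty this.ty h5
    exact (this.conv hT).fin_self h

/-- Path induction. -/
noncomputable def J (C : Exp → Exp → Exp → Exp) (q : Exp) (c : Exp → Exp) : Exp where
  run Γ e := (q.inf Γ).bind fun q' => match q'.2 with
    | Tm.id A a b =>
      ((C (v Γ.length) (v (Γ.length + 1)) (v (Γ.length + 2))).ty
        (Tm.id (flift 2 A 0) (Tm.var 1) (Tm.var 0) :: flift 1 A 0 :: A :: Γ)).bind fun C' =>
      (nf.nty (A :: Γ) (finstRefl C'.1)).bind fun G =>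
      ((c (v Γ.length)).chk (A :: Γ) G).bind fun c' =>
      (nf.nty Γ (finst₃ C'.1 a b q'.1)).bind fun T => fin e (Tm.idInd A C'.1 c' a b q'.1) T
    | _ => none
  sound hΓ _ h := by
    obtain ⟨⟨q', Q⟩, h1, h⟩ := Option.bind_eq_some_iff.1 h
    have hq := inf_sound hΓ h1
    dsimp only at h hq
    split at h
    · obtain ⟨C', h2, h⟩ := Option.bind_eq_some_iff.1 h
      obtain ⟨G, h3, h⟩ := Option.bind_eq_some_iff.1 h
      obtain ⟨c', h4, h⟩ := Option.bind_eq_some_iff.1 h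
      obtain ⟨T, h5, h⟩ := Option.bind_eq_some_iff.1 h
      rw [flift_zero, flift_zero] at h2
      rw [finstRefl_eq] at h3
      rw [finst₃_eq] at h5
      obtain ⟨_, hS⟩ := hq.ty
      obtain ⟨⟨_, hA⟩, ha, hb⟩ := hS.inv_id
      have hC := ty_sound hA.ctx_id h2
      have hG := hC.tm.instRefl_ty
      obtain ⟨_, hGG⟩ := nf_sound.nty ⟨_, hG⟩ h3
      have hc := (chk_sound ⟨_, hGG.tm⟩ h4).conv_symm hGG ⟨_, hG⟩
      have := (EqD.refl hA (.U_intro hΓ)).idInd hC hc (EqD.refl ha hA) (EqD.refl hb hA) hq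
      obtain ⟨_, hT⟩ := nf_sound.nty this.ty h5
      exact (this.conv hT).fin_self h
    · cases h

/-- The identity type of `a` and `b`, in the type inferred from `a`. -/
noncomputable def path (a b : Exp) : Exp where
  run Γ e := (a.inf Γ).bind fun a' => (b.chk Γ a'.2).bind fun b' =>
    (nf.ty Γ a'.2).bind fun A => fin e (Tm.id A.1 a'.1 b') (Tm.U A.2)
  sound hΓ _ h := by
    obtain ⟨a', h1, h⟩ := Option.bind_eq_some_iff.1 h
    obtain ⟨b', h2, h⟩ := Option.bind_eq_some_iff.1 h
    obtain ⟨A, h3, h⟩ := Option.bind_eq_some_iff.1 h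
    have ha := inf_sound hΓ h1
    have hb := chk_sound ha.ty h2
    have hA := nf_sound.ty hΓ h3
    have := (EqD.refl hA.tm (.U_intro hΓ)).id (ha.conv hA) (hb.conv hA)
    exact this.fin_self h

end Exp

end HoTT

namespace HoTT

open Tm Judgment

/-! ### Closed inhabited types -/

/-- The type that `s` elaborates to has a closed inhabitant. -/
def Inh (s : Exp) : Prop := ∃ A t, s.ty [] = some A ∧ Der (tm [] t A.1)

/-- Elaborates the closed types `l`, as assumptions that extend the context `Γ`. -/
noncomputable def hyps (l : List Exp) : Ctx → Option Ctx :=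
  List.rec (fun Γ => some Γ)
    (fun s _ r Γ => (s.ty []).bind fun A => r (flift Γ.length A.1 0 :: Γ)) l

/-- Elaborates `b` to an inhabitant of `s`, where `b` can use variables of the types `l`. -/
noncomputable def checks (l : List Exp) (s b : Exp) : Bool :=
  ((s.ty []).bind fun A => (hyps l []).bind fun Γ =>
    b.chk Γ (flift Γ.length A.1 0)).isSome

/-- Closed inhabitants of the assumed types assemble into a closing substitution. The invariant on
the variables beyond the context makes it undo the weakening of each closed type, with no separate
notion of closed term. -/
theorem exists_isSub_of_hyps {l : List Exp} {Γ Δ : Ctx} {σ : ℕ → Tm} (h : ∀ s ∈ l, Inh s)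
    (hΓ : hyps l Γ = some Δ) (hc : Der (ctx Γ)) (hσ : IsSub [] σ Γ)
    (hv : ∀ k, σ (k + Γ.length) = Tm.var k) :
    Der (ctx Δ) ∧ ∃ τ, IsSub [] τ Δ ∧ ∀ k, τ (k + Δ.length) = Tm.var k := by
  induction l generalizing Γ σ with
  | nil =>
    cases hΓ
    exact ⟨hc, σ, hσ, hv⟩
  | cons s l ih =>
    obtain ⟨A, hA, hΓ⟩ := Option.bind_eq_some_iff.1 hΓ
    obtain ⟨A', t, hA', ht⟩ := h s (by simp)
    rw [hA] at hA'
    cases hA'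
    have hs := (Exp.ty_sound .ctx_nil hA).tm
    have e : Tm.subst σ (lift Γ.length A.1) = A.1 := by
      rw [lift, subst_rename]
      exact (congrArg (Tm.subst · A.1) (funext hv)).trans (subst_var _)
    have hw : Der (tm Γ (lift Γ.length A.1) (Tm.U A.2)) := by
      have := hs.subst_tm hc (isSub_lift (Γ := []) Γ.length hc fun k => by simp)
      rwa [← lift_eq_subst] at this
    rw [flift_zero] at hΓ
    refine ih (fun s hs => h s (by simp [hs])) hΓ (.ctx_cons hw) (hσ.cons (a := t) (by rwa [e])) ?_
    intro k
    exact hv k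

/-- This is the cut rule. A proof is checked with the earlier lemmas as variables, so their proof
terms are neither inspected nor unfolded during evaluation. -/
theorem Inh.of_checks {l : List Exp} {s : Exp} (b : Exp) (hb : checks l s b = true)
    (h : l.Forall Inh) : Inh s := by
  rw [List.forall_iff_forall_mem] at h
  obtain ⟨t, hb⟩ := Option.isSome_iff_exists.1 hb
  obtain ⟨A, hA, hb⟩ := Option.bind_eq_some_iff.1 hb
  obtain ⟨Γ, hΓ, hb⟩ := Option.bind_eq_some_iff.1 hb
  obtain ⟨hc, τ, hτ, hv⟩ := exists_isSub_of_hyps (σ := Tm.var) h hΓ .ctx_nil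
    (.refl .ctx_nil) fun k => rfl
  have hs := (Exp.ty_sound .ctx_nil hA).tm
  have hw : Der (tm Γ (lift Γ.length A.1) (Tm.U A.2)) := by
    have := hs.subst_tm hc (isSub_lift (Γ := []) Γ.length hc fun k => by simp)
    rwa [← lift_eq_subst] at this
  rw [flift_zero] at hb
  have := (Exp.chk_sound ⟨_, hw⟩ hb).tm.subst_tm .ctx_nil hτ
  have e : Tm.subst τ (lift Γ.length A.1) = A.1 := by
    rw [lift, subst_rename]
    exact (congrArg (Tm.subst · A.1) (funext hv)).trans (subst_var _)
  rw [e] at this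
  exact ⟨A, _, hA, this⟩

namespace Exp

/-! ### Derived combinators -/

noncomputable def arrow (A B : Exp) : Exp := pi A fun _ => B

noncomputable def neg (A : Exp) : Exp := arrow A empty

noncomputable def pis (A : Exp) (B : Exp → Exp → Exp) : Exp := pi A fun x => pi A fun y => B x y

/-- Transport along `p` in the family `P`. -/
noncomputable def tr (P : Exp → Exp) (p u : Exp) : Exp :=
  app (J (fun x y _ => arrow (P x) (P y)) p fun _ => lam fun u => u) u

noncomputable def sym (p : Exp) : Exp := J (fun x y _ => path y x) p fun _ => rfl'

noncomputable def ap (f : Exp → Exp) (p : Exp) : Exp :=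
  J (fun x y _ => path (f x) (f y)) p fun _ => rfl'

/-- The concatenation of `p` and `q`, where `q` ends in `c`. -/
noncomputable def catTo (c p q : Exp) : Exp :=
  app (J (fun x y _ => arrow (path y c) (path x c)) p fun _ => lam fun r => r) q

/-- The concatenation of two paths. -/
noncomputable def cat (p q : Exp) : Exp where
  run Γ e := match e with
    | some (Tm.id _ _ c) => (catTo (quote Γ.length c) p q).run Γ e
    | _ => (q.inf Γ).bind fun q' => match q'.2 with
      | Tm.id _ _ c => (catTo (quote Γ.length c) p q).run Γ e
      | _ => none
  sound hΓ he h := by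
    split at h
    · exact (catTo _ p q).sound hΓ he h
    · obtain ⟨q', _, h⟩ := Option.bind_eq_some_iff.1 h
      split at h
      · exact (catTo _ p q).sound hΓ he h
      · cases h

noncomputable instance : CoeFun Exp fun _ => Exp → Exp := ⟨app⟩

/-- Functions of several arguments, for iterated abstraction. -/
class Lams (α : Type) where
  lam : α → Exp

instance : Lams Exp := ⟨fun a => a⟩

noncomputable instance {α : Type} [Lams α] : Lams (Exp → α) :=
  ⟨fun f => lam fun x => Lams.lam (f x)⟩

/-- Iterated abstraction. -/
def lams {α : Type} [Lams α] (f : α) : Exp := Lams.lam f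

/-- The application of `f`, a function with values in `B`, to the path `p`. -/
noncomputable def apT (B : Exp) (f : Exp → Exp) (p : Exp) : Exp :=
  J (fun x y _ => idT B (f x) (f y)) p fun _ => rfl'

noncomputable def isContr (A : Exp) : Exp := sigma A fun a => pi A fun x => idT A a x

/-- `is-(m-2)-type(A)`, where `A` is in the universe `U_i` and `m` is a term of type `ℕ`. -/
noncomputable def trunc (i : ℕ) (m A : Exp) : Exp :=
  app (natRec (fun _ => arrow (U i) (U i)) m (lamT (U i) isContr)
    fun _ K => lam fun A => pis A fun x y => app K (path x y)) A

/-- The underlying type of the `m`-fold loop space of `A` at `a`. -/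
noncomputable def loops (i : ℕ) (m A a : Exp) : Exp :=
  app (app (natRec (fun _ => pi (U i) fun A => arrow A (U i)) m (lam fun A => lam fun _ => A)
    fun _ K => lam fun _ => lam fun a => app (app K (path a a)) (refl a)) A) a

/-- The basepoint of `loops i m A a`. -/
noncomputable def base (i : ℕ) (m A a : Exp) : Exp :=
  app (app (natRec (fun m => pi (U i) fun A => pi A fun a => loops i m A a) m
    (lam fun _ => lam fun a => a)
    fun _ K => lam fun _ => lam fun a => app (app K (path a a)) (refl a)) A) a

/-- The type of proofs that `f : A → B` is an equivalence. -/
noncomputable def isEquiv (A B f : Exp) : Exp :=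
  pi B fun b => isContr (sigma A fun a => idT B (f a) b)

noncomputable def equiv (A B : Exp) : Exp := sigma (arrow A B) fun f => isEquiv A B f

/-- A closed term, checked by the normalizer. -/
noncomputable def rawIn (t : Tm) (A : Exp) : Exp := ann (quote 0 t) A

noncomputable def idIsEquiv (i : ℕ) (A : Exp) : Exp :=
  rawIn (Tm.lam (Tm.U i) (Tm.idIsEquiv (Tm.var 0)))
    (pi (U i) fun A => isEquiv A A (lamT A fun x => x)) A

noncomputable def idEquiv (i : ℕ) (A : Exp) : Exp :=
  rawIn (Tm.lam (Tm.U i) (Tm.idEquiv (Tm.var 0))) (pi (U i) fun A => equiv A A) A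

noncomputable def idtoeqv (i : ℕ) (A B p : Exp) : Exp :=
  rawIn (Tm.lam (Tm.U i) (Tm.lam (Tm.U i) (Tm.idtoeqv i (Tm.var 1) (Tm.var 0))))
    (pis (U i) fun A B => arrow (idT (U i) A B) (equiv A B)) A B p

noncomputable def ua (i : ℕ) : Exp := raw (Tm.univalenceType i)

end Exp

end HoTT

/-! ### Homotopy theory inside the type theory. -/

namespace HoTT

open Exp

/-! ### Paths -/

noncomputable def stInvl : Exp :=
  pi (U 2) fun A => pis A fun x y => pi (path x y) fun p => path (cat (sym p) p) (refl y)

theorem inh_invl : Inh stInvl :=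
  .of_checks (l := [])
    (lams fun (_ _ _ p : Exp) => J (fun _ y p => path (cat (sym p) p) (refl y)) p fun _ => rfl')
    (by decide +kernel) trivial

noncomputable def stRunit : Exp :=
  pi (U 2) fun A => pis A fun x y => pi (path x y) fun p => path (cat p (refl y)) p

theorem inh_runit : Inh stRunit :=
  .of_checks (l := [])
    (lams fun (_ _ _ p : Exp) => J (fun _ y p => path (cat p (refl y)) p) p fun _ => rfl')
    (by decide +kernel) trivial

noncomputable def stCancel : Exp :=
  pi (U 2) fun A => pis A fun x y => pi A fun z => pi (path x y) fun p => pis (path y z) fun r s =>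
    arrow (path (cat p r) (cat p s)) (path r s)

theorem inh_cancel : Inh stCancel :=
  .of_checks (l := [])
    (lams fun (_ _ _ z p : Exp) =>
      J (fun _ y p => pis (path y z) fun r s => arrow (path (cat p r) (cat p s)) (path r s)) p
        fun _ => lams fun (_ _ e : Exp) => e)
    (by decide +kernel) trivial

/-! ### Retracts -/

/-- The data that make `A` a retract of `B`. -/
noncomputable def ret (A B : Exp) (T : Exp → Exp → Exp) : Exp :=
  pi (arrow A B) fun s => pi (arrow B A) fun r =>
    arrow (pi A fun x => path (r (s x)) x) (T s r)

noncomputable def truncRet (m : Exp) : Exp :=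
  pis (U 1) fun A B => ret A B fun _ _ => arrow (trunc 1 m B) (trunc 1 m A)

/-- Retracts of `k`-types are `k`-types. -/
noncomputable def stTruncRet : Exp := pi nat truncRet

/-- A retraction `r ∘ s ∼ id` with homotopy `H` induces one on path types: `s` acts by `ap s`, and
its left inverse sends `q` to `(H x)⁻¹ · ap r q · H y`. Induction on the truncation level then needs
only the contractible case, whose centre is the image of the centre. -/
theorem inh_truncRet : Inh stTruncRet :=
  .of_checks (l := [stInvl])
    (let invl := v 0
    lam fun m => natRec truncRet m
      (lams fun (_ _ s r H c : Exp) =>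
        split c fun b h => pair (r b) (lam fun x => cat (ap r (h (s x))) (H x)))
      fun _ K => lams fun (A _ s r H t x y : Exp) =>
        let r' x y q := cat (sym (H x)) (cat (ap r q) (H y))
        K (path x y) (path (s x) (s y)) (lam fun p => ap s p) (lam fun q => r' x y q)
          -- At `refl` the left-hand side computes to `(H x)⁻¹ · H x`.
          (lam fun p => J (fun x y p => path (r' x y (ap s p)) p) p fun x => invl A (r (s x)) x (H x))
          (t (s x) (s y)))
    (by decide +kernel) inh_invl

/-- `b` lifts `z`, and is nontrivial if `z` is. -/
noncomputable def loopLift (m A a B b z : Exp) : Exp :=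
  sigma (loops 2 m B b) fun z' => arrow (path (base 2 m B b) z') (path (base 2 m A a) z)

noncomputable def loopRet (m : Exp) : Exp :=
  pis (U 2) fun A B => pi A fun a => ret A B fun s _ => pi (loops 2 m A a) fun z =>
    loopLift m A a B (s a) z

noncomputable def stLoopRet : Exp := pi nat loopRet

/-- The induced retraction on path types serves again. The point `refl a` goes judgmentally to `refl
(s a)`, so the induction hypothesis applies without moving the basepoint. In dimension zero, `s a =
s z` gives `a = z` by applying `r`. -/
theorem inh_loopRet : Inh stLoopRet :=
  .of_checks (l := [stInvl])
    (let invl := v 0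
    lam fun m => natRec loopRet m
      (lams fun (_ _ a s r H z : Exp) =>
        pair (s z) (lam fun e => cat (sym (H a)) (cat (ap r e) (H z))))
      fun _ K => lams fun (A _ a s r H z : Exp) =>
        let r' x y q := cat (sym (H x)) (cat (ap r q) (H y))
        K (path a a) (path (s a) (s a)) (refl a) (lam fun p => ap s p) (lam fun q => r' a a q)
          (lam fun p => J (fun x y p => path (r' x y (ap s p)) p) p fun x => invl A (r (s x)) x (H x))
          z)
    (by decide +kernel) inh_invl

/-- Loops lift along pointed retractions. -/
noncomputable def stLoopPt : Exp :=
  pi nat fun m => pis (U 2) fun A B => pi A fun a => pi B fun b => ret A B fun s _ =>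
    arrow (path (s a) b) (pi (loops 2 m A a) fun z => loopLift m A a B b z)

theorem inh_loopPt : Inh stLoopPt :=
  .of_checks (l := [stLoopRet])
    (let loopRet := v 0
    lams fun (m A B a _ s r H p z : Exp) =>
      tr (fun b => loopLift m A a B b z) p (loopRet m A B a s r H z))
    (by decide +kernel) inh_loopRet

/-- For a variable `m`, the recursions that define `loops 1 m` and `loops 2 m` have different
motives and are not judgmentally equal. Cumulativity alone thus does not move a loop up one
universe; an induction on `m` is needed. -/
noncomputable def loopUp (m : Exp) : Exp :=
  pi (U 1) fun A => pi A fun a => pi (loops 1 m A a) fun z =>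
    sigma (loops 2 m A a) fun z' => arrow (path (base 2 m A a) z') (path (base 1 m A a) z)

/-- Loops lift to the next universe. -/
noncomputable def stLoopUp : Exp := pi nat loopUp

theorem inh_loopUp : Inh stLoopUp :=
  .of_checks (l := [])
    (lam fun m => natRec loopUp m
      (lams fun (_ _ z : Exp) => pair z (lam fun e => e))
      fun _ K => lams fun (_ a z : Exp) => K (path a a) (refl a) z)
    (by decide +kernel) trivial

end HoTT

namespace HoTT

open Exp

/-! ### Function extensionality -/

/-- The elaborated type is a normal form of the axiom, possibly after a second pass, so the constant
inhabits it by conversion. -/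
theorem inh_ua {i : ℕ} (h : ((ua i).ty []).isSome = true) : Inh (ua i) := by
  obtain ⟨A, hA⟩ := Option.isSome_iff_exists.1 h
  obtain ⟨s, hs, h⟩ := Option.bind_eq_some_iff.1 hA
  obtain ⟨s', h', hs⟩ := Option.bind_eq_some_iff.1 hs
  cases hs
  have h1 := nf_sound.ty .ctx_nil h'
  have h2 := Der.conv (.univalence_intro .ctx_nil) h1.eq
  dsimp only at h
  cases hb : Tm.hasRedex s'.1
  · rw [hb] at h
    cases h
    exact ⟨_, _, hA, h2⟩
  · rw [hb] at h
    exact ⟨_, _, hA, .conv h2 (nf_sound.ty .ctx_nil h).eq⟩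

theorem inh_ua_one : Inh (ua 1) := inh_ua (by decide +kernel)

theorem inh_ua_zero : Inh (ua 0) := inh_ua (by decide +kernel)

noncomputable def postEquiv (X A B e : Exp) : Exp :=
  isEquiv (arrow X A) (arrow X B) (lamT (arrow X A) fun f => lamT X fun x => fst e (f x))

/-- Postcomposition with an equivalence is an equivalence. -/
noncomputable def stPost : Exp :=
  pi (U 1) fun X => pis (U 1) fun A B => pi (equiv A B) fun e => postEquiv X A B e

/-- Univalence reduces to an equivalence of the form `idtoeqv p`, and path induction to the
identity. By `η`, postcomposition with the identity is the identity function. -/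
theorem inh_post : Inh stPost :=
  .of_checks (l := [ua 1])
    (let ua := v 0
    lams fun (X A B e : Exp) => split (fst (ua A B e)) fun p q =>
      tr (postEquiv X A B) q (J (fun A B p => postEquiv X A B (idtoeqv 1 A B p)) p
        fun A => idIsEquiv 1 (arrow X A)))
    (by decide +kernel) inh_ua_one

noncomputable def stFstEquiv : Exp :=
  pi (U 1) fun A => pi (arrow A (U 1)) fun P => arrow (pi A fun x => isContr (P x)) <|
    isEquiv (sigma A fun x => P x) A (lamT (sigma A fun x => P x) fun z => fst z)

/-- The first projection of a family of contractible types is an equivalence. -/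
theorem inh_fstEquiv : Inh stFstEquiv :=
  .of_checks (l := [])
    (lams fun (A P h b : Exp) =>
      let S := sigma A fun x => P x
      let F b := sigma S fun z => idT A (fst z) b
      let c b := pair (pair b (fst (h b))) rfl'
      pair (c b) (lam fun w => sigmaRec (fun w => idT (F b) (c b) w) w fun z q =>
        -- The path and then the fibre component are abstracted before each elimination, so that
        -- `fst z` becomes a free endpoint for path induction.
        app (sigmaRec (fun z => pi (path (fst z) b) fun q => idT (F b) (c b) (pair z q)) z
          fun _ u => lam fun q =>
            app (J (fun x b q => pi (P x) fun u => idT (F b) (c b) (pair (pair x u) q)) q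
              fun x => lam fun u =>
                apT (F x) (fun u => pair (pair x u) rfl') (snd (h x) u)) u) q))
    (by decide +kernel) trivial

noncomputable def stWeakFunext : Exp :=
  pi (U 1) fun A => pi (arrow A (U 1)) fun P => arrow (pi A fun x => isContr (P x)) <|
    isContr (pi A fun x => P x)

/-- Products of contractible types are contractible. -/
theorem inh_weakFunext : Inh stWeakFunext :=
  .of_checks (l := [stTruncRet, stPost, stFstEquiv])
    (let truncRet := v 0
    let post := v 1
    let fstEquiv := v 2
    lams fun (A P h : Exp) =>
      let S := sigma A fun x => P x
      -- `F` is the fibre over the identity of postcomposition with the first projection `S → A`.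
      -- That projection is an equivalence because the fibres are contractible, hence `F` is
      -- contractible. A section `f` becomes `x ↦ (x, f x)` in `F`, and transport recovers `f`
      -- judgmentally.
      let F := sigma (arrow A S) fun g =>
        idT (arrow A A) (lam fun x => fst (g x)) (lam fun x => x)
      let r w := split w fun g p => lam fun x => tr (fun y => P y) (ap (fun k => k x) p) (snd (g x))
      truncRet zero (pi A fun x => P x) F
        (lam fun f => pair (lam fun x => pair x (f x)) rfl')
        (lam fun w => r w)
        (lam fun _ => rfl')
        (post A S A (pair (lam fun z => fst z) (fstEquiv A P h)) (lam fun x => x)))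
    (by decide +kernel) ⟨inh_truncRet, inh_post, inh_fstEquiv⟩

noncomputable def homotopy (A f g : Exp) : Exp := pi A fun x => path (f x) (g x)

noncomputable def stHomotopyContr : Exp :=
  pi (U 1) fun A => pi (arrow A (U 1)) fun B => pi (pi A fun x => B x) fun f =>
    isContr (sigma (pi A fun x => B x) fun g => homotopy A f g)

/-- The type of functions that are homotopic to `f` is contractible. -/
theorem inh_homotopyContr : Inh stHomotopyContr :=
  .of_checks (l := [stTruncRet, stWeakFunext])
    (let truncRet := v 0
    let wfe := v 1
    lams fun (A B f : Exp) =>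
      -- Functions with a homotopy from `f` form a retract of the product of the based path types `S
      -- x`, each of which is contractible.
      let S x := sigma (B x) fun y => path (f x) y
      truncRet zero (sigma (pi A fun x => B x) fun g => homotopy A f g) (pi A fun x => S x)
        (lam fun z => lam fun x => pair (fst z x) (snd z x))
        (lam fun k => pair (lam fun x => fst (k x)) (lam fun x => snd (k x)))
        (lam fun z => sigmaRec (fun z => idT (sigma (pi A fun x => B x) fun g => homotopy A f g)
          (pair (lam fun x => fst z x) (lam fun x => snd z x)) z) z fun _ _ => rfl')
        (wfe A (lam fun x => S x) (lam fun x => pair (pair (f x) rfl') (lam fun w =>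
          sigmaRec (fun w => idT (S x) (pair (f x) rfl') w) w fun _ q =>
            J (fun a y q => idT (sigma (B x) fun y => path a y) (pair a rfl') (pair y q)) q
              fun _ => rfl'))))
    (by decide +kernel) ⟨inh_truncRet, inh_weakFunext⟩

/-- Lifting loops needs homotopies as a retract of paths, with `refl` preserved, and this is what is
recorded here. Truncatedness of function types needs paths as a retract of homotopies, which `stExt`
provides. -/
noncomputable def stFunext : Exp :=
  pi (U 1) fun A => pi (arrow A (U 1)) fun B => pi (pi A fun x => B x) fun f =>
    sigma (pi (pi A fun x => B x) fun g => arrow (homotopy A f g) (path f g)) fun ext =>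
    sigma (path (ext f (lam fun x => refl (f x))) (refl f)) fun _ =>
    pi (pi A fun x => B x) fun g => pi (homotopy A f g) fun h =>
      idT (homotopy A f g) (lam fun x => ap (fun k => k x) (ext g h)) h

/-- Function extensionality. -/
theorem inh_funext : Inh stFunext :=
  .of_checks (l := [stInvl, stHomotopyContr])
    (let invl := v 0
    let hc := v 1
    lams fun (A B f : Exp) =>
      let S := sigma (pi A fun x => B x) fun g => homotopy A f g
      let c := snd (hc A B f)
      let z₀ := ann (pair f (lam fun x => refl (f x))) S
      -- Correcting the contraction by its value at `z₀` makes `q z₀` equal to `refl`. Hence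
      -- extensionality sends the constant homotopy to `refl`, and the remaining identity follows by
      -- transport from `z₀` along `q`.
      let q z := cat (sym (c z₀)) (c z)
      let e := invl S (fst (hc A B f)) z₀ (c z₀)
      pair (lams fun (g h : Exp) => ap fst (q (ann (pair g h) S))) <|
      pair (ap (fun p => ap fst p) e) <|
      lams fun (g h : Exp) =>
        tr (fun z => idT (homotopy A f (fst z))
            (lam fun x => ap (fun k => k x) (ap fst (q z))) (snd z))
          (q (ann (pair g h) S))
          (apT (homotopy A f f) (fun p => lam fun x => ap (fun k => k x) (ap fst p)) e))
    (by decide +kernel) ⟨inh_invl, inh_homotopyContr⟩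

noncomputable def stExt : Exp :=
  pi (U 1) fun A => pi (arrow A (U 1)) fun B => pis (pi A fun x => B x) fun f g =>
    sigma (arrow (homotopy A f g) (path f g)) fun ext =>
    pi (path f g) fun p => path (ext (lam fun x => ap (fun k => k x) p)) p

theorem inh_ext : Inh stExt :=
  .of_checks (l := [stFunext])
    (let funext := v 0
    lams fun (A B f g : Exp) => pair (fst (funext A B f) g) (lam fun p =>
      J (fun f g p => path (fst (funext A B f) g (lam fun x => ap (fun k => k x) p)) p) p
        fun f => fst (snd (funext A B f))))
    (by decide +kernel) inh_funext

end HoTT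

namespace HoTT

open Exp

/-! ### Paths between pairs -/

noncomputable def sigmaOf (A B : Exp) : Exp := sigma A fun x => B x

/-- Pairs of paths between the components of `z` and `z'`. -/
noncomputable def pairEq (B z z' : Exp) : Exp :=
  sigma (path (fst z) (fst z')) fun p => idT (B (fst z')) (tr (fun x => B x) p (snd z)) (snd z')

noncomputable def toPairEq (B p : Exp) : Exp :=
  J (fun z z' _ => pairEq B z z') p fun _ => pair rfl' rfl'

/-- The fibre of `toPairEq` over `w`. -/
noncomputable def pairEqFib (B z z' w : Exp) : Exp :=
  sigma (path z z') fun r => idT (pairEq B z z') (toPairEq B r) w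

/-- The statement is first proved for literal pairs, whose components are free endpoints for two
successive path inductions; arbitrary elements follow by `Σ`-induction. The normalization at `refl`
gives the other round trip in `stSigmaEq`. -/
noncomputable def stPairPath : Exp :=
  pi (U 2) fun A => pi (arrow A (U 2)) fun B =>
    let S := sigmaOf A B
    sigma (pis A fun x y => pi (path x y) fun p => pi (B x) fun u => pi (B y) fun v =>
      pi (idT (B y) (tr (fun x => B x) p u) v) fun q =>
        pairEqFib B (ann (pair x u) S) (ann (pair y v) S) (pair p q)) fun f =>
    pi A fun x => pi (B x) fun u =>
      path (fst (f x x (refl x) u u rfl')) (refl (ann (pair x u) S))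

theorem inh_pairPath : Inh stPairPath :=
  .of_checks (l := [])
    (lams fun (A B : Exp) =>
      let S := sigmaOf A B
      pair (lams fun (_ _ p : Exp) => J (fun x y p => pi (B x) fun u => pi (B y) fun v =>
          pi (idT (B y) (tr (fun x => B x) p u) v) fun q =>
            pairEqFib B (ann (pair x u) S) (ann (pair y v) S) (pair p q)) p
        fun x => lams fun (_ _ q : Exp) => J (fun u v q =>
          pairEqFib B (ann (pair x u) S) (ann (pair x v) S) (pair rfl' q)) q
            fun _ => pair rfl' rfl')
        (lams fun (_ _ : Exp) => rfl'))
    (by decide +kernel) trivial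

noncomputable def stSigmaPath : Exp :=
  pi (U 2) fun A => pi (arrow A (U 2)) fun B =>
    sigma (pis (sigmaOf A B) fun z z' => pi (pairEq B z z') fun w => pairEqFib B z z' w) fun f =>
    pi A fun x => pi (B x) fun u => let z := ann (pair x u) (sigmaOf A B)
      path (fst (f z z (pair rfl' rfl'))) (refl z)

theorem inh_sigmaPath : Inh stSigmaPath :=
  .of_checks (l := [stPairPath])
    (let pairPath := v 0
    lams fun (A B : Exp) => split (pairPath A B) fun f h =>
      let S := sigmaOf A B
      pair (lams fun (z z' w : Exp) =>
        app (app (sigmaRec (fun z => pi S fun z' => pi (pairEq B z z') fun w => pairEqFib B z z' w) z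
          fun x u => lam fun z' =>
            sigmaRec (fun z' => pi (pairEq B (ann (pair x u) S) z') fun w =>
              pairEqFib B (ann (pair x u) S) z' w) z' fun y v => lam fun w =>
                sigmaRec (fun w => pairEqFib B (ann (pair x u) S) (ann (pair y v) S) w) w
                  fun p q => f x y p u v q) z') w)
        h)
    (by decide +kernel) inh_pairPath

noncomputable def stSigmaEq : Exp :=
  pi (U 2) fun A => pi (arrow A (U 2)) fun B => pis (sigmaOf A B) fun z z' =>
    sigma (arrow (pairEq B z z') (path z z')) fun f =>
    sigma (pi (path z z') fun p => path (f (toPairEq B p)) p) fun _ =>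
    pi (pairEq B z z') fun w => idT (pairEq B z z') (toPairEq B (f w)) w

/-- Paths between pairs are pairs of paths. -/
theorem inh_sigmaEq : Inh stSigmaEq :=
  .of_checks (l := [stSigmaPath])
    (let sp := v 0
    lams fun (A B z z' : Exp) => split (sp A B) fun f h =>
      pair (lam fun w => fst (f z z' w)) <| pair
        (lam fun p => J (fun z z' p => path (fst (f z z' (toPairEq B p))) p) p fun z =>
          sigmaRec (fun z => path (fst (f z z (pair rfl' rfl'))) (refl z)) z fun x u => h x u)
        (lam fun w => snd (f z z' w)))
    (by decide +kernel) inh_sigmaPath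

/-! ### Closure properties of `k`-types -/

noncomputable def stContrPath : Exp :=
  pi (U 1) fun A => arrow (isContr A) <| pis A fun x y => isContr (path x y)

theorem inh_contrPath : Inh stContrPath :=
  .of_checks (l := [stInvl])
    (let invl := v 0
    lams fun (A c x y : Exp) => let h := snd c
      pair (cat (sym (h x)) (h y)) <| lam fun p =>
        J (fun x y p => path (cat (sym (h x)) (h y)) p) p fun x => invl A (fst c) x (h x))
    (by decide +kernel) inh_invl

noncomputable def truncUp (m : Exp) : Exp :=
  pi (U 1) fun A => arrow (trunc 1 m A) (trunc 1 (succ m) A)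

/-- `k`-types are `(k + 1)`-types. -/
noncomputable def stTruncUp : Exp := pi nat truncUp

theorem inh_truncUp : Inh stTruncUp :=
  .of_checks (l := [stContrPath])
    (let contrPath := v 0
    lam fun m => natRec truncUp m contrPath
      fun _ K => lams fun (_ t x y : Exp) => K (path x y) (t x y))
    (by decide +kernel) inh_contrPath

noncomputable def truncPi (m : Exp) : Exp :=
  pi (U 1) fun A => pi (arrow A (U 1)) fun B => arrow (pi A fun x => trunc 1 m (B x))
    (trunc 1 m (pi A fun x => B x))

/-- Products of `k`-types are `k`-types. -/
noncomputable def stTruncPi : Exp := pi nat truncPi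

/-- Weak function extensionality is the contractible case. Above it, `f = g` is a retract of the
product of the types `f x = g x`, which are one level lower. -/
theorem inh_truncPi : Inh stTruncPi :=
  .of_checks (l := [stTruncRet, stWeakFunext, stExt])
    (let truncRet := v 0
    let wfe := v 1
    let ext := v 2
    lam fun m => natRec truncPi m wfe
      fun m K => lams fun (A B t f g : Exp) => split (ext A B f g) fun e h =>
        truncRet m (path f g) (homotopy A f g)
          (lam fun p => lam fun x => ap (fun k => k x) p) e h
          (K A (lam fun x => path (f x) (g x)) (lam fun x => t x (f x) (g x))))
    (by decide +kernel) ⟨inh_truncRet, inh_weakFunext, inh_ext⟩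

noncomputable def truncSigma (m : Exp) : Exp :=
  pi (U 1) fun A => pi (arrow A (U 1)) fun B => arrow (trunc 1 m A) <|
    arrow (pi A fun x => trunc 1 m (B x)) (trunc 1 m (sigmaOf A B))

/-- Sums of `k`-types over a `k`-type are `k`-types. -/
noncomputable def stTruncSigma : Exp := pi nat truncSigma

/-- The path type of a sum is a retract of a sum of path types, to which the induction hypothesis
applies. In the contractible case, contracting the base brings every point into the fibre over the
centre. -/
theorem inh_truncSigma : Inh stTruncSigma :=
  .of_checks (l := [stTruncRet, stSigmaEq])
    (let truncRet := v 0
    let sigmaEq := v 1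
    lam fun m => natRec truncSigma m
      (lams fun (A B c t : Exp) =>
        let S := sigmaOf A B
        pair (pair (fst c) (fst (t (fst c)))) <| lam fun z =>
          sigmaRec (fun z => idT S (pair (fst c) (fst (t (fst c)))) z) z fun x u =>
            app (J (fun a x _ => pi (B x) fun u => idT S (pair a (fst (t a))) (pair x u)) (snd c x)
              fun x => lam fun u => apT S (fun u => pair x u) (snd (t x) u)) u)
      fun m K => lams fun (A B s t z z' : Exp) =>
        split (sigmaEq A (lam fun x => B x) z z') fun f w =>
          truncRet m (path z z') (pairEq B z z') (lam fun p => toPairEq B p) f (fst w)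
            (K (path (fst z) (fst z'))
              (lam fun p => path (tr (fun x => B x) p (snd z)) (snd z'))
              (s (fst z) (fst z'))
              (lam fun p => t (fst z') (tr (fun x => B x) p (snd z)) (snd z'))))
    (by decide +kernel) ⟨inh_truncRet, inh_sigmaEq⟩

noncomputable def truncProp (i : ℕ) (m : Exp) : Exp :=
  pi (U i) fun A => trunc 1 (succ zero) (trunc i m A)

/-- Being a `k`-type is a proposition. -/
noncomputable def stTruncProp (i : ℕ) : Exp := pi nat (truncProp i)

/-- Given a proof that `A` is contractible, `isContr A` is itself contractible, as a sum over `A` of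
products of contractible path types; so any two such proofs are equal in a contractible way. Higher
levels are products of propositions. -/
noncomputable def truncPropProof (i : ℕ) : Exp :=
  let contrPath := v 0
  let truncPi := v 1
  let truncSigma := v 2
  lam fun m => natRec (truncProp i) m
    (lam fun A => lam fun c => contrPath (isContr A)
      (truncSigma zero A (lam fun a => pi A fun x => path a x) c
        (lam fun a => truncPi zero A (lam fun x => path a x) (lam fun x => contrPath A c a x))) c)
    fun m K => lam fun A =>
      let P x y := trunc i m (path x y)
      truncPi (succ zero) A (lam fun x => pi A fun y => P x y)
        (lam fun x => truncPi (succ zero) A (lam fun y => P x y) (lam fun y => K (path x y)))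

theorem inh_truncProp_one : Inh (stTruncProp 1) :=
  .of_checks (l := [stContrPath, stTruncPi, stTruncSigma])
    (truncPropProof 1)
    (by decide +kernel) ⟨inh_contrPath, inh_truncPi, inh_truncSigma⟩

theorem inh_truncProp_zero : Inh (stTruncProp 0) :=
  .of_checks (l := [stContrPath, stTruncPi, stTruncSigma])
    (truncPropProof 0)
    (by decide +kernel) ⟨inh_contrPath, inh_truncPi, inh_truncSigma⟩

noncomputable def propTrunc (m : Exp) : Exp :=
  pi (U 1) fun A => arrow (trunc 1 (succ zero) A) (trunc 1 (succ m) A)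

noncomputable def stPropTrunc : Exp := pi nat propTrunc

theorem inh_propTrunc : Inh stPropTrunc :=
  .of_checks (l := [stTruncUp])
    (let truncUp := v 0
    lam fun m => natRec propTrunc m
      (lams fun (_ t : Exp) => t)
      fun m K => lams fun (A t : Exp) => truncUp (succ m) A (K A t))
    (by decide +kernel) inh_truncUp

noncomputable def stSetTrunc : Exp :=
  pi nat fun m => pi (U 1) fun A => arrow (trunc 1 (succ (succ zero)) A) (trunc 1 (succ (succ m)) A)

theorem inh_setTrunc : Inh stSetTrunc :=
  .of_checks (l := [stPropTrunc])
    (let propTrunc := v 0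
    lams fun (m _ t x y : Exp) => propTrunc m (path x y) (t x y))
    (by decide +kernel) inh_propTrunc

/-- As for loop spaces, truncatedness defined by recursion in two universes agrees only after
induction on the level. -/
noncomputable def truncCumul (m : Exp) : Exp :=
  pi (U 0) fun A => arrow (trunc 0 m A) (trunc 1 m A)

noncomputable def stTruncCumul : Exp := pi nat truncCumul

theorem inh_truncCumul : Inh stTruncCumul :=
  .of_checks (l := [])
    (lam fun m => natRec truncCumul m
      (lams fun (_ t : Exp) => t)
      fun _ K => lams fun (_ t x y : Exp) => K (path x y) (t x y))
    (by decide +kernel) trivial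

noncomputable def stEquivProp : Exp :=
  pis (U 1) fun A B => pi (arrow A B) fun f => trunc 1 (succ zero) (isEquiv A B f)

/-- Being an equivalence is a proposition. -/
theorem inh_equivProp : Inh stEquivProp :=
  .of_checks (l := [stTruncPi, stTruncProp 1])
    (let truncPi := v 0
    let truncProp := v 1
    lams fun (A B f : Exp) =>
      let F b := sigma A fun a => path (f a) b
      truncPi (succ zero) B (lam fun b => isContr (F b)) (lam fun b => truncProp zero (F b)))
    (by decide +kernel) ⟨inh_truncPi, inh_truncProp_one⟩

noncomputable def stEquivTrunc : Exp :=
  pi nat fun m => pis (U 1) fun A B => arrow (trunc 1 (succ m) B) (trunc 1 (succ m) (equiv A B))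

theorem inh_equivTrunc : Inh stEquivTrunc :=
  .of_checks (l := [stTruncPi, stTruncSigma, stPropTrunc, stEquivProp])
    (let truncPi := v 0
    let truncSigma := v 1
    let propTrunc := v 2
    let equivProp := v 3
    lams fun (m A B t : Exp) => truncSigma (succ m) (arrow A B) (lam fun f => isEquiv A B f)
      (truncPi (succ m) A (lam fun _ => B) (lam fun _ => t))
      (lam fun f => propTrunc m (isEquiv A B f) (equivProp A B f)))
    (by decide +kernel) ⟨inh_truncPi, inh_truncSigma, inh_propTrunc, inh_equivProp⟩

end HoTT

namespace HoTT

open Exp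

/-! ### Univalence and propositional families -/

/-- Both round trips are kept: truncatedness uses paths of types as a retract of equivalences, the
lifting of loops uses the reverse. -/
noncomputable def stUaInv (i : ℕ) : Exp :=
  pis (U i) fun A B => sigma (arrow (equiv A B) (idT (U i) A B)) fun g =>
    sigma (pi (equiv A B) fun e => idT (equiv A B) (idtoeqv i A B (g e)) e) fun _ =>
    pi (idT (U i) A B) fun p => path (g (idtoeqv i A B p)) p

noncomputable def uaInvProof (i : ℕ) : Exp :=
  let ua := v 0
  lams fun (A B : Exp) =>
    pair (lam fun e => fst (fst (ua A B e))) <| pair (lam fun e => snd (fst (ua A B e))) <|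
    lam fun p => ap fst (snd (ua A B (idtoeqv i A B p)) (pair p rfl'))

theorem inh_uaInv_zero : Inh (stUaInv 0) :=
  .of_checks (l := [ua 0])
    (uaInvProof 0)
    (by decide +kernel) inh_ua_zero

theorem inh_uaInv_one : Inh (stUaInv 1) :=
  .of_checks (l := [ua 1])
    (uaInvProof 1)
    (by decide +kernel) inh_ua_one

noncomputable def propFam (A P : Exp) : Exp := pi A fun x => trunc 1 (succ zero) (P x)

/-- The two equations on `f` make the path type of the base a pointed retract of the path type of
the subtype, which is the input of `stLoopPt`. -/
noncomputable def stSubtypePath : Exp :=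
  pi (U 2) fun A => pi (arrow A (U 1)) fun P => arrow (propFam A P) <|
    sigma (pis (sigmaOf A P) fun z z' => arrow (path (fst z) (fst z')) (path z z')) fun f =>
    sigma (pi (sigmaOf A P) fun z => path (f z z rfl') (refl z)) fun _ =>
    pis (sigmaOf A P) fun z z' => pi (path (fst z) (fst z')) fun p => path (ap fst (f z z' p)) p

theorem inh_subtypePath : Inh stSubtypePath :=
  .of_checks (l := [])
    (lams fun (A P h : Exp) =>
      let S := sigmaOf A P
      let core p := J (fun x y _ => pi (P x) fun u => pi (P y) fun v =>
          idT S (pair x u) (pair y v)) p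
        fun x => lams fun (u v : Exp) => apT S (fun u => pair x u) (fst (h x u v))
      let f := lams fun (z z' p : Exp) =>
        app (app (sigmaRec (fun z => pi S fun z' => arrow (path (fst z) (fst z')) (path z z')) z
          fun x u => lam fun z' =>
            sigmaRec (fun z' => arrow (path x (fst z')) (idT S (pair x u) z')) z'
              fun _ v => lam fun p => core p u v) z') p
      let f' := ann f (pis S fun z z' => arrow (path (fst z) (fst z')) (path z z'))
      let comp z z' p := path (ap fst (f' z z' p)) p
      pair f <| pair
        (lam fun z => sigmaRec (fun z => path (f' z z rfl') (refl z)) z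
          -- Path types of a proposition are contractible, so the centre of `u = u` equals `refl u`.
          fun x u => apT (idT S (pair x u) (pair x u)) (fun q => apT S (fun u => pair x u) q)
            (snd (h x u u) (refl u)))
        (lams fun (z z' p : Exp) =>
          app (app (sigmaRec (fun z => pi S fun z' => pi (path (fst z) (fst z')) fun p =>
              comp z z' p) z
            fun x u => lam fun z' =>
              sigmaRec (fun z' => pi (path x (fst z')) fun p =>
                comp (ann (pair x u) S) z' p) z'
              fun y v => lam fun p => app (app (J (fun x y p => pi (P x) fun u => pi (P y) fun v =>
                  comp (ann (pair x u) S) (ann (pair y v) S) p) p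
                fun x => lams fun (u v : Exp) =>
                  J (fun u v q => path (ap fst (apT S (fun u => pair x u) q)) (refl x))
                    (fst (h x u v)) fun _ => rfl') u) v) z') p))
    (by decide +kernel) trivial

noncomputable def stSubtypeEq : Exp :=
  pi (U 2) fun A => pi (arrow A (U 1)) fun P => arrow (propFam A P) <|
    pis (sigmaOf A P) fun z z' =>
    sigma (arrow (path (fst z) (fst z')) (path z z')) fun f =>
    sigma (pi (path z z') fun q => path (f (ap fst q)) q) fun _ =>
    pi (path (fst z) (fst z')) fun p => path (ap fst (f p)) p

/-- Paths in a subtype are paths between the first components. -/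
theorem inh_subtypeEq : Inh stSubtypeEq :=
  .of_checks (l := [stSubtypePath])
    (let sp := v 0
    lams fun (A P h z z' : Exp) => split (sp A P h) fun f w => split w fun k l =>
      pair (f z z') <| pair
        (lam fun q => J (fun z z' q => path (f z z' (ap fst q)) q) q fun z => k z)
        (l z z'))
    (by decide +kernel) inh_subtypePath

/-- The dimension is positive because a mere point of `A` need not satisfy `P`. After one looping,
the predicate no longer obstructs anything. -/
noncomputable def stSubtypeLoop : Exp :=
  pi nat fun m => pi (U 2) fun A => pi (arrow A (U 1)) fun P => arrow (propFam A P) <|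
    pi (sigmaOf A P) fun z => pi (loops 2 (succ m) A (fst z)) fun q =>
      loopLift (succ m) A (fst z) (sigmaOf A P) z q

/-- Loops lift to subtypes. -/
theorem inh_subtypeLoop : Inh stSubtypeLoop :=
  .of_checks (l := [stSubtypePath, stLoopPt])
    (let sp := v 0
    let loopPt := v 1
    lams fun (m A P h z q : Exp) => split (sp A P h) fun f w => split w fun k l =>
      loopPt m (path (fst z) (fst z)) (path z z) (refl (fst z)) (refl z)
        (f z z) (lam fun q => ap fst q) (l z z) (k z) q)
    (by decide +kernel) ⟨inh_subtypePath, inh_loopPt⟩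

/-! ### The universe of `k`-types -/

noncomputable def typesU (i : ℕ) (m : Exp) : Exp :=
  sigma (U i) fun A => trunc i (succ (succ m)) A

noncomputable def stTruncTruncU : Exp :=
  pi nat fun m => trunc 1 (succ (succ (succ m))) (typesU 0 m)

/-- A path between `m`-types is a retract of a path between the underlying types, which is a retract
of the type of equivalences. The latter is an `m`-type as soon as the codomain is. -/
theorem inh_truncTruncU : Inh stTruncTruncU :=
  .of_checks (l := [stTruncRet, stSubtypeEq, stTruncProp 0, stUaInv 0, stEquivTrunc, stTruncCumul])
    (let truncRet := v 0
    let subtypeEq := v 1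
    let truncProp := v 2
    let uaInv := v 3
    let equivTrunc := v 4
    let truncCumul := v 5
    lams fun (m z z' : Exp) =>
      let k := succ (succ m)
      let A := fst z
      let B := fst z'
      split (subtypeEq (U 0) (lam fun A => trunc 0 k A) (truncProp k) z z') fun f w =>
      split (uaInv A B) fun g w' =>
        truncRet k (path z z') (idT (U 0) A B) (lam fun p => ap fst p) f (fst w)
          (truncRet k (idT (U 0) A B) (equiv A B) (lam fun p => idtoeqv 0 A B p) g (snd w')
            (equivTrunc (succ m) A B (truncCumul k B (snd z')))))
    (by decide +kernel) ⟨inh_truncRet, inh_subtypeEq, inh_truncProp_zero, inh_uaInv_zero,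
      inh_equivTrunc, inh_truncCumul⟩

noncomputable def loopsSet (m : Exp) : Exp :=
  pi (U 1) fun A => pi A fun a => arrow (trunc 1 (succ (succ m)) A)
    (trunc 1 (succ (succ zero)) (loops 1 m A a))

noncomputable def stLoopsSet : Exp := pi nat loopsSet

theorem inh_loopsSet : Inh stLoopsSet :=
  .of_checks (l := [])
    (lam fun m => natRec loopsSet m
      (lams fun (_ _ t : Exp) => t)
      fun _ K => lams fun (_ a t : Exp) => K (path a a) (refl a) (t a a))
    (by decide +kernel) trivial

/-- The type of points of `V` with an `(m + 1)`-fold loop. -/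
noncomputable def loopSum (m V : Exp) : Exp := sigma V fun X => loops 1 (succ m) V X

noncomputable def stTruncLoopSum : Exp :=
  pi nat fun m => pi (U 1) fun V => arrow (trunc 1 (succ (succ (succ m))) V)
    (trunc 1 (succ (succ (succ m))) (loopSum m V))

/-- Each looping lowers the truncation level by one, so the (m+1)-fold loop spaces of an (m+1)-type
are sets, and in particular (m+1)-types. -/
theorem inh_truncLoopSum : Inh stTruncLoopSum :=
  .of_checks (l := [stTruncSigma, stSetTrunc, stLoopsSet])
    (let truncSigma := v 0
    let setTrunc := v 1
    let loopsSet := v 2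
    lams fun (m V t : Exp) =>
      truncSigma (succ (succ (succ m))) V (lam fun X => loops 1 (succ m) V X) t
        (lam fun X => setTrunc (succ m) (loops 1 (succ m) V X) (loopsSet (succ m) V X t)))
    (by decide +kernel) ⟨inh_truncSigma, inh_setTrunc, inh_loopsSet⟩

/-! ### Loops in function types -/

noncomputable def loopPi (m : Exp) : Exp :=
  pi (U 1) fun A => pi (arrow A (U 1)) fun B => pi (pi A fun x => B x) fun b =>
    pi (pi A fun x => loops 2 m (B x) (b x)) fun z =>
    sigma (loops 2 m (pi A fun x => B x) b) fun z' =>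
      arrow (path (base 2 m (pi A fun x => B x) b) z')
        (pi A fun x => path (base 2 m (B x) (b x)) (z x))

noncomputable def stLoopPi : Exp := pi nat loopPi

/-- Families of loops lift to loops of functions. -/
theorem inh_loopPi : Inh stLoopPi :=
  .of_checks (l := [stLoopPt, stFunext])
    (let loopPt := v 0
    let funext := v 1
    lam fun m => natRec loopPi m
      (lams fun (_ _ _ z : Exp) => pair z (lams fun (e x : Exp) => ap (fun k => k x) e))
      fun m K => lams fun (A B b z : Exp) =>
        -- The induction hypothesis, for the family of path types, gives a loop at the constant
        -- homotopy. Extensionality then carries homotopies to paths of functions and the constant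
        -- homotopy to `refl`.
        split (K A (lam fun x => path (b x) (b x)) (lam fun x => refl (b x)) z) fun z₁ f₁ =>
        split (funext A B b) fun ext w =>
        split (loopPt m (homotopy A b b) (path b b) (lam fun x => refl (b x)) (refl b)
          (ext b) (lam fun p => lam fun x => ap (fun k => k x) p) (snd w b) (fst w) z₁)
          fun z₂ f₂ => pair z₂ (lam fun e => f₁ (f₂ e)))
    (by decide +kernel) ⟨inh_loopPt, inh_funext⟩

end HoTT

namespace HoTT

open Exp

/-! ### Loops in sums of loop spaces -/

/-- The loops `p` at `X` that fix the point `q` of the family `loops 1 (m + 1) V`. -/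
noncomputable def fixed (m V X q : Exp) : Exp :=
  sigma (path X X) fun p => path (tr (fun X => loops 1 (succ m) V X) p q) q

noncomputable def setFam (m V : Exp) : Exp :=
  pi V fun X => trunc 1 (succ (succ zero)) (loops 1 (succ m) V X)

noncomputable def fixedLift (m : Exp) : Exp :=
  pi (U 1) fun V => arrow (setFam m V) <| pi V fun X => pi (loops 1 (succ m) V X) fun q =>
    let E := fixed m V X q
    let c := ann (pair (refl X) rfl') E
    sigma (loops 2 m E c) fun z =>
      arrow (path (base 2 m E c) z) (path (base 1 (succ m) V X) q)

noncomputable def stFixedLift : Exp := pi nat fixedLift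

/-- This is a case distinction on `m`; the induction hypothesis is not used. In dimension one, `q`
fixes itself under transport. Above that, the condition of being fixed is a proposition because the
fibres are sets, and the positive-dimensional loop lifts to the subtype it cuts out. -/
theorem inh_fixedLift : Inh stFixedLift :=
  .of_checks (l := [stRunit, stCancel, stLoopUp, stSubtypeLoop])
    (let runit := v 0
    let cancel := v 1
    let loopUp := v 2
    let subtypeLoop := v 3
    lam fun m => natRec fixedLift m
      (lams fun (V _ X q : Exp) =>
        -- Path induction gives `p · (p_* r) = r · p` for every loop `r`. At `p = r = q`, cancelling
        -- `q` on the left leaves `q_* q = q`.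
        let comm := app (J (fun X _ p => pi (path X X) fun r =>
            path (cat p (tr (fun X => path X X) p r)) (cat r p)) q
          fun X => lam fun r => sym (runit V X X r)) q
        pair (pair q (cancel V X X X q (tr (fun X => path X X) q q) q comm))
          (lam fun e => ap fst e))
      fun m _ => lams fun (V h X q : Exp) =>
        let F X := loops 1 (succ (succ m)) V X
        let P p := path (tr F p q) q
        -- The loop lies in `U 1` while its lift is sought in `U 2`, so it is first raised by one
        -- universe.
        split (loopUp (succ m) (path X X) (refl X) q) fun z₁ f₁ =>
        split (subtypeLoop m (path X X) (lam P) (lam fun p => h X (tr F p q) q)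
          (pair (refl X) rfl') z₁) fun z₂ f₂ => pair z₂ (lam fun e => f₁ (f₂ e)))
    (by decide +kernel) ⟨inh_runit, inh_cancel, inh_loopUp, inh_subtypeLoop⟩

noncomputable def loopsAt (m V w : Exp) : Exp :=
  sigma (loops 2 m (path w w) (refl w)) fun z =>
    arrow (path (base 2 m (path w w) (refl w)) z)
      (path (base 1 (succ m) V (fst w)) (snd w))

noncomputable def stLoopsAt : Exp :=
  pi nat fun m => pi (U 1) fun V => arrow (setFam m V) <| pi (loopSum m V) fun w => loopsAt m V w

/-- Loops of pairs of paths lift to loops of paths between pairs. -/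
noncomputable def stLoopPair : Exp :=
  pi nat fun m => pi (U 1) fun V => pi (arrow V (U 1)) fun F => pi V fun X => pi (F X) fun q =>
    let E := sigma (path X X) fun p => path (tr (fun X => F X) p q) q
    let c := ann (pair (refl X) rfl') E
    let w := ann (pair X q) (sigmaOf V F)
    pi (loops 2 m E c) fun z => sigma (loops 2 m (path w w) (refl w)) fun z' =>
      arrow (path (base 2 m (path w w) (refl w)) z') (path (base 2 m E c) z)

/-- The source is the type of pairs of paths from `w` to itself, a retract of `w = w` by the
description of paths in sums, with the trivial pair sent to `refl w`. -/
theorem inh_loopPair : Inh stLoopPair :=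
  .of_checks (l := [stSigmaEq, stLoopPt])
    (let sigmaEq := v 0
    let loopPt := v 1
    lams fun (m V F X q z : Exp) =>
      let w := ann (pair X q) (sigmaOf V F)
      split (sigmaEq V (lam fun X => F X) w w) fun g k =>
      loopPt m (sigma (path X X) fun p => path (tr (fun X => F X) p q) q) (path w w)
        (pair (refl X) rfl') (refl w) g (lam fun p => toPairEq F p) (snd k) (fst k (refl w)) z)
    (by decide +kernel) ⟨inh_sigmaEq, inh_loopPt⟩

/-- A point `(X, q)` of `loopSum m V` has an `(m + 1)`-fold loop that comes from `q`. -/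
theorem inh_loopsAt : Inh stLoopsAt :=
  .of_checks (l := [stFixedLift, stLoopPair])
    (let fixedLift := v 0
    let loopPair := v 1
    lams fun (m V h w : Exp) => sigmaRec (fun w => loopsAt m V w) w fun X q =>
      split (fixedLift m V h X q) fun z f =>
      split (loopPair m V (lam fun X => loops 1 (succ m) V X) X q z) fun z' f' =>
        pair z' (lam fun e => f (f' e)))
    (by decide +kernel) ⟨inh_fixedLift, inh_loopPair⟩

noncomputable def stLoopU : Exp :=
  pi nat fun m => pi (U 1) fun L => pi (pi L fun w => loops 2 m (path w w) (refl w)) fun t =>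
    sigma (loops 2 (succ m) (idT (U 1) L L) (refl L)) fun z =>
      arrow (path (base 2 (succ m) (idT (U 1) L L) (refl L)) z)
        (pi L fun w => path (base 2 m (path w w) (refl w)) (t w))

/-- Families of loops at the points of `L` lift to loops at `L` in the universe. -/
theorem inh_loopU : Inh stLoopU :=
  .of_checks (l := [stLoopPi, stLoopPt, stFunext, stSubtypeLoop, stEquivProp, stUaInv 1])
    (let loopPi := v 0
    let loopPt := v 1
    let funext := v 2
    let subtypeLoop := v 3
    let equivProp := v 4
    let uaInv := v 5
    lams fun (m L t : Exp) =>
      -- The loop travels from the product of the types `w = w` to `i = i` in `L → L` by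
      -- extensionality, then to the identity equivalence as a loop in a subtype, and finally to `L
      -- = L` by univalence. The functions `f₁, …, f₄` carry a proof of triviality back along this
      -- chain.
      let i := ann (lam fun x => x) (arrow L L)
      let c := lam fun w => refl w
      split (loopPi m L (lam fun w => path w w) c t) fun z₁ f₁ =>
      split (funext L (lam fun _ => L) i) fun ext w =>
      split (loopPt m (homotopy L i i) (path i i) c (refl i)
        (ext i) (lam fun p => lam fun x => ap (fun k => k x) p) (snd w i) (fst w) z₁) fun z₂ f₂ =>
      split (subtypeLoop m (arrow L L) (lam fun f => isEquiv L L f) (equivProp L L)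
        (idEquiv 1 L) z₂) fun z₃ f₃ =>
      split (uaInv L L) fun g k =>
      split (loopPt (succ m) (equiv L L) (idT (U 1) L L) (idEquiv 1 L) (refl L) g
        (lam fun p => idtoeqv 1 L L p) (fst k) (snd k (refl L)) z₃) fun z₄ f₄ =>
        pair z₄ (lam fun e => f₁ (f₂ (f₃ (f₄ e)))))
    (by decide +kernel) ⟨inh_loopPi, inh_loopPt, inh_funext, inh_subtypeLoop, inh_equivProp,
      inh_uaInv_one⟩

/-- A nontrivial `m`-fold loop of `A` at `a`. -/
noncomputable def nontrivial (i : ℕ) (m A a : Exp) : Exp :=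
  sigma (loops i m A a) fun z => neg (path (base i m A a) z)

noncomputable def stLoopSumU : Exp :=
  pi nat fun m => pi (U 1) fun V => arrow (trunc 1 (succ (succ (succ m))) V) <|
    pi V fun X => arrow (nontrivial 1 (succ m) V X) <|
      nontrivial 2 (succ m) (idT (U 1) (loopSum m V) (loopSum m V)) (refl (loopSum m V))

/-- The family that assigns to `w` the loop coming from its second component gives a loop at `L`. A
proof that this loop is trivial yields triviality at every point, in particular at `(X, q)`,
contradicting the choice of `q`. -/
theorem inh_loopSumU : Inh stLoopSumU :=
  .of_checks (l := [stLoopU, stLoopsAt, stLoopsSet])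
    (let loopU := v 0
    let loopsAt := v 1
    let loopsSet := v 2
    lams fun (m V t X q : Exp) => split q fun q hq =>
      let L := loopSum m V
      let h := lam fun X => loopsSet (succ m) V X t
      split (loopU m L (lam fun w => fst (loopsAt m V h w))) fun z f =>
        pair z (lam fun e => hq (snd (loopsAt m V h (pair X q)) (f e (pair X q)))))
    (by decide +kernel) ⟨inh_loopU, inh_loopsAt, inh_loopsSet⟩

noncomputable def stLoopTypesU : Exp :=
  pi nat fun m => pi (U 1) fun L => arrow (nontrivial 2 (succ m) (idT (U 1) L L) (refl L)) <|
    pi (trunc 1 (succ (succ (succ m))) L) fun h =>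
      nontrivial 2 (succ (succ m)) (typesU 1 (succ m)) (ann (pair L h) (typesU 1 (succ m)))

theorem inh_loopTypesU : Inh stLoopTypesU :=
  .of_checks (l := [stSubtypeLoop, stTruncProp 1])
    (let subtypeLoop := v 0
    let truncProp := v 1
    lams fun (m L q h : Exp) => split q fun q hq =>
      let k := succ (succ (succ m))
      split (subtypeLoop (succ m) (U 1) (lam fun A => trunc 1 k A) (truncProp k) (pair L h) q)
        fun z f => pair z (lam fun e => hq (f e)))
    (by decide +kernel) ⟨inh_subtypeLoop, inh_truncProp_one⟩

/-! ### The types of loops in the universes -/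

noncomputable def loopTy (m : Exp) : Exp := loopSum m (typesU 0 m)

noncomputable def stTruncLoopTy : Exp :=
  pi nat fun m => trunc 1 (succ (succ (succ m))) (loopTy m)

theorem inh_truncLoopTy : Inh stTruncLoopTy :=
  .of_checks (l := [stTruncLoopSum, stTruncTruncU])
    (lam fun m => (v 0) m (typesU 0 m) ((v 1) m))
    (by decide +kernel) ⟨inh_truncLoopSum, inh_truncTruncU⟩

noncomputable def stLoopTyU : Exp :=
  pi nat fun m => pi (typesU 0 m) fun X => arrow (nontrivial 1 (succ m) (typesU 0 m) X) <|
    nontrivial 2 (succ (succ m)) (U 1) (loopTy m)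

theorem inh_loopTyU : Inh stLoopTyU :=
  .of_checks (l := [stLoopSumU, stTruncTruncU])
    (lam fun m => (v 0) m (typesU 0 m) ((v 1) m))
    (by decide +kernel) ⟨inh_loopSumU, inh_truncTruncU⟩

noncomputable def stLoopTyTypesU : Exp :=
  pi nat fun m => pi (typesU 0 m) fun X => arrow (nontrivial 1 (succ m) (typesU 0 m) X) <|
    pi (trunc 1 (succ (succ (succ m))) (loopTy m)) fun h =>
      nontrivial 2 (succ (succ m)) (typesU 1 (succ m))
        (ann (pair (loopTy m) h) (typesU 1 (succ m)))

theorem inh_loopTyTypesU : Inh stLoopTyTypesU :=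
  .of_checks (l := [stLoopTypesU, stLoopTyU])
    (lams fun (m X q h : Exp) => (v 0) m (loopTy m) ((v 1) m X q) h)
    (by decide +kernel) ⟨inh_loopTypesU, inh_loopTyU⟩

/-! ### The type with two elements -/

noncomputable def two : Exp := sum unit unit

noncomputable def tt : Exp := ann (inl star) two

noncomputable def code (x y : Exp) : Exp :=
  sumRec (fun _ => U 0) x (fun _ => sumRec (fun _ => U 0) y (fun _ => unit) fun _ => empty)
    fun _ => sumRec (fun _ => U 0) y (fun _ => empty) fun _ => unit

noncomputable def encode (p : Exp) : Exp :=
  J (fun x y _ => code x y) p fun x => sumRec (fun x => code x x) x (fun _ => star) fun _ => star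

noncomputable def stTruncTwo : Exp := trunc 1 (succ (succ zero)) two

/-- By encoding and decoding, the path types are retracts of the types `code x y`. These are `1` or
`0` on constructors, hence propositions. -/
theorem inh_truncTwo : Inh stTruncTwo :=
  .of_checks (l := [stTruncRet, stTruncUp])
    (let truncRet := v 0
    let truncUp := v 1
    let L u := ann (inl u) two
    let R u := ann (inr u) two
    let decode := ann (lams fun (x y : Exp) =>
      app (sumRec (fun x => pi two fun y => arrow (code x y) (path x y)) x
        (fun u => lam fun y => sumRec (fun y => arrow (code (L u) y) (path (L u) y)) y
          (fun u' => lam fun _ => unitRec (fun u => path (L u) (L u')) u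
            (unitRec (fun u' => path (L star) (L u')) u' rfl'))
          (fun _ => lam fun c => absurd c))
        (fun u => lam fun y => sumRec (fun y => arrow (code (R u) y) (path (R u) y)) y
          (fun _ => lam fun c => absurd c)
          (fun u' => lam fun _ => unitRec (fun u => path (R u) (R u')) u
            (unitRec (fun u' => path (R star) (R u')) u' rfl')))) y)
      (pis two fun x y => arrow (code x y) (path x y))
    let T x := trunc 1 (succ zero) x
    let unitProp := truncUp zero unit
      (pair star (lam fun x => unitRec (fun x => path star x) x rfl'))
    lams fun (x y : Exp) => truncRet (succ zero) (path x y) (code x y) (lam fun p => encode p)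
      (decode x y)
      (lam fun p => J (fun x y p => path (decode x y (encode p)) p) p fun x =>
        sumRec (fun x => path (decode x x (encode (refl x))) (refl x)) x
          (fun u => unitRec (fun u => path (decode (L u) (L u) (encode (refl (L u)))) (refl (L u))) u
            rfl')
          (fun u => unitRec (fun u => path (decode (R u) (R u) (encode (refl (R u)))) (refl (R u))) u
            rfl'))
      (app (sumRec (fun x => pi two fun y => T (code x y)) x
        (fun u => lam fun y => sumRec (fun y => T (code (L u) y)) y
          (fun _ => unitProp) (fun _ => lam fun c => absurd c))
        (fun u => lam fun y => sumRec (fun y => T (code (R u) y)) y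
          (fun _ => lam fun c => absurd c) (fun _ => unitProp))) y))
    (by decide +kernel) ⟨inh_truncRet, inh_truncUp⟩

noncomputable def swap (x : Exp) : Exp := sumRec (fun _ => two) x (fun u => inr u) fun u => inl u

noncomputable def stSwapEquiv : Exp := isEquiv two two (lamT two swap)

/-- The swap is its own inverse. Since `2` is a set, a fibre is a subtype of `2`, so two of its
points agree when their first components do. -/
theorem inh_swapEquiv : Inh stSwapEquiv :=
  .of_checks (l := [stTruncTwo, stSubtypeEq])
    (let truncTwo := v 0
    let subtypeEq := v 1
    let inv x := sumRec (fun x => path (swap (swap x)) x) x (fun _ => rfl') fun _ => rfl'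
    lam fun b => pair (pair (swap b) (inv b)) <| lam fun w =>
      fst (subtypeEq two (lam fun a => path (swap a) b) (lam fun a => truncTwo (swap a) b)
        (pair (swap b) (inv b)) w) (cat (sym (ap swap (snd w))) (inv (fst w))))
    (by decide +kernel) ⟨inh_truncTwo, inh_subtypeEq⟩

noncomputable def stTwoU : Exp := nontrivial 1 (succ zero) (U 0) two

/-- The loop is the image of the swap under univalence. If it were `refl`, then the swap would equal
the identity equivalence, and evaluating at `tt` would give a path between the two elements, which
`encode` sends into `0`. -/
theorem inh_twoU : Inh stTwoU :=
  .of_checks (l := [stUaInv 0, stSwapEquiv])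
    (let uaInv := v 0
    let s := ann (pair (lam swap) (v 1)) (equiv two two)
    let z := fst (uaInv two two) s
    pair z <| lam fun e =>
      encode (ap (fun e => fst e tt)
        (cat (ap (fun p => idtoeqv 0 two two p) e) (fst (snd (uaInv two two)) s))))
    (by decide +kernel) ⟨inh_uaInv_zero, inh_swapEquiv⟩

noncomputable def stTwoTypesU : Exp :=
  pi (trunc 0 (succ (succ zero)) two) fun h =>
    nontrivial 1 (succ zero) (typesU 0 zero) (ann (pair two h) (typesU 0 zero))

/-- The base case lives one universe below the general lifting to subtypes, and a single loop needs
only the description of one path type. -/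
theorem inh_twoTypesU : Inh stTwoTypesU :=
  .of_checks (l := [stTwoU, stSubtypeEq, stTruncProp 0])
    (let subtypeEq := v 1
    let truncProp := v 2
    let k := succ (succ zero)
    lam fun h => split (v 0) fun q hq =>
      split (subtypeEq (U 0) (lam fun A => trunc 0 k A) (truncProp k) (pair two h) (pair two h))
        fun f w => pair (f q) (lam fun e => hq (cat (ap (fun p => ap fst p) e) (snd w q))))
    (by decide +kernel) ⟨inh_twoU, inh_subtypeEq, inh_truncProp_zero⟩

end HoTT

/-! ### Passage from internal to external natural numbers and to all universes. -/

namespace HoTT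

open Tm Judgment

/-! ### Types of truncatedness and loop spaces, by induction on a term of type `ℕ` -/

namespace Tm

/-- `isTrunc m A` for a term `m` of type `ℕ` and a type `A` in `U_i`. -/
def truncInd (i : ℕ) (m A : Tm) : Tm :=
  app (natInd (pi (U i) (U i)) (lam (U i) (isContr (var 0)))
    (lam (U i) (pi (var 0) (pi (var 1) (app (var 3) (id (var 2) (var 1) (var 0)))))) m) A

/-- This is the raw counterpart of `Exp.loops`. Unlike an elaborated expression, it commutes with
substitution and with the shift of levels by mere computation. -/
def loopsInd (i : ℕ) (m A a : Tm) : Tm :=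
  app (app (natInd (pi (U i) (pi (var 0) (U i))) (lam (U i) (lam (var 0) (var 1)))
    (lam (U i) (lam (var 0) (app (app (var 2) (id (var 1) (var 0) (var 0))) (refl (var 0))))) m) A) a

def baseInd (i : ℕ) (m A a : Tm) : Tm :=
  app (app (natInd (pi (U i) (pi (var 0) (loopsInd i (var 2) (var 1) (var 0))))
    (lam (U i) (lam (var 0) (var 0)))
    (lam (U i) (lam (var 0) (app (app (var 2) (id (var 1) (var 0) (var 0))) (refl (var 0))))) m) A) a

/-- The type of nontrivial inhabitants of `(A, a)`. -/
def nontriv (A a : Tm) : Tm := sigma A (neg (id (lift 1 A) (lift 1 a) (var 0)))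

def nontrivInd (i : ℕ) (m A a : Tm) : Tm := nontriv (loopsInd i m A a) (baseInd i m A a)

/-- The type of `m`-types in `U_i`. -/
def typesInd (i : ℕ) (m : Tm) : Tm := sigma (U i) (truncInd i (succ (succ (lift 1 m))) (var 0))

def loopTypeInd (i : ℕ) (m : Tm) : Tm :=
  sigma (typesInd i m) (loopsInd (i + 1) (succ (lift 1 m)) (lift 1 (typesInd i m)) (var 0))

/-- Numerals. -/
def num : ℕ → Tm
  | 0 => zero
  | k + 1 => succ (num k)

variable (σ : ℕ → Tm) (i k : ℕ) (m A a : Tm)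

theorem subst_num : subst σ (num k) = num k := by
  induction k with
  | zero => rfl
  | succ k ih => exact congrArg succ ih

theorem lift_num (j : ℕ) : lift j (num k) = num k := by rw [lift_eq_subst, subst_num]

theorem subst_truncInd : subst σ (truncInd i m A) = truncInd i (subst σ m) (subst σ A) := rfl

theorem subst_loopsInd :
    subst σ (loopsInd i m A a) = loopsInd i (subst σ m) (subst σ A) (subst σ a) := rfl

theorem subst_nontriv : subst σ (nontriv A a) = nontriv (subst σ A) (subst σ a) := by
  simp only [nontriv, neg, arrow, subst, subst_lift_one]; rfl

theorem subst_nontrivInd :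
    subst σ (nontrivInd i m A a) = nontrivInd i (subst σ m) (subst σ A) (subst σ a) :=
  subst_nontriv ..

theorem subst_typesInd : subst σ (typesInd i m) = typesInd i (subst σ m) := by
  simp only [typesInd, subst, subst_truncInd, subst_lift_one]; rfl

theorem subst_loopTypeInd : subst σ (loopTypeInd i m) = loopTypeInd i (subst σ m) := by
  simp only [loopTypeInd, subst, subst_loopsInd, subst_lift_one, subst_typesInd]; rfl

end Tm

/-! ### Judgments checked by the normalizer -/

/-- `t` has the normal form `u` and the type `T`. -/
noncomputable def nfIs (Γ : Ctx) (t u T : Tm) : Bool :=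
  match nf Γ t none with
  | some s => and (beq s.1 u) (beq s.2 T)
  | none => false

/-- Unfolding equations are evaluated once, for variables in the lowest universe. Shifting the
levels and substituting for the variables gives all instances. -/
theorem EqD.of_nfIs {Γ : Ctx} {t u T : Tm} (hΓ : Der (Judgment.ctx Γ)) (h : nfIs Γ t u T = true) :
    EqD Γ t u T := by
  unfold nfIs at h
  split at h
  · rename_i s hs
    rw [Bool.and_eq_true] at h
    have := (nf_sound _ _ _ _ hΓ (fun _ h => by cases h) hs).1
    rwa [eq_of_beq h.1, eq_of_beq h.2] at this
  · cases h

/-- The closed types that `s` and `T` stand for have the same normal form. -/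
noncomputable def tyIs (s : Exp) (T : Tm) : Bool :=
  match s.ty [], nf.ty [] T with
  | some A, some B => beq A.1 B.1
  | _, _ => false

theorem EqD.subst {Γ Δ : Ctx} {σ : ℕ → Tm} {t u T : Tm} (h : EqD Γ t u T) (hΔ : Der (Judgment.ctx Δ))
    (hσ : IsSub Δ σ Γ) : EqD Δ (Tm.subst σ t) (Tm.subst σ u) (Tm.subst σ T) :=
  ⟨h.tm.subst_tm hΔ hσ, h.eq.subst_eq hΔ hσ, _, h.ty.choose_spec.subst_tm hΔ hσ⟩

theorem EqD.weaken {Γ : Ctx} {t u T B : Tm} (h : EqD Γ t u T) (hB : Der (Judgment.ctx (B :: Γ))) :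
    EqD (B :: Γ) (lift 1 t) (lift 1 u) (lift 1 T) :=
  ⟨h.tm.weaken hB, h.eq.weaken_eq hB, _, h.ty.choose_spec.weaken hB⟩

theorem EqD.shift {Γ : Ctx} {t u T : Tm} (k : ℕ) (h : EqD Γ t u T) :
    EqD (Γ.map (Tm.shift k)) (Tm.shift k t) (Tm.shift k u) (Tm.shift k T) :=
  ⟨h.tm.shift k, h.eq.shift k, _, h.ty.choose_spec.shift k⟩

theorem isSub_nil (Γ : Ctx) (σ : ℕ → Tm) : IsSub Γ σ [] := by
  intro k A hk
  simp at hk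

variable {Γ : Ctx} {i : ℕ} {A a m : Tm}

theorem isSub_ty (hA : Der (tm Γ A (U i))) : IsSub Γ (Tm.cons A Tm.var) [U i] :=
  (isSub_nil Γ _).cons hA

theorem isSub_pt (hA : Der (tm Γ A (U i))) (ha : Der (tm Γ a A)) :
    IsSub Γ (Tm.cons a (Tm.cons A Tm.var)) [Tm.var 0, U i] :=
  (isSub_ty hA).cons ha

theorem isSub_nat_ty (hm : Der (tm Γ m Tm.nat)) (hA : Der (tm Γ A (U i))) :
    IsSub Γ (Tm.cons A (Tm.cons m Tm.var)) [U i, Tm.nat] :=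
  ((isSub_nil Γ Tm.var).cons hm).cons hA

theorem isSub_nat_pt (hm : Der (tm Γ m Tm.nat)) (hA : Der (tm Γ A (U i))) (ha : Der (tm Γ a A)) :
    IsSub Γ (Tm.cons a (Tm.cons A (Tm.cons m Tm.var))) [Tm.var 0, U i, Tm.nat] :=
  (isSub_nat_ty hm hA).cons ha

theorem der_ctx_ty (Γ : Ctx) (h : Der (ctx Γ)) : Der (ctx (Tm.var 0 :: U 0 :: Γ)) :=
  .ctx_cons (i := 0) (.var (A := U 0) (.ctx_cons (.U_intro h)) rfl)

theorem der_ctx_nat : Der (ctx [Tm.nat]) := .ctx_cons (i := 0) (.nat_form .ctx_nil)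

theorem truncInd_form (hm : Der (tm Γ m Tm.nat)) (hA : Der (tm Γ A (U i))) :
    Der (tm Γ (truncInd i m A) (U i)) := by
  have := EqD.of_nfIs (Γ := [U 0, Tm.nat]) (t := truncInd 0 (Tm.var 1) (Tm.var 0))
    (u := truncInd 0 (Tm.var 1) (Tm.var 0)) (T := U 0) (.ctx_cons (.U_intro der_ctx_nat))
    (by decide +kernel)
  exact ((this.shift i).subst hA.ctx_of_tm (isSub_nat_ty hm hA)).tm

theorem loopsInd_form (hm : Der (tm Γ m Tm.nat)) (hA : Der (tm Γ A (U i))) (ha : Der (tm Γ a A)) :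
    Der (tm Γ (loopsInd i m A a) (U i)) := by
  have := EqD.of_nfIs (Γ := [Tm.var 0, U 0, Tm.nat]) (t := loopsInd 0 (Tm.var 2) (Tm.var 1) (Tm.var 0))
    (u := loopsInd 0 (Tm.var 2) (Tm.var 1) (Tm.var 0)) (T := U 0) (der_ctx_ty _ der_ctx_nat)
    (by decide +kernel)
  exact ((this.shift i).subst hA.ctx_of_tm (isSub_nat_pt hm hA ha)).tm

theorem truncInd_zero (hA : Der (tm Γ A (U i))) :
    EqD Γ (truncInd i Tm.zero A) (isContr A) (U i) := by
  have := EqD.of_nfIs (Γ := [U 0]) (t := truncInd 0 Tm.zero (Tm.var 0))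
    (u := isContr (Tm.var 0)) (T := U 0) (.ctx_cons (.U_intro .ctx_nil)) (by decide +kernel)
  have := (this.shift i).subst hA.ctx_of_tm (isSub_ty hA)
  rw [isContr, ← lift_lift 1 1 A]
  exact this

theorem truncInd_succ (hm : Der (tm Γ m Tm.nat)) (hA : Der (tm Γ A (U i))) :
    EqD Γ (truncInd i (Tm.succ m) A)
      (Tm.pi A (Tm.pi (lift 1 A)
        (truncInd i (lift 2 m) (Tm.id (lift 2 A) (Tm.var 1) (Tm.var 0))))) (U i) := by
  have := EqD.of_nfIs (Γ := [U 0, Tm.nat]) (t := truncInd 0 (Tm.succ (Tm.var 1)) (Tm.var 0))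
    (u := Tm.pi (Tm.var 0) (Tm.pi (Tm.var 1)
      (truncInd 0 (Tm.var 3) (Tm.id (Tm.var 2) (Tm.var 1) (Tm.var 0))))) (T := U 0)
    (.ctx_cons (.U_intro der_ctx_nat)) (by decide +kernel)
  have := (this.shift i).subst hA.ctx_of_tm (isSub_nat_ty hm hA)
  rw [← lift_lift 1 1 A, ← lift_lift 1 1 m]
  exact this

theorem loopsInd_zero (hA : Der (tm Γ A (U i))) (ha : Der (tm Γ a A)) :
    EqD Γ (loopsInd i Tm.zero A a) A (U i) := by
  have := EqD.of_nfIs (Γ := [Tm.var 0, U 0]) (t := loopsInd 0 Tm.zero (Tm.var 1) (Tm.var 0)) (u := Tm.var 1)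
    (T := U 0) (der_ctx_ty _ .ctx_nil) (by decide +kernel)
  exact (this.shift i).subst hA.ctx_of_tm (isSub_pt hA ha)

theorem baseInd_zero (hA : Der (tm Γ A (U i))) (ha : Der (tm Γ a A)) :
    EqD Γ (baseInd i Tm.zero A a) a A := by
  have := EqD.of_nfIs (Γ := [Tm.var 0, U 0]) (t := baseInd 0 Tm.zero (Tm.var 1) (Tm.var 0)) (u := Tm.var 0)
    (T := Tm.var 1) (der_ctx_ty _ .ctx_nil) (by decide +kernel)
  exact (this.shift i).subst hA.ctx_of_tm (isSub_pt hA ha)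

theorem loopsInd_succ (hm : Der (tm Γ m Tm.nat)) (hA : Der (tm Γ A (U i))) (ha : Der (tm Γ a A)) :
    EqD Γ (loopsInd i (Tm.succ m) A a) (loopsInd i m (Tm.id A a a) (Tm.refl a)) (U i) := by
  have := EqD.of_nfIs (Γ := [Tm.var 0, U 0, Tm.nat]) (t := loopsInd 0 (Tm.succ (Tm.var 2)) (Tm.var 1) (Tm.var 0))
    (u := loopsInd 0 (Tm.var 2) (Tm.id (Tm.var 1) (Tm.var 0) (Tm.var 0)) (Tm.refl (Tm.var 0)))
    (T := U 0) (der_ctx_ty _ der_ctx_nat) (by decide +kernel)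
  exact (this.shift i).subst hA.ctx_of_tm (isSub_nat_pt hm hA ha)

theorem baseInd_succ (hm : Der (tm Γ m Tm.nat)) (hA : Der (tm Γ A (U i))) (ha : Der (tm Γ a A)) :
    EqD Γ (baseInd i (Tm.succ m) A a) (baseInd i m (Tm.id A a a) (Tm.refl a))
      (loopsInd i m (Tm.id A a a) (Tm.refl a)) := by
  have := EqD.of_nfIs (Γ := [Tm.var 0, U 0, Tm.nat]) (t := baseInd 0 (Tm.succ (Tm.var 2)) (Tm.var 1) (Tm.var 0))
    (u := baseInd 0 (Tm.var 2) (Tm.id (Tm.var 1) (Tm.var 0) (Tm.var 0)) (Tm.refl (Tm.var 0)))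
    (T := loopsInd 0 (Tm.var 2) (Tm.id (Tm.var 1) (Tm.var 0) (Tm.var 0)) (Tm.refl (Tm.var 0)))
    (der_ctx_ty _ der_ctx_nat) (by decide +kernel)
  exact (this.shift i).subst hA.ctx_of_tm (isSub_nat_pt hm hA ha)

/-! ### Numerals -/

theorem num_form (hΓ : Der (ctx Γ)) (k : ℕ) : Der (tm Γ (num k) Tm.nat) := by
  induction k with
  | zero => exact .nat_intro_zero hΓ
  | succ k ih => exact .nat_intro_succ ih

theorem der_two_vars (hA : Der (tm Γ A (U i))) :
    Der (tm (lift 1 A :: A :: Γ) (Tm.id (lift 2 A) (Tm.var 1) (Tm.var 0)) (U i)) := by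
  have h1 := hA.weaken (.ctx_cons hA)
  have h2 := h1.weaken (.ctx_cons h1)
  rw [lift_lift] at h2
  refine .id_form h2 (.var (.ctx_cons h1) rfl) ?_
  have := Der.var (k := 0) (.ctx_cons h1) rfl
  rwa [lift_lift] at this

/-- For a variable the internal recursion is stuck, but at a numeral it unfolds. This is a
judgmental equality, so no transport is needed to return to the external definition. -/
theorem truncInd_num (k : ℕ) (hA : Der (tm Γ A (U i))) :
    EqD Γ (truncInd i (num k) A) (isTrunc k A) (U i) := by
  induction k generalizing Γ A with
  | zero => exact truncInd_zero hA
  | succ k ih =>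
    refine (truncInd_succ (num_form hA.ctx_of_tm k) hA).trans ?_
    rw [lift_num]
    have h := (EqD.refl hA (.U_intro hA.ctx_of_tm)).pi
      ((EqD.refl (hA.weaken (.ctx_cons hA)) (.U_intro (.ctx_cons hA))).pi (ih (der_two_vars hA)))
    rwa [max_self, max_self] at h

theorem EqD.isTrunc {A' : Tm} (k : ℕ) (h : EqD Γ A A' (U i)) :
    EqD Γ (Tm.isTrunc k A) (Tm.isTrunc k A') (U i) := by
  induction k generalizing Γ A A' with
  | zero =>
    have hc := Der.ctx_cons h.tm
    have h1 := h.weaken hc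
    have hc' := Der.ctx_cons h1.tm
    have h2 := h1.weaken hc'
    rw [lift_lift, lift_lift] at h2
    have hv := der_two_vars h.tm
    obtain ⟨-, hx, hy⟩ := hv.inv_id
    have := h.sigma (h1.pi (h2.id (EqD.refl hx h2.tm) (EqD.refl hy h2.tm)))
    rwa [max_self, max_self] at this
  | succ k ih =>
    have hc := Der.ctx_cons h.tm
    have h1 := h.weaken hc
    have hc' := Der.ctx_cons h1.tm
    have h2 := h1.weaken hc'
    rw [lift_lift, lift_lift] at h2
    obtain ⟨-, hx, hy⟩ := (der_two_vars h.tm).inv_id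
    have := h.pi (h1.pi (ih (h2.id (EqD.refl hx h2.tm) (EqD.refl hy h2.tm))))
    rwa [max_self, max_self] at this

/-- The pointed type `Y` is well-formed, and `X` is equal to it. -/
structure PointedEq (Γ : Ctx) (i : ℕ) (X Y : Pointed) : Prop where
  carrier : EqD Γ X.carrier Y.carrier (U i)
  point : EqD Γ X.point Y.point Y.carrier

namespace PointedEq

variable {X Y Z : Pointed}

theorem refl (hA : Der (tm Γ A (U i))) (ha : Der (tm Γ a A)) : PointedEq Γ i ⟨A, a⟩ ⟨A, a⟩ :=
  ⟨.refl hA (.U_intro hA.ctx_of_tm), .refl ha hA⟩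

theorem trans (h : PointedEq Γ i X Y) (h' : PointedEq Γ i Y Z) : PointedEq Γ i X Z :=
  ⟨h.carrier.trans h'.carrier, (h.point.conv h'.carrier).trans h'.point⟩

theorem loop (h : PointedEq Γ i X Y) : PointedEq Γ i X.loop Y.loop :=
  ⟨h.carrier.id h.point h.point, h.point.reflexivity⟩

theorem iterLoop (k : ℕ) (h : PointedEq Γ i X Y) :
    PointedEq Γ i (X.iterLoop k) (Y.iterLoop k) := by
  induction k generalizing X Y with
  | zero => exact h
  | succ k ih => exact ih h.loop

theorem nontriv (h : PointedEq Γ i X Y) :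
    EqD Γ (Tm.nontriv X.carrier X.point) (Tm.nontriv Y.carrier Y.point) (U i) := by
  have hc := Der.ctx_cons h.carrier.tm
  have h1 := h.carrier.weaken hc
  have h2 := h1.id (h.point.weaken hc) (EqD.refl (.var hc rfl) h1.tm)
  have he := Der.empty_form (i := i) (.ctx_cons h2.tm)
  have := h.carrier.sigma (h2.pi (EqD.refl he (.U_intro (.ctx_cons h2.tm))))
  rwa [max_self, max_self] at this

end PointedEq

/-- Both recursions pass to the loop space first, as in `Ω^(k+1) = Ω^k ∘ Ω`, so the induction is
over all pointed types at once. -/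
theorem loopsInd_num (k : ℕ) (hA : Der (tm Γ A (U i))) (ha : Der (tm Γ a A)) :
    PointedEq Γ i ⟨loopsInd i (num k) A a, baseInd i (num k) A a⟩
      (Pointed.iterLoop k ⟨A, a⟩) := by
  induction k generalizing A a with
  | zero => exact ⟨loopsInd_zero hA ha, baseInd_zero hA ha⟩
  | succ k ih =>
    have hm := num_form hA.ctx_of_tm k
    have h := ih (.id_form hA ha ha) (.id_intro hA ha)
    exact ⟨(loopsInd_succ hm hA ha).trans h.carrier,
      ((baseInd_succ hm hA ha).conv h.carrier).trans h.point⟩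

end HoTT

namespace HoTT

open Tm Judgment

/-! ### Inhabited types in a context -/

/-- The type `T` is inhabited in the context `Γ`. -/
def HasTm (Γ : Ctx) (T : Tm) : Prop := ∃ t, Der (tm Γ t T)

/-- The type the front end elaborates to is compared with a raw type through their normal forms;
soundness of the normalizer turns the agreement into a conversion. -/
theorem Inh.hasTm {s : Exp} {T : Tm} (h : Inh s) (hT : tyIs s T = true) : HasTm [] T := by
  obtain ⟨A, t, hA, ht⟩ := h
  unfold tyIs at hT
  split at hT
  · rename_i A' B h1 h2
    rw [h1] at hA
    cases hA
    rw [eq_of_beq hT] at ht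
    exact ⟨t, .conv ht (nf_sound.ty .ctx_nil h2).eq.eq_symm⟩
  · cases hT

namespace HasTm

variable {Γ Δ : Ctx} {A B T : Tm} {i : ℕ}

theorem of_pi (h : HasTm Γ (pi A B)) (hc : Der (ctx (A :: Γ))) : HasTm (A :: Γ) B := by
  obtain ⟨t, ht⟩ := h
  refine ⟨app (lift 1 t) (Tm.var 0), ?_⟩
  have e : inst (rename (upRen fun j => j + 1) B) (Tm.var 0) = B := by
    rw [inst, subst_rename]
    refine (congrArg (Tm.subst · B) (funext fun k => ?_)).trans (subst_var B)
    cases k <;> rfl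
  have := (ht.weaken hc).pi_elim (.var hc rfl)
  rwa [e] at this

theorem subst {σ : ℕ → Tm} (h : HasTm Γ T) (hΔ : Der (ctx Δ)) (hσ : IsSub Δ σ Γ) :
    HasTm Δ (Tm.subst σ T) :=
  h.elim fun _ h => ⟨_, h.subst_tm hΔ hσ⟩

theorem shift (k : ℕ) (h : HasTm Γ T) : HasTm (Γ.map (Tm.shift k)) (Tm.shift k T) :=
  h.elim fun _ h => ⟨_, h.shift k⟩

theorem conv (h : HasTm Γ A) (hAB : EqD Γ A B (U i)) : HasTm Γ B :=
  h.elim fun _ h => ⟨_, .conv h hAB.eq⟩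

theorem conv_symm (h : HasTm Γ B) (hAB : EqD Γ A B (U i)) : HasTm Γ A :=
  h.elim fun _ h => ⟨_, .conv h hAB.eq.eq_symm⟩

end HasTm

variable {Γ : Ctx} {i j k : ℕ} {A B a m p X L : Tm}

theorem baseInd_form (hm : Der (tm Γ m Tm.nat)) (hA : Der (tm Γ A (U i))) (ha : Der (tm Γ a A)) :
    Der (tm Γ (baseInd i m A a) (loopsInd i m A a)) := by
  have := EqD.of_nfIs (Γ := [Tm.var 0, U 0, Tm.nat])
    (t := baseInd 0 (Tm.var 2) (Tm.var 1) (Tm.var 0))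
    (u := baseInd 0 (Tm.var 2) (Tm.var 1) (Tm.var 0))
    (T := loopsInd 0 (Tm.var 2) (Tm.var 1) (Tm.var 0)) (der_ctx_ty _ der_ctx_nat)
    (by decide +kernel)
  exact ((this.shift i).subst hA.ctx_of_tm (isSub_nat_pt hm hA ha)).tm

theorem nontriv_form (hA : Der (tm Γ A (U i))) (ha : Der (tm Γ a A)) :
    Der (tm Γ (nontriv A a) (U i)) :=
  (PointedEq.refl hA ha).nontriv.tm

theorem nontrivInd_form (hm : Der (tm Γ m Tm.nat)) (hA : Der (tm Γ A (U i)))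
    (ha : Der (tm Γ a A)) : Der (tm Γ (nontrivInd i m A a) (U i)) :=
  nontriv_form (loopsInd_form hm hA ha) (baseInd_form hm hA ha)

theorem der_ctx_U (hΓ : Der (ctx Γ)) : Der (ctx (U i :: Γ)) := .ctx_cons (.U_intro hΓ)

theorem typesInd_form (hm : Der (tm Γ m Tm.nat)) : Der (tm Γ (typesInd i m) (U (i + 1))) := by
  have hc := der_ctx_U (i := i) hm.ctx_of_tm
  exact .sigma_form (.U_intro hm.ctx_of_tm)
    (.U_cumul (truncInd_form (.nat_intro_succ (.nat_intro_succ (hm.weaken hc))) (.var (A := U i) hc rfl)))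

theorem loopTypeInd_form (hm : Der (tm Γ m Tm.nat)) :
    Der (tm Γ (loopTypeInd i m) (U (i + 1))) := by
  have hA := typesInd_form (i := i) hm
  have hc := Der.ctx_cons hA
  exact .sigma_form hA (loopsInd_form (.nat_intro_succ (hm.weaken hc)) (hA.weaken hc) (.var hc rfl))

/-! ### Closed pointed types -/

theorem HasNontrivialInhabitant.hasTm {X : Pointed} (hA : Der (tm [] X.carrier (U i)))
    (ha : Der (tm [] X.point X.carrier)) (h : HasNontrivialInhabitant X) :
    HasTm [] (nontriv X.carrier X.point) := by
  obtain ⟨b, r, hb, hr⟩ := h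
  obtain ⟨j, -, hB⟩ := (nontriv_form hA ha).inv_sigma
  refine ⟨pair b r, .sigma_intro hB hb ?_⟩
  have e : inst (neg (Tm.id (lift 1 X.carrier) (lift 1 X.point) (Tm.var 0))) b =
      neg (Tm.id X.carrier X.point b) := by
    simp only [inst, neg, arrow, subst, subst_lift_one]
    rw [subst_cons_lift, subst_cons_lift, subst_var, subst_var]
    rfl
  rwa [e]

/-- The components of the elements of `nontriv A a`. -/
theorem exists_components : ∃ f g,
    Der (tm [nontriv (Tm.var 1) (Tm.var 0), Tm.var 0, U 0] f (Tm.var 2)) ∧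
    Der (tm [nontriv (Tm.var 1) (Tm.var 0), Tm.var 0, U 0] g
      (neg (Tm.id (Tm.var 2) (Tm.var 1) f))) := by
  have hc := der_ctx_ty _ .ctx_nil
  have hA : Der (tm [Tm.var 0, U 0] (Tm.var 1) (U 0)) := .var (A := U 0) hc rfl
  have hc' := Der.ctx_cons (nontriv_form hA (.var (k := 0) hc rfl))
  have h : (match (Exp.fst (Exp.v 2)).inf [nontriv (Tm.var 1) (Tm.var 0), Tm.var 0, U 0],
      (Exp.snd (Exp.v 2)).inf [nontriv (Tm.var 1) (Tm.var 0), Tm.var 0, U 0] with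
    | some s, some t => and (beq s.2 (Tm.var 2)) (beq t.2 (neg (Tm.id (Tm.var 2) (Tm.var 1) s.1)))
    | _, _ => false) = true := by decide +kernel
  split at h
  · rename_i s t hs ht
    rw [Bool.and_eq_true] at h
    have h1 := (Exp.inf_sound hc' hs).tm
    have h2 := (Exp.inf_sound hc' ht).tm
    rw [eq_of_beq h.1] at h1
    rw [eq_of_beq h.2] at h2
    exact ⟨_, _, h1, h2⟩
  · cases h

theorem HasTm.hasNontrivialInhabitant {X : Pointed} (hA : Der (tm [] X.carrier (U i)))
    (ha : Der (tm [] X.point X.carrier)) (h : HasTm [] (nontriv X.carrier X.point)) :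
    HasNontrivialInhabitant X := by
  obtain ⟨f, g, hf, hg⟩ := exists_components
  obtain ⟨p, hp⟩ := h
  -- The projections are derived for variables in `U 0`. Raising levels by `i` and substituting the
  -- given type, point and inhabitant yields closed components.
  have hσ : IsSub [] (cons p (cons X.point (cons X.carrier Tm.var)))
      [nontriv (Tm.var 1) (Tm.var 0), Tm.var 0, U i] :=
    (isSub_pt hA ha).cons (by rwa [subst_nontriv])
  exact ⟨_, _, (hf.shift i).subst_tm .ctx_nil hσ, (hg.shift i).subst_tm .ctx_nil hσ⟩

/-! ### The inductive step, for terms of type `ℕ` -/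

/-- The internal theorem is a `Π` over `ℕ` in the lowest universes. It is shifted by `i`, opened to
a variable and instantiated at `m`; the next two statements arise in the same way. -/
theorem hasTm_truncInd_loopTypeInd (hm : Der (tm [] m Tm.nat)) :
    HasTm [] (truncInd (i + 1) (succ (succ (succ m))) (loopTypeInd i m)) := by
  have h := (inh_truncLoopTy.hasTm (T := pi Tm.nat
    (truncInd 1 (succ (succ (succ (Tm.var 0)))) (loopTypeInd 0 (Tm.var 0))))
    (by decide +kernel)).shift i
  have := (h.of_pi der_ctx_nat).subst .ctx_nil ((isSub_nil [] Tm.var).cons hm)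
  have e := subst_loopTypeInd (Tm.cons m Tm.var) i (Tm.var 0)
  exact e ▸ this

theorem der_ctx_types (i : ℕ) : Der (ctx [typesInd i (Tm.var 0), Tm.nat]) :=
  .ctx_cons (typesInd_form (.var (A := Tm.nat) der_ctx_nat rfl))

theorem der_ctx_nontriv (i : ℕ) : Der (ctx [nontrivInd (i + 1) (succ (Tm.var 1))
    (typesInd i (Tm.var 1)) (Tm.var 0), typesInd i (Tm.var 0), Tm.nat]) :=
  have hc := der_ctx_types i
  have hm : Der (tm _ (Tm.var 1) Tm.nat) := .var (A := Tm.nat) hc rfl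
  .ctx_cons (nontrivInd_form (.nat_intro_succ hm) (typesInd_form hm) (.var (k := 0) hc rfl))

theorem isSub_nontriv (hm : Der (tm [] m Tm.nat)) (hX : Der (tm [] X (typesInd i m)))
    (hp : Der (tm [] p (nontrivInd (i + 1) (succ m) (typesInd i m) X))) :
    IsSub [] (Tm.cons p (Tm.cons X (Tm.cons m Tm.var))) [nontrivInd (i + 1) (succ (Tm.var 1))
      (typesInd i (Tm.var 1)) (Tm.var 0), typesInd i (Tm.var 0), Tm.nat] := by
  refine (((isSub_nil [] Tm.var).cons hm).cons (by rwa [subst_typesInd])).cons ?_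
  rwa [subst_nontrivInd, subst_typesInd]

theorem hasTm_nontrivInd_U (hm : Der (tm [] m Tm.nat)) (hX : Der (tm [] X (typesInd i m)))
    (hp : HasTm [] (nontrivInd (i + 1) (succ m) (typesInd i m) X)) :
    HasTm [] (nontrivInd (i + 2) (succ (succ m)) (U (i + 1)) (loopTypeInd i m)) := by
  obtain ⟨p, hp⟩ := hp
  have h := (inh_loopTyU.hasTm (T := pi Tm.nat (pi (typesInd 0 (Tm.var 0))
    (pi (nontrivInd 1 (succ (Tm.var 1)) (typesInd 0 (Tm.var 1)) (Tm.var 0))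
      (nontrivInd 2 (succ (succ (Tm.var 2))) (U 1) (loopTypeInd 0 (Tm.var 2))))))
    (by decide +kernel)).shift i
  have := (((h.of_pi der_ctx_nat).of_pi (der_ctx_types i)).of_pi (der_ctx_nontriv i)).subst
    .ctx_nil (isSub_nontriv hm hX hp)
  have e := subst_nontrivInd (Tm.cons p (Tm.cons X (Tm.cons m Tm.var))) (i + 2)
    (succ (succ (Tm.var 2))) (U (i + 1)) (loopTypeInd i (Tm.var 2))
  rw [subst_loopTypeInd] at e
  exact e ▸ this

theorem hasTm_nontrivInd_typesInd {t : Tm} (hm : Der (tm [] m Tm.nat))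
    (hX : Der (tm [] X (typesInd i m)))
    (hp : HasTm [] (nontrivInd (i + 1) (succ m) (typesInd i m) X))
    (ht : Der (tm [] t (truncInd (i + 1) (succ (succ (succ m))) (loopTypeInd i m)))) :
    HasTm [] (nontrivInd (i + 2) (succ (succ m)) (typesInd (i + 1) (succ m))
      (pair (loopTypeInd i m) t)) := by
  obtain ⟨p, hp⟩ := hp
  have h := (inh_loopTyTypesU.hasTm (T := pi Tm.nat (pi (typesInd 0 (Tm.var 0))
    (pi (nontrivInd 1 (succ (Tm.var 1)) (typesInd 0 (Tm.var 1)) (Tm.var 0))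
      (pi (truncInd 1 (succ (succ (succ (Tm.var 2)))) (loopTypeInd 0 (Tm.var 2)))
        (nontrivInd 2 (succ (succ (Tm.var 3))) (typesInd 1 (succ (Tm.var 3)))
          (pair (loopTypeInd 0 (Tm.var 3)) (Tm.var 0)))))))
    (by decide +kernel)).shift i
  have hc := der_ctx_nontriv i
  have hm' := Der.var (k := 2) hc rfl
  have hσ := (isSub_nontriv hm hX hp).cons (a := t)
    (A := truncInd (i + 1) (succ (succ (succ (Tm.var 2)))) (loopTypeInd i (Tm.var 2)))
    (by rwa [subst_truncInd, subst_loopTypeInd])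
  have := ((((h.of_pi der_ctx_nat).of_pi (der_ctx_types i)).of_pi hc).of_pi
    (.ctx_cons (truncInd_form (.nat_intro_succ (.nat_intro_succ (.nat_intro_succ hm')))
      (loopTypeInd_form hm')))).subst .ctx_nil hσ
  have e := subst_nontrivInd (Tm.cons t (Tm.cons p (Tm.cons X (Tm.cons m Tm.var)))) (i + 2)
    (succ (succ (Tm.var 3))) (typesInd (i + 1) (succ (Tm.var 3)))
    (pair (loopTypeInd i (Tm.var 3)) (Tm.var 0))
  simp only [subst, subst_loopTypeInd, subst_typesInd] at e
  exact e ▸ this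

/-! ### Truncatedness and loop spaces at numerals -/

theorem subst_isTrunc (σ : ℕ → Tm) (k : ℕ) (A : Tm) :
    subst σ (isTrunc k A) = isTrunc k (subst σ A) := by
  induction k generalizing σ A with
  | zero => simp only [isTrunc, isContr, subst, subst_lift_one, subst_lift_two]; rfl
  | succ k ih => simp only [isTrunc, subst, subst_lift_one, subst_lift_two, ih]; rfl

theorem isTrunc_form (k : ℕ) (hA : Der (tm Γ A (U i))) : Der (tm Γ (isTrunc k A) (U i)) :=
  ((EqD.refl hA (.U_intro hA.ctx_of_tm)).isTrunc k).tm

theorem truncU_form (i n : ℕ) (hΓ : Der (ctx Γ)) : Der (tm Γ (truncU i n) (U (i + 1))) :=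
  .sigma_form (.U_intro hΓ) (.U_cumul (isTrunc_form _ (.var (A := U i) (der_ctx_U hΓ) rfl)))

theorem typesInd_num (i n : ℕ) (hΓ : Der (ctx Γ)) :
    EqD Γ (typesInd i (num n)) (truncU i n) (U (i + 1)) := by
  have h := (EqD.refl (.U_intro hΓ) (.U_intro hΓ)).sigma
    ((truncInd_num (n + 2) (.var (k := 0) (der_ctx_U hΓ) rfl)).cumul i.le_succ)
  rw [max_self] at h
  rw [typesInd, lift_num]
  exact h

theorem PointedEq.loopsInd_num {X Y : Pointed} (hA : Der (tm Γ X.carrier (U i)))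
    (ha : Der (tm Γ X.point X.carrier)) (h : PointedEq Γ i X Y) (k : ℕ) :
    PointedEq Γ i ⟨loopsInd i (num k) X.carrier X.point, baseInd i (num k) X.carrier X.point⟩
      (Y.iterLoop k) :=
  (HoTT.loopsInd_num k hA ha).trans (h.iterLoop k)

theorem loopTypeInd_num (n : ℕ) (hΓ : Der (ctx Γ)) :
    EqD Γ (loopTypeInd n (num n)) (loopType n) (U (n + 1)) := by
  have h := typesInd_num n n hΓ
  have hc := Der.ctx_cons h.tm
  have h1 := h.weaken hc
  have hv : Der (tm (truncU n n :: Γ) (Tm.var 0) (lift 1 (truncU n n))) := .var hc rfl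
  have hp : PointedEq (truncU n n :: Γ) (n + 1) ⟨lift 1 (typesInd n (num n)), Tm.var 0⟩
    ⟨lift 1 (truncU n n), Tm.var 0⟩ := ⟨h1, .refl hv h1.tm⟩
  have := h.sigma (hp.loopsInd_num ((typesInd_form (num_form hΓ n)).weaken hc)
    (.conv hv h1.eq.eq_symm) (n + 1)).carrier
  rw [max_self] at this
  rw [loopTypeInd, lift_num]
  exact this

theorem loopTypePred_form (n : ℕ) (hΓ : Der (ctx Γ)) : Der (tm Γ (loopTypePred n) (U n)) := by
  cases n with
  | zero => exact .sum_form (.unit_form hΓ) (.unit_form hΓ)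
  | succ n => exact (loopTypeInd_num n hΓ).tm

/-! ### The types of loops in the universes -/

/-- `Loop_{n-1}` is an `n`-type, and the `(n + 1)`-fold loop spaces at it of `U_n` and of the type
of `n`-types in `U_n` have non-trivial inhabitants. -/
def LoopsNontrivial (n : ℕ) : Prop :=
  HasNontrivialInhabitant (Pointed.iterLoop (n + 1) ⟨U n, loopTypePred n⟩) ∧
    (∃ h, Inhabits h (isType n (loopTypePred n))) ∧
    ∀ h, Inhabits h (isType n (loopTypePred n)) →
      HasNontrivialInhabitant
        (Pointed.iterLoop (n + 1) ⟨truncU n n, Tm.pair (loopTypePred n) h⟩)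

theorem der_pair {n : ℕ} {h : Tm} (hh : Inhabits h (isType n (loopTypePred n))) :
    Der (tm [] (pair (loopTypePred n) h) (truncU n n)) :=
  .sigma_intro (isTrunc_form _ (.var (A := U n) (der_ctx_U .ctx_nil) rfl))
    (loopTypePred_form n .ctx_nil) (by rw [inst, isType, subst_isTrunc]; exact hh)

/-- The external types are judgmentally equal to the internal ones at numerals, so everything moves
by conversion. The level `j` is free because `isTrunc` does not mention a universe, while `truncInd`
does. -/
theorem LoopsNontrivial.of_ind {n : ℕ} (hj : n ≤ j) (hL : Der (tm [] L (U n)))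
    (h : EqD [] L (loopTypePred n) (U n))
    (h1 : HasTm [] (nontrivInd (n + 1) (num (n + 1)) (U n) L))
    (h2 : HasTm [] (truncInd j (num (n + 2)) L))
    (h3 : ∀ t, Der (tm [] t (truncInd n (num (n + 2)) L)) →
      HasTm [] (nontrivInd (n + 1) (num (n + 1)) (typesInd n (num n)) (pair L t))) :
    LoopsNontrivial n := by
  have hU : Der (tm [] (U n) (U (n + 1))) := .U_intro .ctx_nil
  refine ⟨?_, ?_, fun t ht => ?_⟩
  · have hp : PointedEq [] (n + 1) ⟨U n, L⟩ ⟨U n, loopTypePred n⟩ :=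
      ⟨.refl hU (.U_intro .ctx_nil), h⟩
    have hp := hp.loopsInd_num hU hL (n + 1)
    exact (h1.conv hp.nontriv).hasNontrivialInhabitant hp.carrier.tm hp.point.tm
  · exact h2.conv ((truncInd_num (n + 2) (hL.cumul_le hj)).trans ((h.cumul hj).isTrunc (n + 2)))
  -- The given proof `t`, whichever it is, also inhabits the internal form of truncatedness. It can
  -- hence be used in the internal statement, which quantifies over all such proofs.
  · have ht' := Der.conv ht ((truncInd_num (n + 2) hL).trans (h.isTrunc (n + 2))).eq.eq_symm
    have hT := typesInd_num (Γ := []) n n .ctx_nil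
    have hS := truncU_form (Γ := []) n n .ctx_nil
    obtain ⟨_, _, hB⟩ := hS.inv_sigma
    have hi (A : Tm) : inst (isType n (Tm.var 0)) A = isTrunc (n + 2) A := by
      rw [inst, isType, subst_isTrunc]; rfl
    have hB' := hB.inst_ty (loopTypePred_form n .ctx_nil)
    rw [hi] at hB'
    have hp : PointedEq [] (n + 1) ⟨typesInd n (num n), pair L t⟩
        ⟨truncU n n, pair (loopTypePred n) t⟩ :=
      ⟨hT, .pair ⟨_, hS⟩ h (by rw [hi]; exact .refl ht hB')⟩
    have hp := hp.loopsInd_num (typesInd_form (num_form .ctx_nil n))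
      (.conv (.sigma_intro hB hL (by rw [hi]; exact .conv ht' (truncInd_num (n + 2) hL).eq))
        hT.eq.eq_symm) (n + 1)
    exact ((h3 t ht').conv hp.nontriv).hasNontrivialInhabitant hp.carrier.tm hp.point.tm

theorem loopsNontrivial (n : ℕ) : LoopsNontrivial n := by
  induction n with
  | zero =>
    have hL := loopTypePred_form (Γ := []) 0 .ctx_nil
    -- That `2` is a set is derived with `trunc 1`, one level above the universe of `2`.
    refine .of_ind (j := 1) (L := Tm.two) (Nat.zero_le _) hL (.refl hL (.U_intro .ctx_nil))
      (inh_twoU.hasTm (by decide +kernel)) (inh_truncTwo.hasTm (by decide +kernel)) fun t ht => ?_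
    have h := inh_twoTypesU.hasTm (T := pi (truncInd 0 (num 2) Tm.two)
      (nontrivInd 1 (num 1) (typesInd 0 (num 0)) (pair Tm.two (Tm.var 0)))) (by decide +kernel)
    exact (h.of_pi (.ctx_cons (truncInd_form (num_form .ctx_nil 2) hL))).subst .ctx_nil
      ((isSub_nil [] Tm.var).cons ht)
  | succ n ih =>
    -- The loop in the bare universe is not used again. What feeds the step is the non-trivial loop
    -- at `(Loop_{n-1}, t)` in the type of `n`-types, for one chosen proof `t`.
    obtain ⟨-, ⟨t, ht⟩, h⟩ := ih
    have hm := num_form .ctx_nil n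
    have hX := der_pair ht
    have hT := typesInd_num (Γ := []) n n .ctx_nil
    have hX' := Der.conv hX hT.eq.eq_symm
    have hp : PointedEq [] (n + 1) ⟨typesInd n (num n), pair (loopTypePred n) t⟩
      ⟨truncU n n, pair (loopTypePred n) t⟩ := ⟨hT, .refl hX hT.tm⟩
    have hp := hp.loopsInd_num (typesInd_form hm) hX' (n + 1)
    have hn := ((h t ht).hasTm hp.carrier.tm hp.point.tm).conv_symm hp.nontriv
    exact .of_ind le_rfl (loopTypeInd_form hm) (loopTypeInd_num n .ctx_nil)
      (hasTm_nontrivInd_U hm hX' hn) (hasTm_truncInd_loopTypeInd hm)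
      fun t => hasTm_nontrivInd_typesInd hm hX' hn

end HoTT

theorem mainTheorem4 (n : ℕ) :
    HoTT.HasNontrivialInhabitant
        (HoTT.Pointed.iterLoop (n + 1) ⟨HoTT.Tm.U n, HoTT.loopTypePred n⟩) ∧
      (∃ h : HoTT.Tm, HoTT.Inhabits h (HoTT.Tm.isType n (HoTT.loopTypePred n))) ∧
      ∀ h : HoTT.Tm, HoTT.Inhabits h (HoTT.Tm.isType n (HoTT.loopTypePred n)) →
        HoTT.HasNontrivialInhabitant
          (HoTT.Pointed.iterLoop (n + 1)
            ⟨HoTT.truncU n n, HoTT.Tm.pair (HoTT.loopTypePred n) h⟩) :=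
  HoTT.loopsNontrivial n
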